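/- **Notation.** For a prime power $q$ and integers $n,s\ge 0$ let $\binom{n}{s}_q=\prod_{i=0}^{s-1}\frac{q^n-q^i}{q^s-q^i}$ (so $\binom n0_q=1$). For $q$ odd put $\sigma_q(n,0)=1$, $\sigma_q(n,s)=0$ for $s>\lfloor n/2\rfloor$, and for $1\le s\le\lfloor n/2\rfloor$ $$\sigma_q(n,s)=\begin{cases}\dfrac{\prod_{i=0}^{s-1}(q^{n-1-2i}-1)}{\prod_{j=1}^{s}(q^j-1)} & n\text{ odd},\\[2ex] \dfrac{(q^{n-s}-\nu q^{n/2-s}+\nu q^{n/2}-1)\prod_{i=1}^{s-1}(q^{n-2i}-1)}{\prod_{j=1}^{s}(q^j-1)} & n\text{ even},\end{cases}$$ where $\nu=1$ if $(-1)^{n/2}$ is a square in $\mathbb F_q$ and $\nu=-1$ otherwise. For integers $N_1,N_2\geq 0$, $\mathbf k=(k_0,k_1,k_2)$ and $\boldsymbol\ell=(\ell_0,\ell_1)$ with non-negative integer entries put $$\Theta_3(\mathbf k;\boldsymbol\ell)=(N_1-3k_0-k_1-k_2)(k_0+2\ell_0+k_1+\ell_1)+k_0(N_1+2N_2-1)+k_1(N_2-2\ell_0-\ell_1)+\ell_0\left(N_2-\tfrac32\ell_0-\ell_1+k_2-\tfrac12\right),$$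 $$T_q^{N_1,N_2}(\mathbf k;\boldsymbol\ell)=\sigma_q(N_1,k_0+k_1)\,\sigma_q(N_2,\ell_0)\binom{N_1-2k_0-k_1}{k_2}_q\binom{N_2-2\ell_0}{\ell_1}_q\binom{k_0+k_1}{k_0}_q\,q^{\Theta_3(\mathbf k;\boldsymbol\ell)},$$ $$S_q(N_1,N_2)=\sum_{k_0=0}^{\lfloor N_1/2\rfloor}\ \sum_{k_1=0}^{\lfloor N_1/2\rfloor-k_0}\ \sum_{k_2=0}^{N_1-2k_0-k_1}\ \sum_{\ell_0=0}^{\lfloor N_2/2\rfloor}\ \sum_{\ell_1=0}^{N_2-2\ell_0}T_q^{N_1,N_2}(\mathbf k;\boldsymbol\ell).$$ **Codes.** Let $R_3$ be a finite commutative chain ring of odd characteristic, with maximal ideal $\langle\gamma\rangle$ of nilpotency index $3$ and residue field $\mathbb F_q$, and let $R_2=R_3/\langle\gamma^2\rangle$. An $R_3R_2$-linear code of block-length $(N_1,N_2)$ is an $R_3$-submodule $\mathscr C$ of $R_3^{N_1}\oplus R_2^{N_2}$; it is Euclidean self-orthogonal if $\sum_i c_ic_i'+\gamma\sum_j d_jd_j'=0$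 in $R_3$ for all $(c|d),(c'|d')\in\mathscr C$. It is of type $\{k_0,k_1,k_2;\ell_0,\ell_1\}$ if, after a permutation of the first $N_1$ and a permutation of the last $N_2$ coordinates, it is generated by the rows of a matrix $$\left[\begin{array}{c|c}A&B\\ C&D\end{array}\right]=\left[\begin{array}{cccc|ccc} I_{k_0}&A_{01}&A_{02}&A_{03}&0&B_{01}&B_{02}\\ 0&\gamma I_{k_1}&\gamma A_{12}&\gamma A_{13}&0&0&\gamma B_{12}\\ 0&0&\gamma^2I_{k_2}&\gamma^2A_{23}&0&0&0\\ 0&0&\gamma C_{02}&\gamma C_{03}&I_{\ell_0}&D_{01}&D_{02}\\ 0&0&0&\gamma^2C_{13}&0&\gamma I_{\ell_1}&\gamma D_{12}\end{array}\right].$$ With the coordinates permuted back, let $\mathscr C^{(X)}$ and $\mathscr C^{(Y)}$ be the linear codes over $R_3$ and $R_2$ generated by the rows of $A$ and of $D$. The $i$-th torsion code $Tor_i$ of such a linear code consists of the reductions modulo $\gamma$ of all words $c$ such that $\gamma^{i-1}c$ lies in the code. **Theorem.** Let $R_3$ be as above, and let $N_1,N_2$ be non-negative integers. 1. Let $E_1\subseteq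 E_2\subseteq E_3\subseteq\mathbb F_q^{N_1}$ and $E_4\subseteq E_5\subseteq\mathbb F_q^{N_2}$ be subspaces of dimensions $k_0,\ k_0+k_1,\ k_0+k_1+k_2$ and $\ell_0,\ \ell_0+\ell_1$ with $E_3\subseteq E_1^{\perp}$, $E_2\subseteq E_2^\perp$ and $E_5\subseteq E_4^\perp$ for the standard inner products. There are precisely $q^{\Theta_3(\mathbf k;\boldsymbol\ell)}$ Euclidean self-orthogonal $R_3R_2$-linear codes $\mathscr C$ of block-length $(N_1,N_2)$ with $Tor_i(\mathscr C^{(X)})=E_i$ for $i=1,2,3$, $Tor_1(\mathscr C^{(Y)})=E_4$ and $Tor_2(\mathscr C^{(Y)})=E_5$. 2. The number of Euclidean self-orthogonal $R_3R_2$-linear codes of block-length $(N_1,N_2)$ and type $\{k_0,k_1,k_2;\ell_0,\ell_1\}$ is $T_q^{N_1,N_2}(\mathbf k;\boldsymbol\ell)$ if $2k_0+2k_1\le N_1$, $2k_0+k_1+k_2\le N_1$ and $2\ell_0+\ell_1\le N_2$, and it is $0$ otherwise. 3. The number of all Euclidean self-orthogonal $R_3R_2$-linear codes of block-length $(N_1,N_2)$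 is $S_q(N_1,N_2)$. 4. Let $p$ be an odd prime, $1\le t\le k$, $r\ge1$ and $N\ge0$ integers, $GR(p^3,r)=(\mathbb Z/p^3)[x]/\langle h(x)\rangle$ with $h$ monic of degree $r$ and irreducible modulo $p$, and $\mathcal R_3=GR(p^3,r)[y]/\langle g(y),p^2y^t\rangle$, where $g(y)=y^k+p(g_{k-1}y^{k-1}+\cdots+g_1y+g_0)$ with $g_0$ a unit. Every $a\in\mathcal R_3$ has a unique expression $a=\sum_{i=0}^{k-1}\sum_{s=0}^{r-1}a_{i,s}x^sy^i$ with $a_{i,s}\in\mathbb Z/p^3$ for $i<t$ and $a_{i,s}\in\mathbb Z/p^2$ for $i\ge t$. Fix a primitive $p^3$-th root of unity $\xi\in\mathbb C$ and put $\chi_a(b)=\xi^{\sum_{i<t,\,s}a_{i,s}b_{i,s}+p\sum_{t\le i<k,\,s}a_{i,s}b_{i,s}}$. An additive code of length $N$ over $\mathcal R_3$ is an additive subgroup $\mathcal C$ of $\mathcal R_3^N$; it is self-orthogonal if $\prod_{i}\chi_{d_i}(c_i)=1$ for all $c,d\in\mathcal C$. The number of self-orthogonal additive codes of length $N$ over $\mathcal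 R_3$ is $S_p\bigl(Nrt,\,Nr(k-t)\bigr)$. -/

import Mathlib

open Polynomial

noncomputable section

/-! ### The chain ring, its quotient, and codes over the mixed alphabet -/

/-- `R` is a chain ring whose maximal ideal is generated by `γ` and has nilpotency index `3`.
(A local ring whose maximal ideal is principal and nilpotent is a chain ring: its ideals are the
powers of the maximal ideal.) -/
structure IsChainRing3 (R : Type*) [CommRing R] [IsLocalRing R] (γ : R) : Prop where
  maximalIdeal_eq : IsLocalRing.maximalIdeal R = Ideal.span {γ}
  pow_three : γ ^ 3 = 0
  sq_ne_zero : γ ^ 2 ≠ 0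

/-- The quotient ring `R₂ = R / ⟨γ²⟩` of the chain ring `R = R₃`. -/
abbrev ChainQuot {R : Type*} [CommRing R] (γ : R) : Type _ := R ⧸ Ideal.span {γ ^ 2}

/-- The ambient module `R₃^{N₁} ⊕ R₂^{N₂}`.  An `R₃R₂`-linear code of block-length `(N₁, N₂)` is
an `R₃`-submodule of it. -/
abbrev Ambient {R : Type*} [CommRing R] (γ : R) (N₁ N₂ : ℕ) : Type _ :=
  (Fin N₁ → R) × (Fin N₂ → ChainQuot γ)

/-- Multiplication by `γ` as a map `R₂ = R / ⟨γ²⟩ → R`, well defined because `γ³ = 0`. -/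
def gammaMul {R : Type*} [CommRing R] {γ : R} (hγ : γ ^ 3 = 0) : ChainQuot γ →ₗ[R] R :=
  Submodule.liftQ (Ideal.span {γ ^ 2}) (LinearMap.mulLeft R γ) (by
    rw [Ideal.span, Submodule.span_le]
    rintro x rfl
    simp only [SetLike.mem_coe, LinearMap.mem_ker, LinearMap.mulLeft_apply]
    rw [← hγ]; ring)

/-- The Euclidean bilinear form `∑ cᵢ cᵢ' + γ ∑ dⱼ dⱼ'`, with values in `R`. -/
def euclForm {R : Type*} [CommRing R] {γ : R} (hγ : γ ^ 3 = 0) {N₁ N₂ : ℕ}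
    (m m' : Ambient γ N₁ N₂) : R :=
  ∑ i, m.1 i * m'.1 i + gammaMul hγ (∑ j, m.2 j * m'.2 j)

/-- The code `C` is Euclidean self-orthogonal: `C ⊆ C^⊥`. -/
def IsSelfOrthogonal {R : Type*} [CommRing R] {γ : R} (hγ : γ ^ 3 = 0) {N₁ N₂ : ℕ}
    (C : Submodule R (Ambient γ N₁ N₂)) : Prop :=
  ∀ m ∈ C, ∀ m' ∈ C, euclForm hγ m m' = 0

/-! ### Generator matrices in standard form, types and torsion codes -/

/-- Sizes of the four blocks of columns of the `R₃`-part: `k₀, k₁, k₂` and the remaining ones. -/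
def blocksX (N₁ : ℕ) (k : Fin 3 → ℕ) : Fin 4 → ℕ :=
  ![k 0, k 1, k 2, N₁ - (k 0 + k 1 + k 2)]

/-- Sizes of the three blocks of columns of the `R₂`-part: `ℓ₀, ℓ₁` and the remaining ones. -/
def blocksY (N₂ : ℕ) (l : Fin 2 → ℕ) : Fin 3 → ℕ :=
  ![l 0, l 1, N₂ - (l 0 + l 1)]

/-- A generator matrix which, after a permutation of the first `N₁` and of the last `N₂` coordinates
(given by the groupings `colX`, `colY` of the columns into blocks), is in the standard form
```
  I   A₀₁   A₀₂    A₀₃   |  0   B₀₁   B₀₂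
  0   γI    γA₁₂   γA₁₃  |  0   0     γB₁₂
  0   0     γ²I    γ²A₂₃ |  0   0     0
  0   0     γC₀₂   γC₀₃  |  I   D₀₁   D₀₂
  0   0     0      γ²C₁₃ |  0   γI    γD₁₂
```
with block sizes `k = (k₀, k₁, k₂)` and `l = (ℓ₀, ℓ₁)`. A row of the upper part has the label
`⟨i, a⟩` (the `a`-th row of the `i`-th block of rows), and likewise for the lower part. -/
structure MixedStdGen {R : Type*} [CommRing R] (γ : R) (N₁ N₂ : ℕ) (k : Fin 3 → ℕ) (l : Fin 2 → ℕ) where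
  colX : Fin N₁ ≃ Σ j : Fin 4, Fin (blocksX N₁ k j)
  colY : Fin N₂ ≃ Σ j : Fin 3, Fin (blocksY N₂ l j)
  A : Matrix (Σ i : Fin 3, Fin (k i)) (Fin N₁) R
  B : Matrix (Σ i : Fin 3, Fin (k i)) (Fin N₂) (ChainQuot γ)
  C : Matrix (Σ i : Fin 2, Fin (l i)) (Fin N₁) R
  D : Matrix (Σ i : Fin 2, Fin (l i)) (Fin N₂) (ChainQuot γ)
  A_lower : ∀ i a j b, j.val < i.val → A ⟨i, a⟩ (colX.symm ⟨j, b⟩) = 0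
  A_diag : ∀ i a j b, j.val = i.val →
    A ⟨i, a⟩ (colX.symm ⟨j, b⟩) = if b.val = a.val then γ ^ i.val else 0
  A_upper : ∀ i a j b, i.val < j.val → γ ^ i.val ∣ A ⟨i, a⟩ (colX.symm ⟨j, b⟩)
  B_lower : ∀ i a j b, j.val ≤ i.val → B ⟨i, a⟩ (colY.symm ⟨j, b⟩) = 0
  B_upper : ∀ i a j b, i.val < j.val →
    algebraMap R (ChainQuot γ) γ ^ i.val ∣ B ⟨i, a⟩ (colY.symm ⟨j, b⟩)
  C_lower : ∀ i a j b, j.val ≤ i.val + 1 → C ⟨i, a⟩ (colX.symm ⟨j, b⟩) = 0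
  C_upper : ∀ i a j b, i.val + 1 < j.val → γ ^ (i.val + 1) ∣ C ⟨i, a⟩ (colX.symm ⟨j, b⟩)
  D_lower : ∀ i a j b, j.val < i.val → D ⟨i, a⟩ (colY.symm ⟨j, b⟩) = 0
  D_diag : ∀ i a j b, j.val = i.val →
    D ⟨i, a⟩ (colY.symm ⟨j, b⟩) = if b.val = a.val then algebraMap R (ChainQuot γ) γ ^ i.val else 0
  D_upper : ∀ i a j b, i.val < j.val →
    algebraMap R (ChainQuot γ) γ ^ i.val ∣ D ⟨i, a⟩ (colY.symm ⟨j, b⟩)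

namespace MixedStdGen

variable {R : Type*} [CommRing R] {γ : R} {N₁ N₂ : ℕ} {k : Fin 3 → ℕ} {l : Fin 2 → ℕ}

/-- The code generated by the rows of the matrix `[A | B ; C | D]`. -/
def code (G : MixedStdGen γ N₁ N₂ k l) : Submodule R (Ambient γ N₁ N₂) :=
  Submodule.span R
    (Set.range (fun x => ((G.A x, G.B x) : Ambient γ N₁ N₂)) ∪
      Set.range (fun x => ((G.C x, G.D x) : Ambient γ N₁ N₂)))

/-- The linear code `C^{(X)}` of length `N₁` over `R₃` with generator matrix `A`. -/
def codeX (G : MixedStdGen γ N₁ N₂ k l) : Submodule R (Fin N₁ → R) :=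
  Submodule.span R (Set.range G.A)

/-- The linear code `C^{(Y)}` of length `N₂` over `R₂` with generator matrix `D`. -/
def codeY (G : MixedStdGen γ N₁ N₂ k l) : Submodule R (Fin N₂ → ChainQuot γ) :=
  Submodule.span R (Set.range G.D)

end MixedStdGen

/-- The code `C` is of type `{k₀, k₁, k₂; ℓ₀, ℓ₁}`. -/
def HasType {R : Type*} [CommRing R] {γ : R} {N₁ N₂ : ℕ} (C : Submodule R (Ambient γ N₁ N₂))
    (k₀ k₁ k₂ l₀ l₁ : ℕ) : Prop :=
  ∃ G : MixedStdGen γ N₁ N₂ ![k₀, k₁, k₂] ![l₀, l₁], G.code = C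

/-- The torsion code `{c̄ : γ^m c ∈ C for some c}` of a linear code `C` over `S = R` or over a
quotient `S` of `R` (words over `S` are represented by words over `R`); it is the `(m+1)`-st torsion
code. -/
def torsionCode {R : Type*} [CommRing R] [IsLocalRing R] (γ : R) {S : Type*} [CommRing S]
    [Algebra R S] {n : ℕ} (C : Submodule R (Fin n → S)) (m : ℕ) :
    Set (Fin n → IsLocalRing.ResidueField R) :=
  {v | ∃ c : Fin n → R, (fun i => algebraMap R S (γ ^ m * c i)) ∈ C ∧
    ∀ i, IsLocalRing.residue R (c i) = v i}

/-- `E₁, E₂, E₃` are the torsion codes of `C^{(X)}`, and `E₄, E₅` those of `C^{(Y)}`, where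
`C^{(X)}` and `C^{(Y)}` are read off from a generator matrix of `C` in standard form (the torsion
codes do not depend on which one). -/
def HasTorsionCodes {R : Type*} [CommRing R] [IsLocalRing R] {γ : R} {N₁ N₂ : ℕ}
    (C : Submodule R (Ambient γ N₁ N₂))
    (E₁ E₂ E₃ : Submodule (IsLocalRing.ResidueField R) (Fin N₁ → IsLocalRing.ResidueField R))
    (E₄ E₅ : Submodule (IsLocalRing.ResidueField R) (Fin N₂ → IsLocalRing.ResidueField R)) : Prop :=
  ∃ (k : Fin 3 → ℕ) (l : Fin 2 → ℕ) (G : MixedStdGen γ N₁ N₂ k l), G.code = C ∧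
    torsionCode γ G.codeX 0 = E₁ ∧ torsionCode γ G.codeX 1 = E₂ ∧ torsionCode γ G.codeX 2 = E₃ ∧
    torsionCode γ G.codeY 0 = E₄ ∧ torsionCode γ G.codeY 1 = E₅

/-- `E ⊆ E'^⊥` for linear codes over a field, with respect to the Euclidean inner product. -/
def LeDual {F : Type*} [Field F] {n : ℕ} (E E' : Submodule F (Fin n → F)) : Prop :=
  ∀ x ∈ E, ∀ y ∈ E', ∑ i, x i * y i = 0

/-! ### The quantities in the enumeration formula -/

/-- The Gaussian binomial coefficient. -/
def gaussBinom (q : ℚ) (n s : ℕ) : ℚ :=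
  ∏ i ∈ Finset.range s, (q ^ n - q ^ i) / (q ^ s - q ^ i)

open Classical in
/-- The sign `ν`: `1` if `(-1)^{n/2}` is a square in `F`, and `-1` otherwise (`n` even). -/
def nuSign (F : Type*) [Field F] (n : ℕ) : ℚ :=
  if IsSquare ((-1 : F) ^ (n / 2)) then 1 else -1

/-- The number `σ_q(n, s)`, by its closed form, for the finite field `F` with `q` elements. -/
def sigmaNum (F : Type*) [Field F] (n s : ℕ) : ℚ :=
  let q : ℚ := Nat.card F
  let ν : ℚ := nuSign F n
  if s = 0 then 1
  else if n / 2 < s then 0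
  else if Odd n then
    (∏ i ∈ Finset.range s, (q ^ (n - 1 - 2 * i) - 1)) / ∏ j ∈ Finset.Icc 1 s, (q ^ j - 1)
  else
    (q ^ (n - s) - ν * q ^ (n / 2 - s) + ν * q ^ (n / 2) - 1) *
      (∏ i ∈ Finset.Icc 1 (s - 1), (q ^ (n - 2 * i) - 1)) / ∏ j ∈ Finset.Icc 1 s, (q ^ j - 1)

/-- The exponent `Θ₃`, an integer; the division is exact, see `theta3_cast`. -/
def theta3 (N₁ N₂ k₀ k₁ k₂ l₀ l₁ : ℤ) : ℤ :=
  (N₁ - 3 * k₀ - k₁ - k₂) * (k₀ + 2 * l₀ + k₁ + l₁) + k₀ * (N₁ + 2 * N₂ - 1)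
    + k₁ * (N₂ - 2 * l₀ - l₁) + (l₀ * (2 * N₂ - 3 * l₀ - 2 * l₁ + 2 * k₂ - 1)) / 2

theorem theta3_cast (N₁ N₂ k₀ k₁ k₂ l₀ l₁ : ℤ) :
    (theta3 N₁ N₂ k₀ k₁ k₂ l₀ l₁ : ℚ) =
      (N₁ - 3 * k₀ - k₁ - k₂) * (k₀ + 2 * l₀ + k₁ + l₁) + k₀ * (N₁ + 2 * N₂ - 1)
        + k₁ * (N₂ - 2 * l₀ - l₁) + l₀ * (N₂ - 3 / 2 * l₀ - l₁ + k₂ - 1 / 2) := by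
  have h : (2 : ℤ) ∣ l₀ * (2 * N₂ - 3 * l₀ - 2 * l₁ + 2 * k₂ - 1) := by
    rcases Int.even_or_odd' l₀ with ⟨m, rfl | rfl⟩
    · exact ⟨m * (2 * N₂ - 3 * (2 * m) - 2 * l₁ + 2 * k₂ - 1), by ring⟩
    · exact ⟨(2 * m + 1) * (N₂ - 3 * m - l₁ + k₂ - 2), by ring⟩
  simp only [theta3]
  push_cast [Int.cast_div h (by norm_num : ((2 : ℤ) : ℚ) ≠ 0)]
  ring

/-- The term of the enumeration formula which belongs to the type `{k₀, k₁, k₂; ℓ₀, ℓ₁}`. -/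
def typeTerm (F : Type*) [Field F] (N₁ N₂ k₀ k₁ k₂ l₀ l₁ : ℕ) : ℚ :=
  let q : ℚ := Nat.card F
  sigmaNum F N₁ (k₀ + k₁) * sigmaNum F N₂ l₀ * gaussBinom q (N₁ - 2 * k₀ - k₁) k₂ *
    gaussBinom q (N₂ - 2 * l₀) l₁ * gaussBinom q (k₀ + k₁) k₀ *
    q ^ theta3 N₁ N₂ k₀ k₁ k₂ l₀ l₁

/-- The sum of the enumeration formula over all types. -/
def enumSum (F : Type*) [Field F] (N₁ N₂ : ℕ) : ℚ :=
  ∑ k₀ ∈ Finset.Icc 0 (N₁ / 2), ∑ k₁ ∈ Finset.Icc 0 (N₁ / 2 - k₀),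
    ∑ k₂ ∈ Finset.Icc 0 (N₁ - 2 * k₀ - k₁), ∑ l₀ ∈ Finset.Icc 0 (N₂ / 2),
      ∑ l₁ ∈ Finset.Icc 0 (N₂ - 2 * l₀), typeTerm F N₁ N₂ k₀ k₁ k₂ l₀ l₁

/-! ### Additive codes over Eisenstein extensions of Galois rings -/

/-- The data of an Eisenstein extension: `h` is a monic basic irreducible polynomial of degree `r`
over `ℤ/p³`, so that `AdjoinRoot h` is the Galois ring `GR(p³, r)`, and
`g = y^k + p (g_{k-1} y^{k-1} + ⋯ + g₀)` is an Eisenstein polynomial over it, with `g₀` a unit. -/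
structure IsEisensteinData (p r k t : ℕ) (h : (ZMod (p ^ 3))[X]) (g : (AdjoinRoot h)[X]) :
    Prop where
  h_monic : h.Monic
  h_natDegree : h.natDegree = r
  h_irreducible :
    Irreducible (h.map (ZMod.castHom (dvd_pow_self p three_ne_zero) (ZMod p)))
  g_monic : g.Monic
  g_natDegree : g.natDegree = k
  g_coeff : ∀ i < k, (p : AdjoinRoot h) ∣ g.coeff i
  g_coeff_zero : ∃ u, IsUnit u ∧ g.coeff 0 = (p : AdjoinRoot h) * u
  t_pos : 1 ≤ t
  t_le : t ≤ k

/-- The ideal `⟨g(y), p² y^t⟩` of `GR(p³, r)[y]`. -/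
def eisIdeal {p : ℕ} {h : (ZMod (p ^ 3))[X]} (t : ℕ) (g : (AdjoinRoot h)[X]) :
    Ideal (AdjoinRoot h)[X] :=
  Ideal.span {g, C ((p : AdjoinRoot h) ^ 2) * X ^ t}

/-- The chain ring `GR(p³, r)[y] / ⟨g(y), p² y^t⟩`. -/
abbrev EisRing {p : ℕ} {h : (ZMod (p ^ 3))[X]} (t : ℕ) (g : (AdjoinRoot h)[X]) : Type :=
  (AdjoinRoot h)[X] ⧸ eisIdeal t g

/-- The group `(ℤ/p³)^{rt} ⊕ (ℤ/p²)^{r(k-t)}`. -/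
abbrev EisCoord (p r k t : ℕ) : Type :=
  (Fin t × Fin r → ZMod (p ^ 3)) × (Fin (k - t) × Fin r → ZMod (p ^ 2))

namespace IsEisensteinData

variable {p r k t : ℕ} {h : (ZMod (p ^ 3))[X]} {g : (AdjoinRoot h)[X]}

/-- The coefficient of `x^s` in the unique expression `a = a₀ + a₁ x + ⋯ + a_{r-1} x^{r-1}` of an
element `a` of the Galois ring. -/
def grCoeff (H : IsEisensteinData p r k t h g) (s : ℕ) : AdjoinRoot h →ₗ[ZMod (p ^ 3)] ZMod (p ^ 3) :=
  lcoeff (ZMod (p ^ 3)) s ∘ₗ (AdjoinRoot.isAdjoinRootMonic h H.h_monic).modByMonicHom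

/-- The coordinates of the class of `f ∈ GR(p³, r)[y]`: reduce `f` modulo `g` to
`a₀ + a₁ y + ⋯ + a_{k-1} y^{k-1}`, and take the coefficients of the `aᵢ` for `i < t` as they are
and those for `t ≤ i < k` modulo `p²`. -/
def prePsi (H : IsEisensteinData p r k t h g) : (AdjoinRoot h)[X] →+ EisCoord p r k t where
  toFun f :=
    (fun x => H.grCoeff x.2 ((f %ₘ g).coeff x.1),
      fun x => ZMod.castHom (pow_dvd_pow p (by norm_num : 2 ≤ 3)) (ZMod (p ^ 2))
        (H.grCoeff x.2 ((f %ₘ g).coeff (t + x.1))))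
  map_zero' := by ext <;> simp
  map_add' f f' := by
    ext
    · simp [add_modByMonic]
    · simp only [add_modByMonic, coeff_add, map_add]; rfl

theorem dvd_coeff (H : IsEisensteinData p r k t h g) (b : (AdjoinRoot h)[X]) {i : ℕ} (hi : i < t) :
    (p : AdjoinRoot h) ∣ ((b * X ^ t) %ₘ g).coeff i := by
  let π := Ideal.Quotient.mk (Ideal.span {(p : AdjoinRoot h)})
  have hπ : ∀ x, π x = 0 ↔ (p : AdjoinRoot h) ∣ x := fun x => by
    rw [Ideal.Quotient.eq_zero_iff_mem, Ideal.mem_span_singleton]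
  have hg : g.map π = X ^ k := by
    ext j
    rw [coeff_map, coeff_X_pow]
    rcases lt_trichotomy j k with hj | rfl | hj
    · rw [if_neg hj.ne, hπ]; exact H.g_coeff j hj
    · have := H.g_monic.coeff_natDegree
      rw [H.g_natDegree] at this
      rw [if_pos rfl, this, map_one]
    · rw [if_neg hj.ne', coeff_eq_zero_of_natDegree_lt (by rw [H.g_natDegree]; exact hj), map_zero]
  have key := congrArg (fun f => (f.map π).coeff i) (modByMonic_add_div (b * X ^ t) g)
  simp only [Polynomial.map_add, Polynomial.map_mul, hg, Polynomial.map_pow, map_X, coeff_add,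
    coeff_X_pow_mul', coeff_mul_X_pow'] at key
  rw [if_neg (by have := H.t_le; omega), if_neg (by omega), add_zero, coeff_map] at key
  exact (hπ _).1 key

theorem prePsi_eq_zero (H : IsEisensteinData p r k t h g) {f : (AdjoinRoot h)[X]}
    (hf : f ∈ eisIdeal t g) : H.prePsi f = 0 := by
  obtain ⟨a, b, rfl⟩ := Ideal.mem_span_pair.1 hf
  have h1 : H.prePsi (a * g) = 0 := by
    have : (a * g) %ₘ g = 0 := (modByMonic_eq_zero_iff_dvd H.g_monic).2 (dvd_mul_left g a)
    ext <;> simp [prePsi, this]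
  have h2 : b * (C ((p : AdjoinRoot h) ^ 2) * X ^ t) = (p ^ 2 : ℕ) • (b * X ^ t) := by
    rw [nsmul_eq_mul, ← C_eq_natCast]; push_cast; ring
  rw [map_add, h1, zero_add, h2, map_nsmul]
  ext x
  · obtain ⟨c, hc⟩ := H.dvd_coeff b x.1.2
    have h3 : (p ^ 2 : ℕ) • ((b * X ^ t) %ₘ g).coeff x.1 = (p ^ 3 : ℕ) • c := by
      rw [hc, nsmul_eq_mul, nsmul_eq_mul]; push_cast; ring
    change (p ^ 2 : ℕ) • H.grCoeff x.2 (((b * X ^ t) %ₘ g).coeff x.1) = 0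
    rw [← map_nsmul, h3, map_nsmul, nsmul_eq_mul, ZMod.natCast_self, zero_mul]
  · change (p ^ 2 : ℕ) • _ = (0 : ZMod (p ^ 2))
    rw [nsmul_eq_mul, ZMod.natCast_self, zero_mul]

/-- The coordinate map `Ψ` from the Eisenstein extension to `(ℤ/p³)^{rt} ⊕ (ℤ/p²)^{r(k-t)}`. -/
def psi (H : IsEisensteinData p r k t h g) : EisRing t g →+ EisCoord p r k t :=
  QuotientAddGroup.lift (eisIdeal t g).toAddSubgroup H.prePsi fun _ hf => H.prePsi_eq_zero hf

/-- The character `χ_a` evaluated at `b`, where `ξ` is a primitive `p³`-th root of unity: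
`ξ` raised to `∑_{i < t} a_{i,s} b_{i,s} + p ∑_{t ≤ j < k} a_{j,s} b_{j,s}`. -/
def chi (H : IsEisensteinData p r k t h g) (ξ : ℂ) (a b : EisRing t g) : ℂ :=
  (∏ x, ξ ^ ((H.psi a).1 x * (H.psi b).1 x).val) *
    ∏ x, ξ ^ (p * ((H.psi a).2 x * (H.psi b).2 x).val)

/-- The additive code `C` of length `N` is self-orthogonal: it is contained in its `χ`-dual code
`{d : χ_d(c) = 1 for all c ∈ C}`. -/
def IsChiSelfOrthogonal (H : IsEisensteinData p r k t h g) (ξ : ℂ) {N : ℕ}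
    (C : AddSubgroup (Fin N → EisRing t g)) : Prop :=
  ∀ d ∈ C, ∀ c ∈ C, ∏ i, H.chi ξ (d i) (c i) = 1

end IsEisensteinData

end

/-! ### Cardinalities of fibres and of submodules -/

/-! Filter the ambient module by M₀ ⊇ M₁ ⊇ ⋯ ⊇ M₅ = 0, where M_j consists of the words (γ^⌈j/2⌉ x |
γ^⌊j/2⌋ y). Multiplication by γ maps M_j into M_{j+2}, and the successive quotients are alternately
F^N₁ and F^N₂ over the residue field F. The pieces (C ∩ M_j + M_{j+1}) / M_{j+1} of a code C are
subspaces E₁, E₄, E₂, E₅, E₃, in this order. For a code with a generator matrix in standard form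
these are the torsion codes of the parts A and D; conversely, information sets of the pieces allow
Gaussian elimination to standard form. Hence the torsion codes and the type are intrinsic to C
(`hasTorsionCodes_iff`, `hasType_iff`). Self-orthogonality forces E₃ ⊥ E₁, E₂ ⊥ E₂ and E₅ ⊥ E₄,
because the pairings of words from these layers have γ² times the inner product as leading term.

Codes with given pieces are built one layer at a time through the modules C + M_i. Refining D = C +
M_i means lifting generators of D by corrections in M_i, which matter only modulo the prescribed
intersection with M_i. The four steps impose, in turn: no condition; that the form is divisible by
γ²; that it also vanishes on the part inside M₁; that it vanishes. At each step the form, or γ times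
it, takes values in the socle γ²R ≅ F, and M_i maps onto the dual of the relevant quotient W₁/W. The
conditions on the corrections are therefore independent linear equations together with a system t +
tᵀ = s, solvable because 2 is invertible. So the number of refinements depends on dimensions only
(`card_isotropic_lifts`), and the four numbers multiply to q^Θ₃
(`card_selfOrthogonal_hasPieces_eq_zpow`).

It remains to count flags of pieces. Self-orthogonal subspaces are counted by extending them one
vector at a time, which needs the number of zeros of a sum of squares (`card_isotropic_subspaces`);
the other members of the flags lie between two given subspaces and contribute Gaussian binomials.
Summing q^Θ₃ over the flags of one type gives T, and summing over types gives S.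

For additive codes over an Eisenstein extension, the coordinates give an isomorphism of groups onto
the mixed alphabet ℤ/p³, ℤ/p² with γ = p. Subgroups are the same as ℤ/p³-submodules, and the product
of characters is ξ raised to the Euclidean form, so the count of all self-orthogonal codes applies.
-/

theorem Nat.card_eq_card_mul_of_fiber {α β : Type*} [Finite α] [Finite β] (f : α → β) (n : ℕ)
    (h : ∀ b, Nat.card {a // f a = b} = n) : Nat.card α = Nat.card β * n := by
  classical
  have := Fintype.ofFinite β
  rw [← Nat.card_congr (Equiv.sigmaFiberEquiv f), Nat.card_sigma, Finset.sum_congr rfl fun b _ => h b]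
  simp

/-- The fibres of an additive map over the points of its range all have the size of the kernel. -/
theorem AddMonoidHom.card_fiber {G H : Type*} [AddGroup G] [AddGroup H] (f : G →+ H) (g : G) :
    Nat.card {a // f a = f g} = Nat.card f.ker := by
  refine Nat.card_congr ⟨fun a => ⟨a.1 - g, ?_⟩, fun a => ⟨a.1 + g, ?_⟩, fun a => ?_, fun a => ?_⟩
  · rw [AddMonoidHom.mem_ker, map_sub, a.2, sub_self]
  · rw [map_add, AddMonoidHom.mem_ker.1 a.2, zero_add]
  · simp
  · simp

theorem AddMonoidHom.card_eq_of_surjective {G H : Type*} [AddGroup G] [AddGroup H] [Finite G]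
    [Finite H] (f : G →+ H) (hf : Function.Surjective f) :
    Nat.card G = Nat.card H * Nat.card f.ker :=
  Nat.card_eq_card_mul_of_fiber f _ fun b => by
    obtain ⟨g, rfl⟩ := hf b
    exact f.card_fiber g

theorem Submodule.card_eq_card_mul_card_quotient_submoduleOf {R A : Type*} [Ring R] [AddCommGroup A]
    [Module R A] {U W : Submodule R A} (h : U ≤ W) :
    Nat.card W = Nat.card U * Nat.card (W ⧸ U.submoduleOf W) := by
  rw [Submodule.card_eq_card_quotient_mul_card (U.submoduleOf W)]
  congr 1
  exact Nat.card_congr (Submodule.submoduleOfEquivOfLe h).toEquiv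

theorem Submodule.card_mul_card_inf {R A : Type*} [Ring R] [AddCommGroup A]
    [Module R A] (p p' : Submodule R A) :
    Nat.card p * Nat.card p' = Nat.card ↥(p ⊔ p') * Nat.card ↥(p ⊓ p') := by
  have h := Nat.card_congr (LinearMap.quotientInfEquivSupQuotient p p').toEquiv
  have h1 := Submodule.card_eq_card_mul_card_quotient_submoduleOf (inf_le_left : p ⊓ p' ≤ p)
  have h2 := Submodule.card_eq_card_mul_card_quotient_submoduleOf (le_sup_right : p' ≤ p ⊔ p')
  have h3 : (p ⊓ p').submoduleOf p = Submodule.comap p.subtype p ⊓ Submodule.comap p.subtype p' :=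
    rfl
  rw [h1, h2, h3, h]
  change _ = _ * Nat.card (↥(p ⊔ p') ⧸ Submodule.comap (p ⊔ p').subtype p') * _
  ring

/-! ### Relative bases -/

/-- The family `e` represents a basis of `W / U` over the residue field. -/
structure IsRelBasis {R A ι : Type*} [CommRing R] [IsLocalRing R] [AddCommGroup A] [Module R A]
    [Fintype ι] (U W : Submodule R A) (e : ι → A) : Prop where
  sup_span : U ⊔ Submodule.span R (Set.range e) = W
  mem_maximalIdeal : ∀ a : ι → R, ∑ i, a i • e i ∈ U → ∀ i, a i ∈ IsLocalRing.maximalIdeal R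

namespace IsRelBasis

variable {R A ι κ : Type*} [CommRing R] [IsLocalRing R] [AddCommGroup A] [Module R A]
  [Fintype ι] [Fintype κ] {U W X : Submodule R A} {e v : ι → A} {f : κ → A}

/-- Since the maximal ideal sends W into U, the quotient W/U is a vector space over the residue
field, and the comparison of cardinalities says that its dimension is n. Representatives of a basis
form the family. -/
theorem exists_of_card [Finite R] [Finite A] (hUW : U ≤ W)
    (hm : ∀ r ∈ IsLocalRing.maximalIdeal R, ∀ x ∈ W, r • x ∈ U) (n : ℕ)
    (hc : Nat.card W = Nat.card U * Nat.card (IsLocalRing.ResidueField R) ^ n) :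
    ∃ e : Fin n → A, IsRelBasis U W e := by
  let V := W ⧸ U.submoduleOf W
  have htor : Module.IsTorsionBySet R V (IsLocalRing.maximalIdeal R : Set R) := by
    rintro x ⟨r, hr⟩
    obtain ⟨w, rfl⟩ := Submodule.Quotient.mk_surjective _ x
    change r • (Submodule.Quotient.mk w : V) = 0
    rw [← Submodule.Quotient.mk_smul, Submodule.Quotient.mk_eq_zero]
    exact hm r hr w w.2
  let _ : Module (IsLocalRing.ResidueField R) V := htor.module
  have : IsScalarTower R (IsLocalRing.ResidueField R) V := htor.isScalarTower
  have : Finite (IsLocalRing.ResidueField R) :=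
    Finite.of_surjective _ (IsLocalRing.residue_surjective (R := R))
  have : Finite V := Finite.of_surjective _ (Submodule.Quotient.mk_surjective _)
  have hq : 1 < Nat.card (IsLocalRing.ResidueField R) := Finite.one_lt_card
  have hdim : Module.finrank (IsLocalRing.ResidueField R) V = n := by
    have h1 := Submodule.card_eq_card_mul_card_quotient_submoduleOf hUW
    rw [hc] at h1
    have h2 := Nat.eq_of_mul_eq_mul_left Nat.card_pos h1
    rw [Module.natCard_eq_pow_finrank (K := IsLocalRing.ResidueField R) (V := V)] at h2
    exact (Nat.pow_right_injective hq h2).symm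
  let b := Module.finBasisOfFinrankEq (IsLocalRing.ResidueField R) V hdim
  choose e he using fun i => Submodule.Quotient.mk_surjective (U.submoduleOf W) (b i)
  have hres : ∀ (r : R) (x : V), r • x = IsLocalRing.residue R r • x := fun r x =>
    (algebraMap_smul (IsLocalRing.ResidueField R) r x).symm
  refine ⟨fun i => (e i : A), le_antisymm (sup_le hUW ?_) fun x hx => ?_, fun a ha i => ?_⟩
  · rw [Submodule.span_le]
    rintro _ ⟨i, rfl⟩
    exact (e i).2
  · choose a ha using fun i => IsLocalRing.residue_surjective (R := R)
      (b.repr (Submodule.Quotient.mk ⟨x, hx⟩) i)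
    have h : (Submodule.Quotient.mk (⟨x, hx⟩ - ∑ i, a i • e i) : V) = 0 := by
      have h2 := b.sum_repr (Submodule.Quotient.mk ⟨x, hx⟩)
      rw [Submodule.Quotient.mk_sub, sub_eq_zero, ← h2, ← Submodule.mkQ_apply _ (∑ i, a i • e i), map_sum]
      refine Finset.sum_congr rfl fun i _ => ?_
      rw [map_smul, Submodule.mkQ_apply, he, hres, ha]
    rw [Submodule.Quotient.mk_eq_zero] at h
    have h3 : x - ∑ i, a i • (e i : A) ∈ U := by
      have : ((⟨x, hx⟩ - ∑ i, a i • e i : W) : A) ∈ U := h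
      simpa using this
    rw [← sub_add_cancel x (∑ i, a i • (e i : A))]
    exact Submodule.add_mem_sup h3 (Submodule.sum_mem _ fun i _ =>
      Submodule.smul_mem _ _ (Submodule.subset_span ⟨i, rfl⟩))
  · have h : (Submodule.Quotient.mk (∑ i, a i • e i) : V) = 0 := by
      rw [Submodule.Quotient.mk_eq_zero]
      change ((∑ i, a i • e i : W) : A) ∈ U
      simpa using ha
    rw [← Submodule.mkQ_apply, map_sum] at h
    have h2 : ∑ i, IsLocalRing.residue R (a i) • b i = 0 := by
      rw [← h]
      refine Finset.sum_congr rfl fun i _ => ?_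
      rw [map_smul, Submodule.mkQ_apply, he, hres]
    have h3 := Fintype.linearIndependent_iff.1 b.linearIndependent _ h2 i
    rwa [IsLocalRing.residue_eq_zero_iff] at h3

/-- A relation modulo U is also one modulo W, so the coefficients of f lie in the maximal ideal. By
`hm` their contribution falls into U, and a relation for e alone remains. -/
theorem sumElim (he : IsRelBasis U W e) (hf : IsRelBasis W X f)
    (hm : ∀ r ∈ IsLocalRing.maximalIdeal R, ∀ x ∈ X, r • x ∈ U) :
    IsRelBasis U X (Sum.elim e f) := by
  have hfX : ∀ i, f i ∈ X := fun i => by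
    rw [← hf.sup_span]
    exact Submodule.mem_sup_right (Submodule.subset_span ⟨i, rfl⟩)
  have heW : ∀ i, e i ∈ W := fun i => by
    rw [← he.sup_span]
    exact Submodule.mem_sup_right (Submodule.subset_span ⟨i, rfl⟩)
  have hUW : U ≤ W := by rw [← he.sup_span]; exact le_sup_left
  refine ⟨?_, fun a ha => ?_⟩
  · rw [Set.Sum.elim_range, Submodule.span_union, ← sup_assoc, he.sup_span, hf.sup_span]
  · rw [Fintype.sum_sum_type] at ha
    simp only [Sum.elim_inl, Sum.elim_inr] at ha
    have h1 : ∑ i, a (Sum.inl i) • e i ∈ W :=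
      Submodule.sum_mem _ fun i _ => Submodule.smul_mem _ _ (heW i)
    have h2 := hf.mem_maximalIdeal (fun i => a (Sum.inr i)) ((Submodule.add_mem_iff_right _ h1).1 (hUW ha))
    have h3 : ∑ i, a (Sum.inr i) • f i ∈ U :=
      Submodule.sum_mem _ fun i _ => hm _ (h2 i) _ (hfX i)
    have h4 := he.mem_maximalIdeal (fun i => a (Sum.inl i)) ((Submodule.add_mem_iff_left _ h3).1 ha)
    rintro (i | i)
    · exact h4 i
    · exact h2 i

theorem mem (he : IsRelBasis U W e) (i : ι) : e i ∈ W := by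
  rw [← he.sup_span]
  exact Submodule.mem_sup_right (Submodule.subset_span ⟨i, rfl⟩)

theorem le (he : IsRelBasis U W e) : U ≤ W := by
  rw [← he.sup_span]; exact le_sup_left

/-- Only the classes modulo U matter. This permits moving the representatives when lifts are
counted. -/
theorem congr (he : IsRelBasis U W e) (hv : ∀ i, v i - e i ∈ U) : IsRelBasis U W v := by
  refine ⟨le_antisymm (sup_le he.le ?_) ?_, fun a ha => he.mem_maximalIdeal a ?_⟩
  · rw [Submodule.span_le]
    rintro _ ⟨i, rfl⟩
    exact (sub_add_cancel (v i) (e i)) ▸ W.add_mem (he.le (hv i)) (he.mem i)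
  · rw [← he.sup_span]
    refine sup_le le_sup_left ?_
    rw [Submodule.span_le]
    rintro _ ⟨i, rfl⟩
    rw [← sub_sub_cancel (v i) (e i), sub_eq_neg_add]
    exact Submodule.add_mem_sup (U.neg_mem (hv i)) (Submodule.subset_span ⟨i, rfl⟩)
  · have : ∑ i, a i • e i = ∑ i, a i • v i - ∑ i, a i • (v i - e i) := by
      rw [← Finset.sum_sub_distrib]
      exact Finset.sum_congr rfl fun i _ => by rw [smul_sub, sub_sub_cancel]
    rw [this]
    exact U.sub_mem ha (Submodule.sum_mem _ fun i _ => U.smul_mem _ (hv i))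

end IsRelBasis

/-! ### Counting solutions of a symmetric linear system -/

theorem card_lt_pairs (m : ℕ) : Nat.card {p : Fin m × Fin m // p.1 < p.2} = m * (m - 1) / 2 := by
  let e : {p : Fin m × Fin m // p.1 < p.2} ≃ Σ b : Fin m, Fin b :=
    ⟨fun p => ⟨p.1.2, ⟨p.1.1, p.2⟩⟩, fun x => ⟨(⟨x.2, x.2.2.trans x.1.2⟩, x.1), x.2.2⟩,
      fun _ => rfl, fun _ => rfl⟩
  rw [Nat.card_congr e, Nat.card_sigma]
  simp only [Nat.card_eq_fintype_card, Fintype.card_fin]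
  rw [Fin.sum_univ_eq_sum_range (fun i => i) m, Finset.sum_range_id]

/-- As 2 is invertible, the diagonal of t is forced to be s/2 and the entries below it are
determined by those above, which leaves m(m-1)/2 free entries. The factor with exponent m(m+1)/2,
the number of equations, avoids a subtraction. -/
theorem card_add_transpose_eq {F : Type*} [Field F] [Finite F] (h2 : (2 : F) ≠ 0) {m : ℕ}
    (s : Fin m → Fin m → F) (hs : ∀ a b, s a b = s b a) :
    Nat.card {t : Fin m → Fin m → F // ∀ a b, t a b + t b a = s a b} *
      Nat.card F ^ (m * (m + 1) / 2) = Nat.card F ^ (m * m) := by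
  let e : {t : Fin m → Fin m → F // ∀ a b, t a b + t b a = s a b} ≃
      ({p : Fin m × Fin m // p.1 < p.2} → F) :=
    { toFun := fun t p => t.1 p.1.1 p.1.2
      invFun := fun g => ⟨fun a b => if h : a < b then g ⟨(a, b), h⟩ else
          if h : b < a then s a b - g ⟨(b, a), h⟩ else s a b / 2, fun a b => by
        rcases lt_trichotomy a b with h | rfl | h
        · simp [h, h.not_gt, hs b a]
        · simp only [lt_irrefl, dite_false]
          rw [← add_div, ← two_mul, mul_div_cancel_left₀ _ h2]
        · simp [h, h.not_gt]⟩
      left_inv := fun t => by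
        ext a b
        rcases lt_trichotomy a b with h | rfl | h
        · simp [h]
        · have := t.2 a a
          simp only [lt_irrefl, dite_false]
          rw [← this, ← two_mul, mul_div_cancel_left₀ _ h2]
        · simp only [h, h.not_gt, dite_false, dite_true]
          rw [← t.2 a b, add_sub_cancel_right]
      right_inv := fun g => by
        ext ⟨p, hp⟩
        simp [hp] }
  rw [Nat.card_congr e, Nat.card_fun, card_lt_pairs, ← pow_add]
  congr 1
  obtain _ | m := m
  · rfl
  · have h1 : 2 ∣ (m + 1) * m := (Nat.even_mul_succ_self m).two_dvd.trans (by rw [mul_comm])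
    have h3 : 2 ∣ (m + 1) * (m + 2) := (Nat.even_mul_succ_self (m + 1)).two_dvd
    rw [Nat.add_sub_cancel]
    obtain ⟨x, hx⟩ := h1
    obtain ⟨y, hy⟩ := h3
    rw [show m + 1 + 1 = m + 2 from rfl, hx, hy, Nat.mul_div_cancel_left _ two_pos,
      Nat.mul_div_cancel_left _ two_pos]
    nlinarith

/-- The three blocks are independent of each other: the first w entries have prescribed values under
S, the next m satisfy a symmetric system in these values, the last r are free. Each value of S is
taken on a coset of the kernel. -/
theorem card_isotropic_tuples {F U : Type*} [Field F] [Finite F] (h2 : (2 : F) ≠ 0) [AddCommGroup U]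
    [Finite U] {m w r : ℕ} (S : U →+ (Fin m → F)) (hS : Function.Surjective S)
    (s : Fin m → Fin m → F) (hs : ∀ a b, s a b = s b a) (t : Fin w → Fin m → F) :
    Nat.card {u : (Fin w ⊕ Fin m) ⊕ Fin r → U //
        (∀ x b, S (u (.inl (.inl x))) b = t x b) ∧
        ∀ a b, S (u (.inl (.inr a))) b + S (u (.inl (.inr b))) a = s a b} *
      Nat.card F ^ (m * (m + 1) / 2 + m * w) = Nat.card U ^ (w + m + r) := by
  set z := Nat.card S.ker with hz
  have hU : Nat.card U = Nat.card F ^ m * z := by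
    rw [S.card_eq_of_surjective hS, Nat.card_fun, Nat.card_fin]
  have hfib : ∀ v : Fin m → F, Nat.card {x // S x = v} = z := fun v => by
    obtain ⟨x, rfl⟩ := hS v
    exact S.card_fiber x
  have hfibs : ∀ {n : ℕ} (v : Fin n → Fin m → F),
      Nat.card {u : Fin n → U // ∀ x, S (u x) = v x} = z ^ n := fun {n} v => by
    rw [Nat.card_congr (Equiv.subtypePiEquivPi (p := fun x y => S y = v x)), Nat.card_pi]
    simp [hfib]
  -- Group the tuples by their matrix of values under S. Each admissible matrix comes from z ^ m
  -- tuples, z being the size of the kernel.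
  have hm : Nat.card {u : Fin m → U // ∀ a b, S (u a) b + S (u b) a = s a b} =
      Nat.card {t : Fin m → Fin m → F // ∀ a b, t a b + t b a = s a b} * z ^ m := by
    refine Nat.card_eq_card_mul_of_fiber (fun u => ⟨fun a => S (u.1 a), u.2⟩) _ fun v => ?_
    rw [← hfibs v.1]
    refine Nat.card_congr ⟨fun u => ⟨u.1.1, fun x => congrFun (congrArg Subtype.val u.2) x⟩,
      fun u => ⟨⟨u.1, fun a b => by rw [u.2, u.2]; exact v.2 a b⟩, Subtype.ext (funext u.2)⟩,
      fun _ => rfl, fun _ => rfl⟩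
  let e : {u : (Fin w ⊕ Fin m) ⊕ Fin r → U //
        (∀ x b, S (u (.inl (.inl x))) b = t x b) ∧
        ∀ a b, S (u (.inl (.inr a))) b + S (u (.inl (.inr b))) a = s a b} ≃
      {u : Fin w → U // ∀ x, S (u x) = t x} ×
        {u : Fin m → U // ∀ a b, S (u a) b + S (u b) a = s a b} × (Fin r → U) :=
    { toFun := fun u => (⟨fun x => u.1 (.inl (.inl x)), fun x => funext (u.2.1 x)⟩,
        ⟨fun x => u.1 (.inl (.inr x)), u.2.2⟩, fun x => u.1 (.inr x))
      invFun := fun y => ⟨Sum.elim (Sum.elim y.1.1 y.2.1.1) y.2.2,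
        fun x b => congrFun (y.1.2 x) b, y.2.1.2⟩
      left_inv := fun u => by
        apply Subtype.ext
        funext i
        rcases i with (i | i) | i <;> rfl
      right_inv := fun y => rfl }
  rw [Nat.card_congr e, Nat.card_prod, Nat.card_prod, hfibs, hm, Nat.card_fun, Nat.card_fin,
    pow_add (Nat.card F)]
  have h := card_add_transpose_eq h2 s hs
  calc _ = (Nat.card {t : Fin m → Fin m → F // ∀ a b, t a b + t b a = s a b} *
        Nat.card F ^ (m * (m + 1) / 2)) * z ^ m * (Nat.card F ^ (m * w) * z ^ w) * Nat.card U ^ r := by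
          ring
    _ = _ := by
      rw [h, pow_add, pow_add, hU, pow_mul, pow_mul, mul_pow, mul_pow]; ring

/-! ### Counting isotropic lifts of a code -/

section IsotropicLifts

open IsLocalRing

variable {R A : Type*} [CommRing R] [IsLocalRing R] [AddCommGroup A] [Module R A]

/-- The pairing of `U` with a family `e`, read as a map to `F^m` through an embedding `κ` of the
residue field, is surjective if the family is independent modulo the orthogonal of `U`. -/
theorem exists_surjective_pairing (κ : ResidueField R →ₗ[R] R)
    (hκ : Function.Injective κ) (c : A →ₗ[R] A →ₗ[R] R) {U W W₁ : Submodule R A} {m : ℕ}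
    {e : Fin m → A} (he : IsRelBasis W W₁ e) (hUW : U ≤ W)
    (hperp : ∀ y ∈ W₁, (∀ u ∈ U, c u y = 0) → y ∈ W)
    (hκW : ∀ x ∈ W₁, ∀ y ∈ W₁, c x y ∈ LinearMap.range κ) :
    ∃ S : U →ₗ[R] (Fin m → ResidueField R), Function.Surjective S ∧
      ∀ u b, κ (S u b) = c u (e b) := by
  let K := LinearEquiv.ofInjective κ hκ
  let S : U →ₗ[R] (Fin m → ResidueField R) := LinearMap.pi fun b =>
    K.symm.toLinearMap ∘ₗ LinearMap.codRestrict (LinearMap.range κ) (c.flip (e b) ∘ₗ U.subtype)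
      fun u => hκW u (he.le (hUW u.2)) (e b) (he.mem b)
  have hS : ∀ u b, κ (S u b) = c u (e b) := fun u b => by
    have : (K (S u b) : R) = c u (e b) := by
      simp only [S, LinearMap.pi_apply, LinearMap.comp_apply, LinearEquiv.coe_coe,
        LinearEquiv.apply_symm_apply]
      rfl
    exact this
  refine ⟨S, ?_, hS⟩
  -- The range of S is an R-submodule, hence a subspace over the residue field because R maps onto
  -- it.
  let T : Submodule (ResidueField R) (Fin m → ResidueField R) :=
    { carrier := LinearMap.range S
      add_mem' := fun h h' => Submodule.add_mem _ h h'
      zero_mem' := Submodule.zero_mem _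
      smul_mem' := fun a x h => by
        obtain ⟨r, rfl⟩ := IsLocalRing.residue_surjective a
        exact (LinearMap.range S).smul_mem r h }
  suffices hT : T = ⊤ by
    intro v
    have : v ∈ T := hT ▸ Submodule.mem_top
    exact this
  by_contra hT
  -- If the range were proper, a nonzero functional f would vanish on it. Lifting its coefficients
  -- to l, the element ∑ l b • e b is orthogonal to U, hence lies in W; independence of e modulo W
  -- puts every l b in the maximal ideal, so f = 0.
  obtain ⟨f, hf0, hf⟩ := Submodule.exists_le_ker_of_lt_top T (lt_top_iff_ne_top.2 hT)
  choose l hl using fun b => IsLocalRing.residue_surjective (f (Pi.single b 1))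
  have hfx : ∀ x, f x = ∑ b, residue R (l b) * x b := fun x => by
    conv_lhs => rw [← Finset.univ_sum_single x]
    rw [map_sum]
    refine Finset.sum_congr rfl fun b _ => ?_
    rw [hl, ← mul_one (x b), ← smul_eq_mul (x b), Pi.single_smul, map_smul, smul_eq_mul, mul_comm,
      smul_eq_mul, mul_one]
  have h1 : ∑ b, l b • e b ∈ W := by
    refine hperp _ (Submodule.sum_mem _ fun b _ => Submodule.smul_mem _ _ (he.mem b)) fun u hu => ?_
    have h2 : f (S ⟨u, hu⟩) = 0 := hf ⟨⟨u, hu⟩, rfl⟩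
    rw [hfx] at h2
    rw [map_sum]
    calc ∑ b, c u (l b • e b) = κ (∑ b, residue R (l b) * S ⟨u, hu⟩ b) := by
          rw [map_sum]
          refine Finset.sum_congr rfl fun b _ => ?_
          rw [map_smul, ← hS ⟨u, hu⟩ b, ← map_smul]
          rfl
      _ = 0 := by rw [h2, map_zero]
  refine hf0 (LinearMap.ext fun x => ?_)
  rw [hfx]
  refine Finset.sum_eq_zero fun b _ => ?_
  rw [(residue_eq_zero_iff _).2 (he.mem_maximalIdeal l h1 b), zero_mul]

variable [Finite R] [Finite A]

/-- U is the layer being refined, P its prescribed intersection with D', and Q a part that every D'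
must contain. Choose representatives e of bases of W/(Q+U), W₁/W and D/W₁. Every D' is Q plus the
span of lifts e i + v i with v i in U. Since c vanishes on U × W, W × W and Q × W₁, isotropy on W₁
becomes mw linear equations and m(m+1)/2 equations of the shape t + tᵀ = s in the values S (v i);
the lifts of the last r vectors are unrestricted. Two tuples give the same D' exactly when they
differ by elements of P, so the number of tuples is divided by |P|^(w+m+r). -/
theorem card_isotropic_lifts (h2 : (2 : ResidueField R) ≠ 0) (κ : ResidueField R →ₗ[R] R)
    (hκ : Function.Injective κ) (c : A →ₗ[R] A →ₗ[R] R) (hc : ∀ x y, c x y = c y x)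
    {D U P Q W W₁ : Submodule R A} (hPU : P ≤ U) (hPQ : P ≤ Q) (hQU : Q ⊓ U ≤ P)
    (hmD : ∀ r ∈ maximalIdeal R, ∀ d ∈ D, r • d ∈ Q) (hQW : Q ≤ W) (hUW : U ≤ W) (hWW₁ : W ≤ W₁)
    (hW₁D : W₁ ≤ D) (hQ : ∀ D' : Submodule R A, D' ⊔ U = D → P ≤ D' → Q ≤ D')
    (hcQ : ∀ x ∈ Q, ∀ y ∈ W₁, c x y = 0) (hcU : ∀ u ∈ U, ∀ y ∈ W, c u y = 0)
    (hcW : ∀ x ∈ W, ∀ y ∈ W, c x y = 0) (hperp : ∀ y ∈ W₁, (∀ u ∈ U, c u y = 0) → y ∈ W)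
    (hκW : ∀ x ∈ W₁, ∀ y ∈ W₁, c x y ∈ LinearMap.range κ) {m w r u : ℕ}
    (cardW₁ : Nat.card W₁ = Nat.card W * Nat.card (ResidueField R) ^ m)
    (cardW : Nat.card W = Nat.card ↥(Q ⊔ U) * Nat.card (ResidueField R) ^ w)
    (cardD : Nat.card D = Nat.card W₁ * Nat.card (ResidueField R) ^ r)
    (cardU : Nat.card U = Nat.card P * Nat.card (ResidueField R) ^ u) :
    Nat.card {D' : Submodule R A // D' ⊔ U = D ∧ D' ⊓ U = P ∧
        ∀ x ∈ D' ⊓ W₁, ∀ y ∈ D' ⊓ W₁, c x y = 0} *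
      Nat.card (ResidueField R) ^ (m * (m + 1) / 2 + m * w) =
      Nat.card (ResidueField R) ^ (u * (w + m + r)) := by
  have : Finite (ResidueField R) := Finite.of_surjective _ (residue_surjective (R := R))
  have hWD := hWW₁.trans hW₁D
  have hQUW : Q ⊔ U ≤ W := sup_le hQW hUW
  obtain ⟨ew, hew⟩ := IsRelBasis.exists_of_card hQUW
    (fun r hr x hx => Submodule.mem_sup_left (hmD r hr x (hWD hx))) w cardW
  obtain ⟨em, hem⟩ := IsRelBasis.exists_of_card hWW₁
    (fun r hr x hx => hQW (hmD r hr x (hW₁D hx))) m cardW₁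
  obtain ⟨er, her⟩ := IsRelBasis.exists_of_card hW₁D
    (fun r hr x hx => (hQW.trans hWW₁) (hmD r hr x hx)) r cardD
  have he₁ := hew.sumElim hem (fun r hr x hx => Submodule.mem_sup_left (hmD r hr x (hW₁D hx)))
  have he := he₁.sumElim her (fun r hr x hx => Submodule.mem_sup_left (hmD r hr x hx))
  set e : (Fin w ⊕ Fin m) ⊕ Fin r → A := Sum.elim (Sum.elim ew em) er with hedef
  have heW₁ : ∀ i, e (.inl i) ∈ W₁ := he₁.mem
  obtain ⟨S, hSs, hS⟩ := exists_surjective_pairing κ hκ c hem hUW hperp hκW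
  have hU0 : ∀ u ∈ U, ∀ u' ∈ U, c u u' = 0 := fun u hu u' hu' => hcU u hu u' (hUW hu')
  -- Tuples of lifts.
  let Tup := {v : (Fin w ⊕ Fin m) ⊕ Fin r → U //
    ∀ i j, c (e (.inl i) + v (.inl i)) (e (.inl j) + v (.inl j)) = 0}
  let Good := {D' : Submodule R A // D' ⊔ U = D ∧ D' ⊓ U = P ∧
        ∀ x ∈ D' ⊓ W₁, ∀ y ∈ D' ⊓ W₁, c x y = 0}
  have hTup : Nat.card Tup * Nat.card (ResidueField R) ^ (m * (m + 1) / 2 + m * w) =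
      Nat.card U ^ (w + m + r) := by
    choose s hs using fun a b => hκW _ (he₁.mem (.inr a)) _ (he₁.mem (.inr b))
    choose t ht using fun x b => hκW _ (he₁.mem (.inl x)) _ (he₁.mem (.inr b))
    have hs' : ∀ a b, κ (s a b) = c (em a) (em b) := hs
    have ht' : ∀ x b, κ (t x b) = c (ew x) (em b) := ht
    rw [← card_isotropic_tuples (r := r) h2 S.toAddMonoidHom hSs (fun a b => - s a b)
      (fun a b => by rw [hκ ((hs' a b).trans ((hc _ _).trans (hs' b a).symm))]) (fun x b => - t x b)]
    congr 1
    refine Nat.card_congr (Equiv.subtypeEquivRight fun v => ?_)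
    have hwm : ∀ x b, c (ew x + v (.inl (.inl x))) (em b + v (.inl (.inr b))) =
        κ (t x b + S (v (.inl (.inl x))) b) := fun x b => by
      rw [map_add κ, hS, ht', map_add, map_add, LinearMap.add_apply, LinearMap.add_apply,
        hc (ew x) (v _), hcU _ (v _).2 _ (hew.mem x), hU0 _ (v _).2 _ (v _).2]
      ring
    have hmm : ∀ a b, c (em a + v (.inl (.inr a))) (em b + v (.inl (.inr b))) =
        κ (s a b + (S (v (.inl (.inr a))) b + S (v (.inl (.inr b))) a)) := fun a b => by
      rw [map_add κ, map_add κ, hS, hS, hs', map_add, map_add, LinearMap.add_apply,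
        LinearMap.add_apply, hc (em a) (v _), hU0 _ (v _).2 _ (v _).2]
      ring
    constructor
    · intro h
      refine ⟨fun x b => ?_, fun a b => ?_⟩
      · have := h (.inl x) (.inr b)
        change c (ew x + _) (em b + _) = 0 at this
        rw [hwm, ← map_zero κ] at this
        exact eq_neg_of_add_eq_zero_right (hκ this)
      · have := h (.inr a) (.inr b)
        change c (em a + _) (em b + _) = 0 at this
        rw [hmm, ← map_zero κ] at this
        exact eq_neg_of_add_eq_zero_right (hκ this)
    · rintro ⟨h1, h3⟩ i j
      have hwm0 : ∀ x b, c (ew x + v (.inl (.inl x))) (em b + v (.inl (.inr b))) = 0 := fun x b => by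
        have := h1 x b
        rw [LinearMap.toAddMonoidHom_coe] at this
        rw [hwm, this, add_neg_cancel, map_zero]
      rcases i with x | a <;> rcases j with y | b
      · exact hcW _ (W.add_mem (hew.mem x) (hUW (v _).2)) _ (W.add_mem (hew.mem y) (hUW (v _).2))
      · exact hwm0 x b
      · rw [hc]; exact hwm0 y a
      · have := h3 a b
        rw [LinearMap.toAddMonoidHom_coe] at this
        exact (hmm a b).trans (by rw [this, add_neg_cancel, map_zero])
  have hpert : ∀ v : (Fin w ⊕ Fin m) ⊕ Fin r → U, IsRelBasis (Q ⊔ U) D fun i => e i + v i :=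
    fun v => he.congr fun i => by
      rw [add_sub_cancel_left]; exact Submodule.mem_sup_right (v i).2
  let f : Tup → Good := fun v => ⟨Q ⊔ Submodule.span R (Set.range fun i => e i + v.1 i), by
    have hrel := hpert v.1
    refine ⟨?_, le_antisymm ?_ (le_inf (hPQ.trans le_sup_left) hPU), ?_⟩
    · rw [sup_right_comm, hrel.sup_span]
    -- A combination of the lifts lying in Q + U has coefficients in the maximal ideal, so it lies
    -- in Q; hence the intersection with U lies in Q ⊓ U ≤ P.
    · rintro x ⟨hx, hxU⟩
      obtain ⟨y, hy, z, hz, rfl⟩ := Submodule.mem_sup.1 hx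
      obtain ⟨a, rfl⟩ := (Submodule.mem_span_range_iff_exists_fun R).1 hz
      refine hQU ⟨?_, hxU⟩
      refine Q.add_mem hy (Submodule.sum_mem _ fun i _ => hmD _ ?_ _ (hrel.mem i))
      refine hrel.mem_maximalIdeal a ?_ i
      exact (Submodule.add_mem_iff_right _ (Submodule.mem_sup_left hy)).1
        (Submodule.mem_sup_right hxU)
    -- In an element of W₁ the coefficients of the last r lifts lie in the maximal ideal, so these
    -- terms go into Q, which c annihilates against W₁. Only the first w + m lifts enter the form.
    · have key : ∀ x ∈ (Q ⊔ Submodule.span R (Set.range fun i => e i + v.1 i)) ⊓ W₁,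
          ∃ q ∈ Q, ∃ a : Fin w ⊕ Fin m → R, x = q + ∑ i, a i • (e (.inl i) + v.1 (.inl i)) := by
        rintro x ⟨hx, hxW⟩
        obtain ⟨y, hy, z, hz, rfl⟩ := Submodule.mem_sup.1 hx
        obtain ⟨a, rfl⟩ := (Submodule.mem_span_range_iff_exists_fun R).1 hz
        rw [Fintype.sum_sum_type] at hxW ⊢
        have hr : IsRelBasis W₁ D fun i => e (.inr i) + v.1 (.inr i) := her.congr fun i => by
          change er i + _ - er i ∈ W₁
          rw [add_sub_cancel_left]; exact hWW₁ (hUW (v.1 _).2)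
        have h1 : ∑ i, a (.inl i) • (e (.inl i) + v.1 (.inl i) : A) ∈ W₁ :=
          Submodule.sum_mem _ fun i _ => W₁.smul_mem _ (W₁.add_mem (heW₁ i)
            (hWW₁ (hUW (v.1 _).2)))
        have h3 : ∑ i, a (.inr i) • (e (.inr i) + v.1 (.inr i) : A) ∈ W₁ :=
          (Submodule.add_mem_iff_right _ h1).1
            ((Submodule.add_mem_iff_right _ ((hQW.trans hWW₁) hy)).1 hxW)
        have h4 := hr.mem_maximalIdeal _ h3
        refine ⟨y + ∑ i, a (.inr i) • (e (.inr i) + v.1 (.inr i) : A), Q.add_mem hy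
          (Submodule.sum_mem _ fun i _ => hmD _ (h4 i) _ (hr.mem i)), fun i => a (.inl i), ?_⟩
        rw [add_assoc, add_comm (∑ i, a (.inr i) • (e (.inr i) + v.1 (.inr i) : A))]
      intro x hx y hy
      obtain ⟨q, hq, a, ha⟩ := key x hx
      obtain ⟨q', hq', a', ha'⟩ := key y hy
      have hqW := hQW.trans hWW₁
      rw [ha, map_add, LinearMap.add_apply, hcQ q hq y hy.2, zero_add, ha', map_add,
        hc _ q', hcQ q' hq' _ (by
          rw [← add_sub_cancel_left q (∑ i, a i • (e (.inl i) + v.1 (.inl i) : A)), ← ha]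
          exact W₁.sub_mem hx.2 (hqW hq)), zero_add, map_sum]
      refine Finset.sum_eq_zero fun j _ => ?_
      rw [map_smul, map_sum, LinearMap.sum_apply, Finset.sum_eq_zero fun i _ => ?_, smul_zero]
      rw [map_smul, LinearMap.smul_apply, v.2 i j, smul_zero]⟩
  -- Within a given D', two lifts of the same e i differ by an element of D' ⊓ U = P, so the fibre
  -- is a translate of the tuples in P.
  have hfib : ∀ D' : Good, Nat.card {v : Tup // f v = D'} = Nat.card P ^ (w + m + r) := by
    intro D'
    have hsplit : ∀ i, ∃ u : U, e i + u ∈ D'.1 := fun i => by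
      have h1 := he.mem i
      rw [← D'.2.1] at h1
      obtain ⟨y, hy, z, hz, h3⟩ := Submodule.mem_sup.1 h1
      exact ⟨⟨-z, U.neg_mem hz⟩, by rw [← h3]; simpa using hy⟩
    choose v₀ hv₀ using hsplit
    have hPD' : P ≤ D'.1 := D'.2.2.1.symm.le.trans inf_le_left
    have hQD' : Q ≤ D'.1 := hQ _ D'.2.1 hPD'
    have hfD : ∀ v : Tup, f v = D' ↔ ∀ i, e i + v.1 i ∈ D'.1 := fun v => by
      constructor
      · rintro rfl i
        exact Submodule.mem_sup_right (Submodule.subset_span ⟨i, rfl⟩)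
      · intro h
        apply Subtype.ext
        have hle : (f v).1 ≤ D'.1 := sup_le hQD' (by
          rw [Submodule.span_le]
          rintro _ ⟨i, rfl⟩
          exact h i)
        -- Both modules have the same sum with U and the same intersection with U, and one contains
        -- the other; the modular law gives equality.
        refine le_antisymm hle fun x hx => ?_
        have hxD : x ∈ D := D'.2.1 ▸ Submodule.mem_sup_left hx
        rw [← (f v).2.1] at hxD
        obtain ⟨y, hy, z, hz, rfl⟩ := Submodule.mem_sup.1 hxD
        have hzP : z ∈ P := by
          rw [← D'.2.2.1]
          exact ⟨(Submodule.add_mem_iff_right _ (hle hy)).1 hx, hz⟩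
        refine Submodule.add_mem _ hy ?_
        rw [← (f v).2.2.1] at hzP
        exact hzP.1
    have hgood : ∀ v : (Fin w ⊕ Fin m) ⊕ Fin r → U, (∀ i, e i + v i ∈ D'.1) →
        ∀ i j, c (e (.inl i) + v (.inl i)) (e (.inl j) + v (.inl j)) = 0 := fun v hv i j =>
      D'.2.2.2 _ ⟨hv _, W₁.add_mem (heW₁ i) (hWW₁ (hUW (v _).2))⟩ _
        ⟨hv _, W₁.add_mem (heW₁ j) (hWW₁ (hUW (v _).2))⟩
    let E : {v : Tup // f v = D'} ≃ ((Fin w ⊕ Fin m) ⊕ Fin r → P) :=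
      { toFun := fun v i => ⟨(v.1.1 i : A) - v₀ i, by
          rw [← D'.2.2.1]
          refine ⟨?_, U.sub_mem (v.1.1 i).2 (v₀ i).2⟩
          have := D'.1.sub_mem ((hfD v.1).1 v.2 i) (hv₀ i)
          rwa [add_sub_add_left_eq_sub] at this⟩
        invFun := fun p =>
          have hp : ∀ i, e i + ((⟨p i, hPU (p i).2⟩ + v₀ i : U) : A) ∈ D'.1 := fun i => by
            have := D'.1.add_mem (hPD' (p i).2) (hv₀ i)
            rw [Submodule.coe_add]
            rwa [add_left_comm] at this
          ⟨⟨fun i => ⟨p i, hPU (p i).2⟩ + v₀ i, hgood _ hp⟩, (hfD _).2 hp⟩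
        left_inv := fun v => by
          apply Subtype.ext; apply Subtype.ext; funext i; apply Subtype.ext
          simp
        right_inv := fun p => by
          funext i; apply Subtype.ext
          simp }
    rw [Nat.card_congr E, Nat.card_fun]
    simp
  have hcount := Nat.card_eq_card_mul_of_fiber f _ hfib
  rw [hcount, cardU, mul_pow] at hTup
  have hP : 0 < Nat.card P ^ (w + m + r) := pow_pos Nat.card_pos _
  refine Nat.eq_of_mul_eq_mul_left hP ?_
  rw [pow_mul, ← hTup]
  ring

end IsotropicLifts

/-! ### Arithmetic in a chain ring of nilpotency index three -/

namespace IsChainRing3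

open IsLocalRing

variable {R : Type*} [CommRing R] [IsLocalRing R] {γ : R}

theorem mem_maximalIdeal (hγ : IsChainRing3 R γ) {x : R} : x ∈ maximalIdeal R ↔ γ ∣ x := by
  rw [hγ.maximalIdeal_eq, Ideal.mem_span_singleton]

theorem residue_eq_zero (hγ : IsChainRing3 R γ) {x : R} : residue R x = 0 ↔ γ ∣ x := by
  rw [residue_eq_zero_iff, hγ.mem_maximalIdeal]

theorem residue_mul_left (hγ : IsChainRing3 R γ) (x : R) : residue R (γ * x) = 0 :=
  hγ.residue_eq_zero.2 (dvd_mul_right _ _)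

/-- If γ did not divide x, then x - γ ^ (ν - j) * y would be a unit of the local ring annihilated by
γ ^ j. This would give γ ^ j = 0 with j ≤ 2, against γ ^ 2 ≠ 0. -/
theorem dvd_of_pow_dvd (hγ : IsChainRing3 R γ) {j ν : ℕ} (hj : j < ν) (hν : ν ≤ 3) {x : R}
    (h : γ ^ ν ∣ γ ^ j * x) : γ ∣ x := by
  obtain ⟨y, hy⟩ := h
  by_contra hx
  have h1 : γ ^ j * (x - γ ^ (ν - j) * y) = 0 := by
    rw [mul_sub, hy, ← mul_assoc, ← pow_add, Nat.add_sub_cancel' hj.le, sub_self]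
  have h2 : IsUnit (x - γ ^ (ν - j) * y) := by
    rw [← notMem_maximalIdeal, hγ.mem_maximalIdeal]
    exact fun h => hx ((dvd_sub_left ((dvd_pow_self γ (by omega)).mul_right y)).1 h)
  have h3 : γ ^ j = 0 := by rwa [h2.mul_left_eq_zero] at h1
  exact hγ.sq_ne_zero (by
    rw [← Nat.add_sub_cancel' (show j ≤ 2 by omega), pow_add, h3, zero_mul])

theorem pow_dvd_of_pow_add_dvd (hγ : IsChainRing3 R γ) {a b : ℕ} (hab : a + b ≤ 3) {x : R}
    (h : γ ^ (a + b) ∣ γ ^ a * x) : γ ^ b ∣ x := by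
  induction b generalizing a x with
  | zero => simp
  | succ b ih =>
    obtain ⟨y, rfl⟩ := hγ.dvd_of_pow_dvd (by omega) hab h
    rw [pow_succ']
    refine mul_dvd_mul_left _ (ih (a := a + 1) (by omega) ?_)
    rwa [pow_succ, mul_assoc, show a + 1 + b = a + (b + 1) by ring]

theorem eq_zero_iff (hγ : IsChainRing3 R γ) {x : R} : x = 0 ↔ γ ^ 3 ∣ x := by
  rw [hγ.pow_three, zero_dvd_iff]

theorem mul_eq_zero_iff (hγ : IsChainRing3 R γ) {x : R} : γ * x = 0 ↔ γ ^ 2 ∣ x := by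
  rw [hγ.eq_zero_iff]
  refine ⟨fun h => hγ.pow_dvd_of_pow_add_dvd (a := 1) (by norm_num) (by rwa [pow_one]), fun h => ?_⟩
  rw [pow_succ']
  exact mul_dvd_mul_left _ h

/-- Multiplication by `γ²`, as a map from the residue field to `R`. -/
def socleMap (hγ : IsChainRing3 R γ) : ResidueField R →ₗ[R] R :=
  Submodule.liftQ (maximalIdeal R) (LinearMap.mulLeft R (γ ^ 2)) fun x hx => by
    obtain ⟨y, rfl⟩ := hγ.mem_maximalIdeal.1 hx
    rw [LinearMap.mem_ker, LinearMap.mulLeft_apply, ← mul_assoc, ← pow_succ, hγ.pow_three, zero_mul]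

theorem socleMap_residue (hγ : IsChainRing3 R γ) (x : R) : hγ.socleMap (residue R x) = γ ^ 2 * x :=
  rfl

theorem socleMap_injective (hγ : IsChainRing3 R γ) : Function.Injective hγ.socleMap := by
  rw [injective_iff_map_eq_zero]
  intro a ha
  obtain ⟨x, rfl⟩ := residue_surjective a
  rw [socleMap_residue, hγ.eq_zero_iff] at ha
  exact hγ.residue_eq_zero.2 (hγ.dvd_of_pow_dvd (by norm_num) le_rfl ha)

theorem mem_range_socleMap (hγ : IsChainRing3 R γ) {x : R} (h : γ ^ 2 ∣ x) :
    x ∈ LinearMap.range hγ.socleMap := by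
  obtain ⟨y, rfl⟩ := h
  exact ⟨residue R y, hγ.socleMap_residue y⟩

theorem chainQuot_eq_zero {R : Type*} [CommRing R] {γ : R} (x : R) : algebraMap R (ChainQuot γ) x = 0 ↔ γ ^ 2 ∣ x := by
  rw [Ideal.Quotient.algebraMap_eq, Ideal.Quotient.eq_zero_iff_mem, Ideal.mem_span_singleton]

end IsChainRing3

/-! ### The pieces `γ^j E` of a code -/

section GradedPiece

open IsLocalRing

variable {R : Type*} [CommRing R] [IsLocalRing R]

/-- The words `γ^j c` over `S` whose leading coefficient `c` lies in `E` modulo the maximal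
ideal. -/
def gradedPiece (γ : R) (S : Type*) [CommRing S] [Algebra R S] {n : ℕ} (j : ℕ)
    (E : Submodule (ResidueField R) (Fin n → ResidueField R)) : Submodule R (Fin n → S) where
  carrier := {x | ∃ c : Fin n → R, (fun i => residue R (c i)) ∈ E ∧
    (fun i => algebraMap R S (γ ^ j * c i)) = x}
  add_mem' := by
    rintro _ _ ⟨c, hc, rfl⟩ ⟨d, hd, rfl⟩
    exact ⟨c + d, by
      simp only [Pi.add_apply, map_add]
      exact E.add_mem hc hd, by ext i; simp [mul_add]⟩
  zero_mem' := ⟨0, by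
    simp only [Pi.zero_apply, map_zero]
    exact E.zero_mem, by ext i; simp⟩
  smul_mem' := by
    rintro r _ ⟨c, hc, rfl⟩
    refine ⟨r • c, by
      simp only [Pi.smul_apply, smul_eq_mul, map_mul]
      exact E.smul_mem (residue R r) hc, ?_⟩
    ext i
    simp only [Pi.smul_apply, smul_eq_mul, Algebra.smul_def, ← map_mul]
    congr 1
    ring

variable {γ : R} {S : Type*} [CommRing S] [Algebra R S] {n : ℕ}
  {E E' : Submodule (ResidueField R) (Fin n → ResidueField R)}

theorem mem_gradedPiece {j : ℕ} {x : Fin n → S} : x ∈ gradedPiece γ S j E ↔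
    ∃ c : Fin n → R, (fun i => residue R (c i)) ∈ E ∧
      (fun i => algebraMap R S (γ ^ j * c i)) = x := Iff.rfl

theorem mem_gradedPiece_top {j : ℕ} {x : Fin n → S} : x ∈ gradedPiece γ S j ⊤ ↔
    ∃ c : Fin n → R, (fun i => algebraMap R S (γ ^ j * c i)) = x := by
  simp [mem_gradedPiece]

theorem gradedPiece_mono {j : ℕ} (h : E ≤ E') : gradedPiece γ S j E ≤ gradedPiece γ S j E' := by
  rintro _ ⟨c, hc, rfl⟩
  exact ⟨c, h hc, rfl⟩

/-- A word γ^(j+1) c has the coefficient γ c at level j, whose residue is zero and so lies in every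
E. No relation between E and E' is needed. -/
theorem gradedPiece_succ_le (hγ : IsChainRing3 R γ) {j : ℕ} :
    gradedPiece γ S (j + 1) E' ≤ gradedPiece γ S j E := by
  rintro _ ⟨c, -, rfl⟩
  refine ⟨fun i => γ * c i, ?_, by ext i; rw [pow_succ, mul_assoc]⟩
  have : (fun i => residue R (γ * c i)) = 0 := by ext i; exact hγ.residue_mul_left _
  rw [this]
  exact E.zero_mem

theorem gradedPiece_antitone (hγ : IsChainRing3 R γ) {i j : ℕ} (h : i < j) :
    gradedPiece γ S j E' ≤ gradedPiece γ S i E := by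
  induction j, h using Nat.le_induction with
  | base => exact gradedPiece_succ_le hγ
  | succ j _ ih => exact (gradedPiece_succ_le hγ (E := E')).trans ih

theorem gradedPiece_antitone_top (hγ : IsChainRing3 R γ) {i j : ℕ} (h : i ≤ j) :
    gradedPiece γ S j E ≤ gradedPiece γ S i ⊤ := by
  rcases h.eq_or_lt with rfl | h
  · exact gradedPiece_mono le_top
  · exact gradedPiece_antitone hγ h

theorem gradedPiece_zero_top (hS : Function.Surjective (algebraMap R S)) :
    gradedPiece γ S 0 (⊤ : Submodule (ResidueField R) (Fin n → ResidueField R)) = ⊤ := by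
  refine eq_top_iff.2 fun x _ => ?_
  choose c hc using fun i => hS (x i)
  exact ⟨c, Submodule.mem_top, by ext i; simp [hc]⟩

theorem gradedPiece_eq_bot {ν : ℕ} (hν : ∀ x, algebraMap R S x = 0 ↔ γ ^ ν ∣ x) :
    gradedPiece γ S ν E = ⊥ := by
  rw [eq_bot_iff]
  rintro _ ⟨c, -, rfl⟩
  rw [Submodule.mem_bot]
  ext i
  exact (hν _).2 (dvd_mul_right _ _)

/-- Two leading coefficients of the same word agree modulo the maximal ideal. -/
theorem residue_eq_of_algebraMap_eq (hγ : IsChainRing3 R γ) {ν : ℕ} (hν3 : ν ≤ 3)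
    (hν : ∀ x, algebraMap R S x = 0 ↔ γ ^ ν ∣ x) {j : ℕ} (hj : j < ν) {x y : R}
    (h : algebraMap R S (γ ^ j * x) = algebraMap R S (γ ^ j * y)) : residue R x = residue R y := by
  rw [← sub_eq_zero, ← map_sub, ← mul_sub, hν] at h
  have := hγ.residue_eq_zero.2 (hγ.dvd_of_pow_dvd hj hν3 h)
  rwa [map_sub, sub_eq_zero] at this

theorem mem_of_mem_gradedPiece (hγ : IsChainRing3 R γ) {ν : ℕ} (hν3 : ν ≤ 3)
    (hν : ∀ x, algebraMap R S x = 0 ↔ γ ^ ν ∣ x) {j : ℕ} (hj : j < ν) {c : Fin n → R}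
    (h : (fun i => algebraMap R S (γ ^ j * c i)) ∈ gradedPiece γ S j E) :
    (fun i => residue R (c i)) ∈ E := by
  obtain ⟨d, hd, h⟩ := h
  convert hd using 2 with i
  exact residue_eq_of_algebraMap_eq hγ hν3 hν hj (congrFun h i).symm

theorem mem_gradedPiece_succ (hγ : IsChainRing3 R γ) {ν : ℕ} (hν3 : ν ≤ 3)
    (hν : ∀ x, algebraMap R S x = 0 ↔ γ ^ ν ∣ x) {j : ℕ} (hj : j < ν) {c : Fin n → R} :
    (fun i => algebraMap R S (γ ^ j * c i)) ∈
      gradedPiece γ S (j + 1) (⊤ : Submodule (ResidueField R) (Fin n → ResidueField R)) ↔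
    ∀ i, γ ∣ c i := by
  constructor
  · rintro ⟨d, -, h⟩ i
    have := congrFun h i
    rw [pow_succ, mul_assoc] at this
    rw [← hγ.residue_eq_zero, ← residue_eq_of_algebraMap_eq hγ hν3 hν hj this]
    exact hγ.residue_mul_left _
  · intro h
    choose d hd using h
    exact ⟨d, Submodule.mem_top, by ext i; rw [hd, pow_succ, mul_assoc]⟩

theorem gradedPiece_inj (hγ : IsChainRing3 R γ) {ν : ℕ} (hν3 : ν ≤ 3)
    (hν : ∀ x, algebraMap R S x = 0 ↔ γ ^ ν ∣ x) {j : ℕ} (hj : j < ν)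
    (h : gradedPiece γ S j E ≤ gradedPiece γ S j E') : E ≤ E' := by
  intro e he
  choose c hc using fun i => residue_surjective (R := R) (e i)
  have h1 : (fun i => algebraMap R S (γ ^ j * c i)) ∈ gradedPiece γ S j E :=
    ⟨c, by simpa only [hc] using he, rfl⟩
  have := mem_of_mem_gradedPiece hγ hν3 hν hj (h h1)
  simpa only [hc] using this

theorem smul_mem_gradedPiece {j : ℕ} {x : Fin n → S} (h : x ∈ gradedPiece γ S j E) :
    γ • x ∈ gradedPiece γ S (j + 1) E := by
  obtain ⟨c, hc, rfl⟩ := h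
  refine ⟨c, hc, ?_⟩
  ext i
  rw [Pi.smul_apply, Algebra.smul_def, ← map_mul, pow_succ', mul_assoc]

/-- A lift to R is determined modulo γ ^ ν only, but j < ν makes γ ^ (j + 1) divide γ ^ ν, so the
divisibility may be tested on any lift and one factor γ cancelled. -/
theorem mem_gradedPiece_of_smul_mem (hγ : IsChainRing3 R γ)
    (hS : Function.Surjective (algebraMap R S)) {ν : ℕ} (hν3 : ν ≤ 3)
    (hν : ∀ x, algebraMap R S x = 0 ↔ γ ^ ν ∣ x) {j : ℕ} (hj : j < ν) {x : Fin n → S}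
    (h : γ • x ∈ gradedPiece γ S (j + 1) (⊤ : Submodule _ (Fin n → ResidueField R))) :
    x ∈ gradedPiece γ S j (⊤ : Submodule _ (Fin n → ResidueField R)) := by
  choose c hc using fun i => hS (x i)
  obtain ⟨d, hd⟩ := mem_gradedPiece_top.1 h
  have key : ∀ i, γ ^ j ∣ c i := fun i => by
    have h1 := congrFun hd i
    rw [Pi.smul_apply, ← hc, Algebra.smul_def, ← map_mul, ← sub_eq_zero, ← map_sub, hν] at h1
    have h2 : γ ^ (1 + j) ∣ γ ^ 1 * c i := by
      rw [pow_one, add_comm]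
      have h3 : γ ^ (j + 1) ∣ γ ^ ν := pow_dvd_pow _ hj
      exact (dvd_sub_right (dvd_mul_right _ _)).1 (h3.trans h1)
    exact hγ.pow_dvd_of_pow_add_dvd (by omega) h2
  choose e he using key
  exact mem_gradedPiece_top.2 ⟨e, by ext i; rw [← he, hc]⟩

/-- Sending a word to the residue of its leading coefficient maps onto E, and each fibre is a coset
of the next layer. The coefficient is not unique, but its residue is. -/
theorem card_gradedPiece [Finite R] [Finite S] (hγ : IsChainRing3 R γ) {ν : ℕ} (hν3 : ν ≤ 3)
    (hν : ∀ x, algebraMap R S x = 0 ↔ γ ^ ν ∣ x) {j : ℕ} (hj : j < ν) :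
    Nat.card (gradedPiece γ S j E) = Nat.card (ResidueField R) ^ Module.finrank (ResidueField R) E *
      Nat.card (gradedPiece γ S (j + 1) (⊤ : Submodule _ (Fin n → ResidueField R))) := by
  have : Finite (ResidueField R) := Finite.of_surjective _ (residue_surjective (R := R))
  rw [← Module.natCard_eq_pow_finrank (K := ResidueField R) (V := E)]
  choose c hcE hc using fun x : gradedPiece γ S j E => x.2
  refine Nat.card_eq_card_mul_of_fiber (fun x => (⟨fun i => residue R (c x i), hcE x⟩ : E)) _ ?_
  rintro ⟨e, he⟩
  choose d hd using fun i => residue_surjective (R := R) (e i)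
  let y : gradedPiece γ S j E :=
    ⟨fun i => algebraMap R S (γ ^ j * d i), d, by simpa only [hd] using he, rfl⟩
  have key : ∀ x : gradedPiece γ S j E, (⟨fun i => residue R (c x i), hcE x⟩ : E) = ⟨e, he⟩ ↔
      (x - y : Fin n → S) ∈ gradedPiece γ S (j + 1) (⊤ : Submodule _ (Fin n → ResidueField R)) := by
    intro x
    have h1 : (x - y : Fin n → S) = fun i => algebraMap R S (γ ^ j * (c x i - d i)) := by
      rw [← hc x]
      ext i
      simp only [y, Pi.sub_apply, mul_sub, map_sub]
    rw [h1, mem_gradedPiece_succ (c := fun i => c x i - d i) hγ hν3 hν hj, Subtype.mk_eq_mk, funext_iff]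
    refine forall_congr' fun i => ?_
    rw [← hγ.residue_eq_zero, map_sub, sub_eq_zero, hd]
  refine Nat.card_congr ⟨fun x => ⟨x.1 - y, (key x.1).1 x.2⟩, fun z =>
    ⟨⟨z.1 + y, Submodule.add_mem _ (gradedPiece_succ_le hγ z.2) y.2⟩, (key _).2 ?_⟩,
    fun x => ?_, fun z => ?_⟩
  · rw [add_sub_cancel_right]; exact z.2
  · apply Subtype.ext; apply Subtype.ext
    exact sub_add_cancel _ _
  · apply Subtype.ext
    exact add_sub_cancel_right _ _

end GradedPiece

/-! ### The Euclidean form and the filtration of the ambient module -/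

section Form

variable {R : Type*} [CommRing R] {γ : R} {N₁ N₂ : ℕ}

theorem gammaMul_algebraMap (hγ : γ ^ 3 = 0) (x : R) :
    gammaMul hγ (algebraMap R (ChainQuot γ) x) = γ * x := rfl

theorem euclForm_comm (hγ : γ ^ 3 = 0) (m m' : Ambient γ N₁ N₂) :
    euclForm hγ m m' = euclForm hγ m' m := by
  simp only [euclForm, mul_comm]

theorem euclForm_add (hγ : γ ^ 3 = 0) (m m' m'' : Ambient γ N₁ N₂) :
    euclForm hγ (m + m') m'' = euclForm hγ m m'' + euclForm hγ m' m'' := by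
  simp only [euclForm, Prod.fst_add, Prod.snd_add, Pi.add_apply, add_mul, Finset.sum_add_distrib,
    map_add]
  ring

theorem euclForm_smul (hγ : γ ^ 3 = 0) (r : R) (m m' : Ambient γ N₁ N₂) :
    euclForm hγ (r • m) m' = r * euclForm hγ m m' := by
  simp only [euclForm, Prod.smul_fst, Prod.smul_snd, Pi.smul_apply, smul_eq_mul, mul_assoc,
    smul_mul_assoc, ← Finset.mul_sum, ← Finset.smul_sum, map_smul]
  ring

/-- The Euclidean form as a bilinear map. -/
noncomputable def euclBilin (hγ : γ ^ 3 = 0) (N₁ N₂ : ℕ) : Ambient γ N₁ N₂ →ₗ[R] Ambient γ N₁ N₂ →ₗ[R] R :=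
  LinearMap.mk₂ R (euclForm hγ) (euclForm_add hγ) (euclForm_smul hγ)
    (fun m m' m'' => by
      rw [euclForm_comm, euclForm_add, euclForm_comm, euclForm_comm hγ m''])
    (fun r m m' => by rw [euclForm_comm, euclForm_smul, euclForm_comm]; rfl)

theorem euclBilin_apply (hγ : γ ^ 3 = 0) (m m' : Ambient γ N₁ N₂) :
    euclBilin hγ N₁ N₂ m m' = euclForm hγ m m' := rfl

theorem euclForm_mk (hγ : γ ^ 3 = 0) (x x' : Fin N₁ → R) (y y' : Fin N₂ → R) :
    euclForm hγ (x, fun i => algebraMap R (ChainQuot γ) (y i))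
      (x', fun i => algebraMap R (ChainQuot γ) (y' i)) = ∑ i, x i * x' i + γ * ∑ i, y i * y' i := by
  simp only [euclForm, ← map_mul, ← map_sum, gammaMul_algebraMap]

theorem surjective_algebraMap_chainQuot : Function.Surjective (algebraMap R (ChainQuot γ)) :=
  Ideal.Quotient.mk_surjective

theorem finite_chainQuot [Finite R] : Finite (ChainQuot γ) :=
  Finite.of_surjective _ (surjective_algebraMap_chainQuot (γ := γ))

end Form

/-! ### Layers of the mixed ambient module and divisibility of the form on them -/

section Block

open IsLocalRing

variable {R : Type*} [CommRing R] [IsLocalRing R] {γ : R} {N₁ N₂ : ℕ}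
  {EX EX' : Submodule (ResidueField R) (Fin N₁ → ResidueField R)}
  {EY EY' : Submodule (ResidueField R) (Fin N₂ → ResidueField R)}

/-- The words `(γ^a x | γ^b y)` with leading coefficients `x` in `EX` and `y` in `EY`. -/
noncomputable def block (γ : R) {N₁ N₂ : ℕ} (a b : ℕ)
    (EX : Submodule (ResidueField R) (Fin N₁ → ResidueField R))
    (EY : Submodule (ResidueField R) (Fin N₂ → ResidueField R)) :
    Submodule R (Ambient γ N₁ N₂) :=
  (gradedPiece γ R a EX).prod (gradedPiece γ (ChainQuot γ) b EY)

theorem exists_of_mem_block {a b : ℕ} {m : Ambient γ N₁ N₂} (h : m ∈ block γ a b EX EY) :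
    ∃ (x : Fin N₁ → R) (y : Fin N₂ → R), (fun i => residue R (x i)) ∈ EX ∧
      (fun i => residue R (y i)) ∈ EY ∧
      m = (fun i => γ ^ a * x i, fun i => algebraMap R (ChainQuot γ) (γ ^ b * y i)) := by
  obtain ⟨⟨x, hx, h1⟩, ⟨y, hy, h2⟩⟩ := h
  exact ⟨x, y, hx, hy, Prod.ext h1.symm h2.symm⟩

theorem pow_dvd_sum (hγ : IsChainRing3 R γ) {n a a' s : ℕ} {x x' : Fin n → R}
    {E E' : Submodule (ResidueField R) (Fin n → ResidueField R)}
    (hx : (fun i => residue R (x i)) ∈ E) (hx' : (fun i => residue R (x' i)) ∈ E')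
    (h : s ≤ a + a' ∨ s ≤ a + a' + 1 ∧ LeDual E E') :
    γ ^ s ∣ ∑ i, (γ ^ a * x i) * (γ ^ a' * x' i) := by
  have h1 : ∑ i, (γ ^ a * x i) * (γ ^ a' * x' i) = γ ^ (a + a') * ∑ i, x i * x' i := by
    rw [Finset.mul_sum]
    exact Finset.sum_congr rfl fun i _ => by ring
  rw [h1]
  rcases h with h | ⟨h, hE⟩
  · exact (pow_dvd_pow γ h).mul_right _
  · have h2 := hE _ hx _ hx'
    simp only [← map_mul, ← map_sum] at h2
    rw [hγ.residue_eq_zero] at h2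
    refine (pow_dvd_pow γ h).trans ?_
    rw [pow_succ]
    exact mul_dvd_mul_left _ h2

/-- The first component contributes γ^(a+a') and the second γ^(b+b'+1), each gaining one more factor
γ when the spaces of leading coefficients are orthogonal. The divisibility and vanishing statements
of the lifting steps that come from the layers are instances of this. -/
theorem pow_dvd_euclForm (hγ : IsChainRing3 R γ) {a b a' b' s : ℕ} {m m' : Ambient γ N₁ N₂}
    (hm : m ∈ block γ a b EX EY) (hm' : m' ∈ block γ a' b' EX' EY')
    (hX : s ≤ a + a' ∨ s ≤ a + a' + 1 ∧ LeDual EX EX')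
    (hY : s ≤ b + b' + 1 ∨ s ≤ b + b' + 2 ∧ LeDual EY EY') :
    γ ^ s ∣ euclForm hγ.pow_three m m' := by
  obtain ⟨x, y, hx, hy, rfl⟩ := exists_of_mem_block hm
  obtain ⟨x', y', hx', hy', rfl⟩ := exists_of_mem_block hm'
  rw [euclForm_mk]
  refine dvd_add (pow_dvd_sum hγ hx hx' hX) ?_
  obtain _ | s := s
  · simp
  · rw [pow_succ']
    refine mul_dvd_mul_left _ (pow_dvd_sum hγ hy hy' ?_)
    rcases hY with h | h
    · exact Or.inl (by omega)
    · exact Or.inr ⟨by omega, h.2⟩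

theorem algebraMap_self_eq_zero (hγ : IsChainRing3 R γ) (x : R) :
    algebraMap R R x = 0 ↔ γ ^ 3 ∣ x := by
  rw [Algebra.algebraMap_self_apply, ← hγ.eq_zero_iff]

/-- The filtration `M₀ ⊇ M₁ ⊇ ⋯ ⊇ M₅ = 0` of the ambient module whose successive quotients are,
alternately, the words of length `N₁` and `N₂` over the residue field. -/
noncomputable def filtration (γ : R) (N₁ N₂ j : ℕ) : Submodule R (Ambient γ N₁ N₂) :=
  block γ ((j + 1) / 2) (j / 2) ⊤ ⊤

theorem filtration_antitone (hγ : IsChainRing3 R γ) : Antitone (filtration γ N₁ N₂) :=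
  fun _ _ h => Submodule.prod_mono (gradedPiece_antitone_top hγ (by omega))
    (gradedPiece_antitone_top hγ (by omega))

theorem filtration_zero : filtration γ N₁ N₂ 0 = ⊤ := by
  simp only [filtration, block]
  rw [gradedPiece_zero_top surjective_algebraMap_chainQuot,
    gradedPiece_zero_top (S := R) (fun x => ⟨x, rfl⟩), Submodule.prod_top]

theorem filtration_five (hγ : IsChainRing3 R γ) : filtration γ N₁ N₂ 5 = ⊥ := by
  simp only [filtration, block]
  rw [gradedPiece_eq_bot (ν := 3) (algebraMap_self_eq_zero hγ),
    gradedPiece_eq_bot (ν := 2) IsChainRing3.chainQuot_eq_zero, Submodule.prod_bot]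

theorem card_block [Finite R] (a b : ℕ) : Nat.card (block γ a b EX EY) =
    Nat.card (gradedPiece γ R a EX) * Nat.card (gradedPiece γ (ChainQuot γ) b EY) := by
  rw [← Nat.card_prod]
  exact Nat.card_congr (Equiv.subtypeProdEquivProd (p := fun x => x ∈ gradedPiece γ R a EX)
    (q := fun y => y ∈ gradedPiece γ (ChainQuot γ) b EY))

theorem card_block_left [Finite R] (hγ : IsChainRing3 R γ) {a b : ℕ} (ha : a < 3) :
    Nat.card (block γ a b EX EY) = Nat.card (ResidueField R) ^ Module.finrank (ResidueField R) EX *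
      Nat.card (block γ (a + 1) b (⊤ : Submodule _ (Fin N₁ → ResidueField R)) EY) := by
  rw [card_block, card_block, card_gradedPiece hγ le_rfl (algebraMap_self_eq_zero hγ) ha, mul_assoc]

theorem card_block_right [Finite R] (hγ : IsChainRing3 R γ) {a b : ℕ} (hb : b < 2) :
    Nat.card (block γ a b EX EY) = Nat.card (ResidueField R) ^ Module.finrank (ResidueField R) EY *
      Nat.card (block γ a (b + 1) EX (⊤ : Submodule _ (Fin N₂ → ResidueField R))) := by
  have := finite_chainQuot (γ := γ)
  rw [card_block, card_block,
    card_gradedPiece (S := ChainQuot γ) hγ (by norm_num) IsChainRing3.chainQuot_eq_zero hb]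
  ring

theorem smul_mem_block {a b : ℕ} {m : Ambient γ N₁ N₂} (h : m ∈ block γ a b EX EY) :
    γ • m ∈ block γ (a + 1) (b + 1) EX EY :=
  ⟨smul_mem_gradedPiece h.1, smul_mem_gradedPiece h.2⟩

theorem smul_mem_filtration {j : ℕ} {m : Ambient γ N₁ N₂} (h : m ∈ filtration γ N₁ N₂ j) :
    γ • m ∈ filtration γ N₁ N₂ (j + 2) := by
  have := smul_mem_block h
  rwa [filtration, show (j + 2 + 1) / 2 = (j + 1) / 2 + 1 by omega,
    show (j + 2) / 2 = j / 2 + 1 by omega]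

theorem mem_filtration_of_smul_mem (hγ : IsChainRing3 R γ) {j : ℕ} (hj : j ≤ 3)
    {m : Ambient γ N₁ N₂} (h : γ • m ∈ filtration γ N₁ N₂ (j + 2)) :
    m ∈ filtration γ N₁ N₂ j := by
  rw [filtration, show (j + 2 + 1) / 2 = (j + 1) / 2 + 1 by omega,
    show (j + 2) / 2 = j / 2 + 1 by omega] at h
  exact ⟨mem_gradedPiece_of_smul_mem hγ (fun x => ⟨x, rfl⟩) le_rfl (algebraMap_self_eq_zero hγ)
    (by omega) h.1, mem_gradedPiece_of_smul_mem hγ surjective_algebraMap_chainQuot (by norm_num)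
    IsChainRing3.chainQuot_eq_zero (by omega) h.2⟩

end Block

/-! ### Submodules with prescribed graded pieces -/

section HasGraded

variable {R A : Type*} [CommRing R] [AddCommGroup A] [Module R A]

theorem Submodule.card_map_mul (f : A →ₗ[R] A) [Finite A] (D : Submodule R A) :
    Nat.card D = Nat.card (D.map f) * Nat.card ↥(D ⊓ LinearMap.ker f) := by
  rw [(f.submoduleMap D).toAddMonoidHom.card_eq_of_surjective (f.submoduleMap_surjective D)]
  congr 1
  refine Nat.card_congr ⟨fun x => ⟨x.1, x.1.2, congrArg Subtype.val x.2⟩,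
    fun x => ⟨⟨x.1, x.2.1⟩, Subtype.ext x.2.2⟩, fun _ => rfl, fun _ => rfl⟩

/-- The map f identifies (f D + U)/U with D modulo the elements that f sends into U. With f
multiplication by γ this measures how many generators of a layer are already multiples of words of
D. -/
theorem Submodule.card_map_sup_mul (f : A →ₗ[R] A) [Finite A] (D U : Submodule R A) :
    Nat.card ↥(D.map f ⊔ U) * Nat.card ↥(D ⊓ U.comap f) = Nat.card U * Nat.card D := by
  have h1 := Submodule.card_mul_card_inf (D.map f) U
  have h2 := Submodule.card_map_mul f D
  have h3 := Submodule.card_map_mul f (D ⊓ U.comap f)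
  have h4 : (D ⊓ U.comap f).map f = D.map f ⊓ U := by
    ext x
    constructor
    · rintro ⟨y, ⟨hy, hy'⟩, rfl⟩
      exact ⟨⟨y, hy, rfl⟩, hy'⟩
    · rintro ⟨⟨y, hy, rfl⟩, hy'⟩
      exact ⟨y, ⟨hy, hy'⟩, rfl⟩
  have h5 : D ⊓ U.comap f ⊓ LinearMap.ker f = D ⊓ LinearMap.ker f := by
    ext x
    constructor
    · rintro ⟨⟨hx, -⟩, hx'⟩
      exact ⟨hx, hx'⟩
    · rintro ⟨hx, hx'⟩
      refine ⟨⟨hx, ?_⟩, hx'⟩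
      change f x ∈ U
      rw [LinearMap.mem_ker.1 hx']
      exact U.zero_mem
  rw [h4, h5] at h3
  rw [h3, ← mul_assoc, ← h1, h2]
  ring

/-- `D` contains `M i`, and its pieces in the quotients `M j / M (j + 1)`, `j < i`, are given by
`P j`. -/
def HasGraded (M P : ℕ → Submodule R A) (i : ℕ) (D : Submodule R A) : Prop :=
  M i ≤ D ∧ ∀ j < i, D ⊓ M j ⊔ M (j + 1) = P j

namespace HasGraded

variable {M P : ℕ → Submodule R A} {i : ℕ} {D D' : Submodule R A}

theorem inf_le (h : HasGraded M P i D) {j : ℕ} (hj : j < i) : D ⊓ M j ≤ P j := by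
  rw [← h.2 j hj]; exact le_sup_left

theorem sup_inf_of_le (hM : Antitone M) {i j : ℕ} (hj : j ≤ i) :
    (D' ⊔ M i) ⊓ M j = D' ⊓ M j ⊔ M i := by
  rw [sup_comm, sup_inf_assoc_of_le D' (hM hj), sup_comm]

/-- With `inf_eq` and `of_sup_eq` this splits the data of D' with prescribed pieces up to layer i
into the coarser module D = D' ⊔ M i and the intersection D' ⊓ M i = P i. -/
theorem sup (hM : Antitone M) (h : HasGraded M P (i + 1) D') : HasGraded M P i (D' ⊔ M i) := by
  refine ⟨le_sup_right, fun j hj => ?_⟩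
  rw [sup_inf_of_le hM hj.le, sup_assoc, sup_eq_right.2 (hM (show j + 1 ≤ i from hj))]
  exact h.2 j (hj.trans (Nat.lt_succ_self i))

theorem inf_eq (hM : Antitone M) (h : HasGraded M P (i + 1) D') : D' ⊓ M i = P i := by
  rw [← h.2 i (Nat.lt_succ_self i), left_eq_sup]
  exact le_inf h.1 (hM (Nat.le_succ i))

theorem of_sup_eq (hM : Antitone M) (h : HasGraded M P i D) (h1 : D' ⊔ M i = D)
    (h2 : D' ⊓ M i = P i) (hP : M (i + 1) ≤ P i) : HasGraded M P (i + 1) D' := by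
  refine ⟨hP.trans (h2 ▸ inf_le_left), fun j hj => ?_⟩
  rcases (Nat.lt_succ_iff.1 hj).eq_or_lt with rfl | hj
  · rw [h2, sup_eq_left.2 hP]
  · rw [← h.2 j hj, ← h1, sup_inf_of_le hM hj.le, sup_assoc,
      sup_eq_right.2 (hM (show j + 1 ≤ i from hj))]

theorem card_inf [Finite A] (hM : Antitone M) (h : HasGraded M P i D) {j : ℕ} (hj : j < i) {n : ℕ}
    (hP : Nat.card (P j) = n * Nat.card (M (j + 1))) :
    Nat.card ↥(D ⊓ M j) = Nat.card ↥(D ⊓ M (j + 1)) * n := by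
  have h1 := Submodule.card_mul_card_inf (D ⊓ M j) (M (j + 1))
  rw [h.2 j hj, hP, inf_assoc, inf_eq_right.2 (hM (Nat.le_succ j))] at h1
  have h2 : 0 < Nat.card (M (j + 1)) := Nat.card_pos
  refine Nat.eq_of_mul_eq_mul_right h2 ?_
  rw [h1]
  ring

/-- One step of the layerwise count: the modules D' are fibred over the coarser D = D' ⊔ M i, and
all fibres have the same size. The requirement on D must follow from the one on D', which is
`hcond`. -/
theorem card_succ [Finite A] (hM : Antitone M) (hP : M (i + 1) ≤ P i)
    {cond cond' : Submodule R A → Prop} (hcond : ∀ D', cond' D' → cond (D' ⊔ M i)) {a b : ℕ}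
    (ha : 0 < a) (hfib : ∀ D, HasGraded M P i D → cond D →
      Nat.card {D' // D' ⊔ M i = D ∧ D' ⊓ M i = P i ∧ cond' D'} * a = b) :
    Nat.card {D' // HasGraded M P (i + 1) D' ∧ cond' D'} * a =
      Nat.card {D // HasGraded M P i D ∧ cond D} * b := by
  rw [Nat.card_eq_card_mul_of_fiber (β := {D // HasGraded M P i D ∧ cond D})
    (fun D' => ⟨D'.1 ⊔ M i, D'.2.1.sup hM, hcond _ D'.2.2⟩) (b / a) ?_]
  -- The quotient b / a is known to be exact only if some D exists; otherwise both sides are zero.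
  · by_cases h : Nonempty {D // HasGraded M P i D ∧ cond D}
    · obtain ⟨D⟩ := h
      have := hfib D.1 D.2.1 D.2.2
      rw [← this, Nat.mul_div_cancel _ ha]
      ring
    · rw [not_nonempty_iff] at h
      rw [Nat.card_of_isEmpty]
      simp
  · intro D
    rw [← hfib D.1 D.2.1 D.2.2, Nat.mul_div_cancel _ ha]
    refine Nat.card_congr ⟨fun D' => ⟨D'.1.1, congrArg Subtype.val D'.2, D'.1.2.1.inf_eq hM,
      D'.1.2.2⟩, fun D' => ⟨⟨D'.1, D.2.1.of_sup_eq hM D'.2.1 D'.2.2.1 hP, D'.2.2.2⟩,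
      Subtype.ext D'.2.1⟩, fun _ => rfl, fun _ => rfl⟩

end HasGraded

end HasGraded

/-! ### Self-orthogonal codes with prescribed graded pieces -/

section GradedCount

open IsLocalRing

variable {R : Type*} [CommRing R] [IsLocalRing R] {γ : R} {N₁ N₂ : ℕ}

/-- The submodules of the `M_j` prescribed by the pieces `E₁, E₂, E₃` of the words of length `N₁`
and the pieces `E₄, E₅` of the words of length `N₂`. -/
noncomputable def targetPiece (γ : R) {N₁ N₂ : ℕ}
    (E₁ E₂ E₃ : Submodule (ResidueField R) (Fin N₁ → ResidueField R))
    (E₄ E₅ : Submodule (ResidueField R) (Fin N₂ → ResidueField R)) :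
    ℕ → Submodule R (Ambient γ N₁ N₂)
  | 0 => block γ 0 0 E₁ ⊤
  | 1 => block γ 1 0 ⊤ E₄
  | 2 => block γ 1 1 E₂ ⊤
  | 3 => block γ 2 1 ⊤ E₅
  | _ => block γ 2 2 E₃ ⊤

theorem block_mono {a b : ℕ} {EX EX' : Submodule (ResidueField R) (Fin N₁ → ResidueField R)}
    {EY EY' : Submodule (ResidueField R) (Fin N₂ → ResidueField R)} (hX : EX ≤ EX')
    (hY : EY ≤ EY') : block γ a b EX EY ≤ block γ a b EX' EY' :=
  Submodule.prod_mono (gradedPiece_mono hX) (gradedPiece_mono hY)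

section

variable {E₁ E₂ E₃ : Submodule (ResidueField R) (Fin N₁ → ResidueField R)}
  {E₄ E₅ : Submodule (ResidueField R) (Fin N₂ → ResidueField R)}

theorem targetPiece_le : ∀ j < 5, targetPiece γ E₁ E₂ E₃ E₄ E₅ j ≤ filtration γ N₁ N₂ j
  | 0, _ => block_mono le_top le_top
  | 1, _ => block_mono le_top le_top
  | 2, _ => block_mono le_top le_top
  | 3, _ => block_mono le_top le_top
  | 4, _ => block_mono le_top le_top

theorem filtration_succ_le (hγ : IsChainRing3 R γ) :
    ∀ j < 5, filtration γ N₁ N₂ (j + 1) ≤ targetPiece γ E₁ E₂ E₃ E₄ E₅ j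
  | 0, _ => Submodule.prod_mono (gradedPiece_succ_le hγ) le_rfl
  | 1, _ => Submodule.prod_mono le_rfl (gradedPiece_succ_le hγ)
  | 2, _ => Submodule.prod_mono (gradedPiece_succ_le hγ) le_rfl
  | 3, _ => Submodule.prod_mono le_rfl (gradedPiece_succ_le hγ)
  | 4, _ => Submodule.prod_mono (gradedPiece_succ_le hγ) le_rfl

/-- The dimensions of the pieces `E_j`. -/
noncomputable def targetDim (E₁ E₂ E₃ : Submodule (ResidueField R) (Fin N₁ → ResidueField R))
    (E₄ E₅ : Submodule (ResidueField R) (Fin N₂ → ResidueField R)) : ℕ → ℕ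
  | 0 => Module.finrank (ResidueField R) E₁
  | 1 => Module.finrank (ResidueField R) E₄
  | 2 => Module.finrank (ResidueField R) E₂
  | 3 => Module.finrank (ResidueField R) E₅
  | _ => Module.finrank (ResidueField R) E₃

theorem card_targetPiece [Finite R] (hγ : IsChainRing3 R γ) :
    ∀ j < 5, Nat.card (targetPiece γ E₁ E₂ E₃ E₄ E₅ j) =
      Nat.card (ResidueField R) ^ targetDim E₁ E₂ E₃ E₄ E₅ j *
        Nat.card (filtration γ N₁ N₂ (j + 1))
  | 0, _ => card_block_left hγ (by norm_num)
  | 1, _ => card_block_right hγ (by norm_num)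
  | 2, _ => card_block_left hγ (by norm_num)
  | 3, _ => card_block_right hγ (by norm_num)
  | 4, _ => card_block_left hγ (by norm_num)

end

theorem card_filtration_even [Finite R] (hγ : IsChainRing3 R γ) {j : ℕ} (hj : j < 3) :
    Nat.card (filtration γ N₁ N₂ (2 * j)) =
      Nat.card (ResidueField R) ^ N₁ * Nat.card (filtration γ N₁ N₂ (2 * j + 1)) := by
  rw [filtration, filtration, show (2 * j + 1) / 2 = j by omega, show 2 * j / 2 = j by omega,
    show (2 * j + 1 + 1) / 2 = j + 1 by omega, card_block_left hγ hj, finrank_top,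
    Module.finrank_fin_fun]

theorem card_filtration_odd [Finite R] (hγ : IsChainRing3 R γ) {j : ℕ} (hj : j < 2) :
    Nat.card (filtration γ N₁ N₂ (2 * j + 1)) =
      Nat.card (ResidueField R) ^ N₂ * Nat.card (filtration γ N₁ N₂ (2 * j + 2)) := by
  rw [filtration, filtration, show (2 * j + 1) / 2 = j by omega,
    show (2 * j + 1 + 1) / 2 = j + 1 by omega, show (2 * j + 2 + 1) / 2 = j + 1 by omega, card_block_right hγ hj, finrank_top,
    Module.finrank_fin_fun]

theorem comap_filtration (hγ : IsChainRing3 R γ) {j : ℕ} (hj : j ≤ 3) :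
    (filtration γ N₁ N₂ (j + 2)).comap (LinearMap.lsmul R (Ambient γ N₁ N₂) γ) =
      filtration γ N₁ N₂ j :=
  Submodule.ext fun _ => ⟨fun h => mem_filtration_of_smul_mem hγ hj h, fun h => smul_mem_filtration h⟩

theorem mem_block_zero {m : Ambient γ N₁ N₂} : m ∈ block γ 0 0 ⊤ ⊤ := by
  have : m ∈ filtration γ N₁ N₂ 0 := by rw [filtration_zero]; trivial
  exact this

theorem euclForm_single_left {R : Type*} [CommRing R] {γ : R} (hγ : γ ^ 3 = 0) (r : R) (i : Fin N₁) (m : Ambient γ N₁ N₂) :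
    euclForm hγ (Pi.single i r, 0) m = r * m.1 i := by
  simp [euclForm, Pi.single_apply]

theorem euclForm_single_right {R : Type*} [CommRing R] {γ : R} (hγ : γ ^ 3 = 0) (r s : R) (i : Fin N₂) (m : Ambient γ N₁ N₂)
    (hm : m.2 i = algebraMap R (ChainQuot γ) s) :
    euclForm hγ (0, Pi.single i (algebraMap R (ChainQuot γ) r)) m = γ * (r * s) := by
  have : ∑ j, (Pi.single i (algebraMap R (ChainQuot γ) r) : Fin N₂ → ChainQuot γ) j * m.2 j =
      algebraMap R (ChainQuot γ) (r * s) := by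
    rw [map_mul, ← hm]
    simp [Pi.single_apply]
  simp only [euclForm, Pi.zero_apply, zero_mul, Finset.sum_const_zero, zero_add, this,
    gammaMul_algebraMap]

theorem single_mem_gradedPiece {S : Type*} [CommRing S] [Algebra R S] {n j : ℕ} (i : Fin n) :
    (Pi.single i (algebraMap R S (γ ^ j)) : Fin n → S) ∈
      gradedPiece γ S j (⊤ : Submodule (ResidueField R) (Fin n → ResidueField R)) := by
  refine mem_gradedPiece_top.2 ⟨Pi.single i 1, ?_⟩
  ext k
  rcases eq_or_ne k i with rfl | h
  · simp
  · simp [h]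

/-- The code `D` with its pieces is extended to the next layer in the number of ways counted by
`card_isotropic_lifts`. -/
theorem card_lifts [Finite R] (hγ : IsChainRing3 R γ) (h2 : (2 : ResidueField R) ≠ 0)
    (c : Ambient γ N₁ N₂ →ₗ[R] Ambient γ N₁ N₂ →ₗ[R] R) (hc : ∀ x y, c x y = c y x)
    {P : ℕ → Submodule R (Ambient γ N₁ N₂)} {i : ℕ} {D W W₁ : Submodule R (Ambient γ N₁ N₂)}
    (hPU : P i ≤ filtration γ N₁ N₂ i) (hUP : filtration γ N₁ N₂ (i + 1) ≤ P i)
    (hγP : ∀ d ∈ D, γ • d ∈ filtration γ N₁ N₂ i → γ • d ∈ P i)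
    (hγW : ∀ d ∈ D, γ • d ∈ W) (hUW : filtration γ N₁ N₂ i ≤ W) (hWW₁ : W ≤ W₁) (hW₁D : W₁ ≤ D)
    (hcγ : ∀ d ∈ D, ∀ y ∈ W₁, c (γ • d) y = 0) (hcP : ∀ x ∈ P i, ∀ y ∈ W₁, c x y = 0)
    (hcU : ∀ u ∈ filtration γ N₁ N₂ i, ∀ y ∈ W, c u y = 0) (hcW : ∀ x ∈ W, ∀ y ∈ W, c x y = 0)
    (hperp : ∀ y ∈ W₁, (∀ u ∈ filtration γ N₁ N₂ i, c u y = 0) → y ∈ W)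
    (hdvd : ∀ x ∈ W₁, ∀ y ∈ W₁, γ ^ 2 ∣ c x y) {m w r u : ℕ}
    (cardW₁ : Nat.card W₁ = Nat.card W * Nat.card (ResidueField R) ^ m)
    (cardW : Nat.card W = Nat.card ↥(D.map (LinearMap.lsmul R (Ambient γ N₁ N₂) γ) ⊔
      filtration γ N₁ N₂ i) * Nat.card (ResidueField R) ^ w)
    (cardD : Nat.card D = Nat.card W₁ * Nat.card (ResidueField R) ^ r)
    (cardU : Nat.card (filtration γ N₁ N₂ i) = Nat.card (P i) * Nat.card (ResidueField R) ^ u) :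
    Nat.card {D' : Submodule R (Ambient γ N₁ N₂) // D' ⊔ filtration γ N₁ N₂ i = D ∧
        D' ⊓ filtration γ N₁ N₂ i = P i ∧ ∀ x ∈ D' ⊓ W₁, ∀ y ∈ D' ⊓ W₁, c x y = 0} *
      Nat.card (ResidueField R) ^ (m * (m + 1) / 2 + m * w) =
      Nat.card (ResidueField R) ^ (u * (w + m + r)) := by
  have := finite_chainQuot (γ := γ)
  set L := LinearMap.lsmul R (Ambient γ N₁ N₂) γ with hL
  have hPW := hPU.trans hUW
  have hγU : ∀ x ∈ filtration γ N₁ N₂ i, γ • x ∈ P i := fun x hx =>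
    hUP (filtration_antitone hγ (Nat.le_succ _) (smul_mem_filtration hx))
  -- Every refinement contains Q = γD + P i: it contains P i, and γD is contained in γD' + γM_i,
  -- where γM_i ≤ M_{i+2} ≤ M_{i+1} ≤ P i.
  refine card_isotropic_lifts h2 hγ.socleMap hγ.socleMap_injective c hc (Q := D.map L ⊔ P i)
    hPU le_sup_right ?_ ?_ (sup_le ?_ hPW) hUW hWW₁ hW₁D ?_ ?_ hcU hcW hperp
    (fun x hx y hy => hγ.mem_range_socleMap (hdvd x hx y hy)) cardW₁ ?_ cardD cardU
  · rintro x ⟨hx, hxU⟩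
    obtain ⟨_, ⟨d, hd, rfl⟩, p, hp, rfl⟩ := Submodule.mem_sup.1 hx
    exact (P i).add_mem (hγP d hd ((Submodule.add_mem_iff_left _ (hPU hp)).1 hxU)) hp
  · intro a ha d hd
    obtain ⟨b, rfl⟩ := hγ.mem_maximalIdeal.1 ha
    rw [mul_smul]
    exact Submodule.mem_sup_left ⟨b • d, D.smul_mem b hd, rfl⟩
  · rintro _ ⟨d, hd, rfl⟩
    exact hγW d hd
  · intro D' h1 h2
    refine sup_le ?_ h2
    rintro _ ⟨d, hd, rfl⟩
    rw [← h1] at hd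
    obtain ⟨y, hy, z, hz, rfl⟩ := Submodule.mem_sup.1 hd
    rw [map_add]
    exact D'.add_mem (D'.smul_mem γ hy) (h2 (hγU z hz))
  · intro x hx y hy
    obtain ⟨_, ⟨d, hd, rfl⟩, p, hp, rfl⟩ := Submodule.mem_sup.1 hx
    have h3 : c (L d) y = 0 := hcγ d hd y hy
    rw [map_add, LinearMap.add_apply, h3, hcP p hp y hy, add_zero]
  · rw [cardW, sup_assoc, sup_eq_right.2 hPU]

end GradedCount

/-! ### The four lifting steps -/

section GradedCountSteps

open IsLocalRing

variable {R : Type*} [CommRing R] [IsLocalRing R] {γ : R} {N₁ N₂ : ℕ}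
  {E₁ E₂ E₃ : Submodule (ResidueField R) (Fin N₁ → ResidueField R)}
  {E₄ E₅ : Submodule (ResidueField R) (Fin N₂ → ResidueField R)}
  {D : Submodule R (Ambient γ N₁ N₂)}

/-- `D` has the pieces prescribed by `E₁, …, E₅` in the first `i` layers of the filtration. -/
abbrev HasPieces (E₁ E₂ E₃ : Submodule (ResidueField R) (Fin N₁ → ResidueField R))
    (E₄ E₅ : Submodule (ResidueField R) (Fin N₂ → ResidueField R)) (i : ℕ)
    (D : Submodule R (Ambient γ N₁ N₂)) : Prop :=
  HasGraded (filtration γ N₁ N₂) (targetPiece γ E₁ E₂ E₃ E₄ E₅) i D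

theorem HasPieces.card_inf [Finite R] (hγ : IsChainRing3 R γ) {i : ℕ}
    (h : HasPieces E₁ E₂ E₃ E₄ E₅ i D) {j : ℕ} (hj : j < i) (hi : i ≤ 5) :
    Nat.card ↥(D ⊓ filtration γ N₁ N₂ j) = Nat.card ↥(D ⊓ filtration γ N₁ N₂ (j + 1)) *
      Nat.card (ResidueField R) ^ targetDim E₁ E₂ E₃ E₄ E₅ j := by
  have := finite_chainQuot (γ := γ)
  exact HasGraded.card_inf (filtration_antitone hγ) h hj
    (card_targetPiece hγ j (by omega))

theorem card_filtration_eq_mul [Finite R] (hγ : IsChainRing3 R γ) {j u n : ℕ} (hj : j < 5)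
    (hn : Nat.card (filtration γ N₁ N₂ j) =
      Nat.card (ResidueField R) ^ n * Nat.card (filtration γ N₁ N₂ (j + 1)))
    (hu : n = u + targetDim E₁ E₂ E₃ E₄ E₅ j) :
    Nat.card (filtration γ N₁ N₂ j) = Nat.card (targetPiece γ E₁ E₂ E₃ E₄ E₅ j) *
      Nat.card (ResidueField R) ^ u := by
  rw [hn, card_targetPiece hγ j hj, hu, pow_add]
  ring

/-- No condition is imposed yet, so the form is taken to be zero: the k₀ generators of D modulo M₁
are lifted freely, each in q^(N₂ - l₀) ways modulo the prescribed piece. -/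
theorem card_lifts_one [Finite R] (hγ : IsChainRing3 R γ) (h2 : (2 : ResidueField R) ≠ 0)
    {k₀ l₀ u : ℕ} (hE₁ : Module.finrank (ResidueField R) E₁ = k₀)
    (hE₄ : Module.finrank (ResidueField R) E₄ = l₀) (hu : N₂ = u + l₀)
    (hD : HasPieces E₁ E₂ E₃ E₄ E₅ 1 D) :
    Nat.card {D' : Submodule R (Ambient γ N₁ N₂) // D' ⊔ filtration γ N₁ N₂ 1 = D ∧
        D' ⊓ filtration γ N₁ N₂ 1 = targetPiece γ E₁ E₂ E₃ E₄ E₅ 1 ∧ True} * 1 =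
      Nat.card (ResidueField R) ^ (u * k₀) := by
  have h1 : D ⊓ filtration γ N₁ N₂ 1 = filtration γ N₁ N₂ 1 := inf_eq_right.2 hD.1
  have h := card_lifts hγ h2 (c := 0) (P := targetPiece γ E₁ E₂ E₃ E₄ E₅) (i := 1) (D := D)
    (W := filtration γ N₁ N₂ 1) (W₁ := filtration γ N₁ N₂ 1) (m := 0) (w := 0) (r := k₀) (u := u)
    (fun _ _ => rfl)
    (targetPiece_le 1 (by norm_num)) (filtration_succ_le hγ 1 (by norm_num))
    (fun d _ _ => filtration_succ_le hγ 1 (by norm_num)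
      (smul_mem_filtration (j := 0) (by rw [filtration_zero]; trivial)))
    (fun d _ => filtration_antitone hγ (by norm_num)
      (smul_mem_filtration (j := 0) (by rw [filtration_zero]; trivial)))
    le_rfl le_rfl hD.1 (by simp) (by simp) (by simp) (by simp) (fun y hy _ => hy) (by simp)
    (by simp) ?_ ?_ ?_
  · simpa using h
  · rw [pow_zero, mul_one, sup_eq_right.2]
    rintro _ ⟨d, -, rfl⟩
    exact filtration_antitone hγ (show 1 ≤ 2 by norm_num)
      (smul_mem_filtration (j := 0) (by rw [filtration_zero]; trivial))
  · have := hD.card_inf hγ (j := 0) (by norm_num) (by norm_num)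
    rw [filtration_zero, inf_top_eq, zero_add, h1] at this
    rw [this, targetDim, hE₁]
  · exact card_filtration_eq_mul hγ (by norm_num) (card_filtration_odd hγ (j := 0) (by norm_num))
      (by rw [targetDim, hE₄, hu])

/-- Orthogonality of E₁ to itself puts the form on D into γR, so γ times the form takes values in
the socle and vanishes exactly when γ² divides the form. The symmetric part of the system concerns
D/(D ∩ M₁), so m = k₀. The other w = l₀ generators, from the layer of E₄, pair to zero among
themselves because E₄ ⊥ E₄. -/
theorem card_lifts_two [Finite R] (hγ : IsChainRing3 R γ) (h2 : (2 : ResidueField R) ≠ 0)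
    {k₀ k₁ l₀ u : ℕ} (hE₁ : Module.finrank (ResidueField R) E₁ = k₀)
    (hE₂ : Module.finrank (ResidueField R) E₂ = k₀ + k₁)
    (hE₄ : Module.finrank (ResidueField R) E₄ = l₀) (hu : N₁ = u + (k₀ + k₁))
    (h12 : E₁ ≤ E₂) (h21 : LeDual E₂ E₁) (h44 : LeDual E₄ E₄)
    (hD : HasPieces E₁ E₂ E₃ E₄ E₅ 2 D) :
    Nat.card {D' : Submodule R (Ambient γ N₁ N₂) // D' ⊔ filtration γ N₁ N₂ 2 = D ∧
        D' ⊓ filtration γ N₁ N₂ 2 = targetPiece γ E₁ E₂ E₃ E₄ E₅ 2 ∧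
        ∀ x ∈ D', ∀ y ∈ D', γ ^ 2 ∣ euclForm hγ.pow_three x y} *
      Nat.card (ResidueField R) ^ (k₀ * (k₀ + 1) / 2 + k₀ * l₀) =
      Nat.card (ResidueField R) ^ (u * (l₀ + k₀)) := by
  have h11 : LeDual E₁ E₁ := fun x hx y hy => h21 x (h12 hx) y hy
  have hD0 : ∀ d ∈ D, d ∈ block γ 0 0 E₁ ⊤ := fun d hd =>
    hD.inf_le (j := 0) (by norm_num) ⟨hd, by rw [filtration_zero]; trivial⟩
  have hD1 : ∀ d ∈ D ⊓ filtration γ N₁ N₂ 1, d ∈ block γ 1 0 ⊤ E₄ := fun d hd =>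
    hD.inf_le (j := 1) (by norm_num) hd
  have hM2 : D ⊓ filtration γ N₁ N₂ 2 = filtration γ N₁ N₂ 2 := inf_eq_right.2 hD.1
  have hγ2 : ∀ d : Ambient γ N₁ N₂, γ • d ∈ filtration γ N₁ N₂ 2 := fun d =>
    smul_mem_filtration (j := 0) (by rw [filtration_zero]; trivial)
  have h12' : filtration γ N₁ N₂ 2 ≤ filtration γ N₁ N₂ 1 := filtration_antitone hγ (by norm_num)
  have hc0 : ∀ x y : Ambient γ N₁ N₂, (γ • euclBilin hγ.pow_three N₁ N₂) x y = 0 ↔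
      γ ^ 2 ∣ euclForm hγ.pow_three x y := fun x y => hγ.mul_eq_zero_iff
  have h := card_lifts hγ h2 (c := γ • euclBilin hγ.pow_three N₁ N₂)
    (P := targetPiece γ E₁ E₂ E₃ E₄ E₅) (i := 2) (D := D)
    (W := D ⊓ filtration γ N₁ N₂ 1) (W₁ := D) (m := k₀) (w := l₀) (r := 0) (u := u)
    (fun x y => congrArg (γ * ·) (euclForm_comm hγ.pow_three x y))
    (targetPiece_le 2 (by norm_num)) (filtration_succ_le hγ 2 (by norm_num))
    (fun d hd _ => block_mono h12 le_rfl (smul_mem_block (hD0 d hd)))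
    (fun d hd => ⟨D.smul_mem _ hd, h12' (hγ2 d)⟩)
    (le_inf hD.1 h12') inf_le_left le_rfl
    (fun d hd y hy => (hc0 _ _).2 (pow_dvd_euclForm hγ (smul_mem_block (hD0 d hd)) (hD0 y hy)
      (Or.inr ⟨le_rfl, h11⟩) (Or.inl le_rfl)))
    (fun x hx y hy => (hc0 _ _).2 (pow_dvd_euclForm (b := 1) hγ hx (hD0 y hy)
      (Or.inr ⟨le_rfl, h21⟩) (Or.inl le_rfl)))
    (fun x hx y hy => (hc0 _ _).2 (pow_dvd_euclForm (a := 1) (b := 1) hγ hx (hD1 y hy)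
      (Or.inl le_rfl) (Or.inl le_rfl)))
    (fun x hx y hy => (hc0 _ _).2 (pow_dvd_euclForm (a := 1) (b := 0) hγ (hD1 x hx) (hD1 y hy)
      (Or.inl le_rfl) (Or.inr ⟨le_rfl, h44⟩)))
    (fun y hy h => ⟨hy, by
      refine ⟨?_, (mem_block_zero (m := y)).2⟩
      -- Pairing y with γ times the i-th unit vector of the first component gives γ times y.1 i;
      -- divisibility by γ² forces γ ∣ y.1 i, so y lies in M₁.
      choose z hz using fun i => hγ.dvd_of_pow_dvd (j := 1) (ν := 2) (x := y.1 i) (by norm_num)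
        (by norm_num) (by
          have := (hc0 _ _).1 (h (Pi.single i (γ ^ 1), 0)
            ⟨single_mem_gradedPiece (S := R) i, Submodule.zero_mem _⟩)
          rwa [euclForm_single_left] at this)
      exact mem_gradedPiece_top.2 ⟨z, funext fun i => by rw [hz, pow_one]; rfl⟩⟩)
    (fun x hx y hy => by
      change γ ^ 2 ∣ γ * euclForm hγ.pow_three x y
      rw [pow_two]
      have := pow_dvd_euclForm (s := 1) hγ (hD0 x hx) (hD0 y hy) (Or.inr ⟨le_rfl, h11⟩)
        (Or.inl le_rfl)
      rw [pow_one] at this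
      exact mul_dvd_mul_left _ this) ?_ ?_ (by simp) ?_
  · rw [add_zero] at h
    rw [← h]
    congr 1
    refine Nat.card_congr (Equiv.subtypeEquivRight fun D' => and_congr_right fun h1 =>
      and_congr_right fun _ => ?_)
    have : D' ⊓ D = D' := inf_eq_left.2 (h1 ▸ le_sup_left)
    rw [this]
    exact forall₂_congr fun x _ => forall₂_congr fun y _ => (hc0 x y).symm
  · have := hD.card_inf hγ (j := 0) (by norm_num) (by norm_num)
    rw [filtration_zero, inf_top_eq, zero_add] at this
    rw [this, targetDim, hE₁]
  · have := hD.card_inf hγ (j := 1) (by norm_num) (by norm_num)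
    rw [this, hM2, targetDim, hE₄, sup_eq_right.2]
    rintro _ ⟨d, -, rfl⟩
    exact hγ2 d
  · exact card_filtration_eq_mul hγ (by norm_num) (card_filtration_even hγ (j := 1) (by norm_num))
      (by rw [targetDim, hE₂, hu])


/-- The form has values in the socle by the previous condition and must now vanish on D' ∩ M₁. As M₃
pairs to zero with M₂, the symmetric part concerns D ∩ M₁ modulo D ∩ M₂, so m = l₀. Of the k₀ + k₁
generators in the next layer, k₀ are multiples γd already fixed, whence w = k₁. The k₀ generators
outside M₁ are lifted freely. -/
theorem card_lifts_three [Finite R] (hγ : IsChainRing3 R γ) (h2 : (2 : ResidueField R) ≠ 0)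
    {k₀ k₁ l₀ l₁ u : ℕ} (hE₁ : Module.finrank (ResidueField R) E₁ = k₀)
    (hE₂ : Module.finrank (ResidueField R) E₂ = k₀ + k₁)
    (hE₄ : Module.finrank (ResidueField R) E₄ = l₀)
    (hE₅ : Module.finrank (ResidueField R) E₅ = l₀ + l₁) (hu : N₂ = u + (l₀ + l₁))
    (h45 : E₄ ≤ E₅) (h22 : LeDual E₂ E₂) (h54 : LeDual E₅ E₄)
    (hD : HasPieces E₁ E₂ E₃ E₄ E₅ 3 D)
    (hform : ∀ x ∈ D, ∀ y ∈ D, γ ^ 2 ∣ euclForm hγ.pow_three x y) :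
    Nat.card {D' : Submodule R (Ambient γ N₁ N₂) // D' ⊔ filtration γ N₁ N₂ 3 = D ∧
        D' ⊓ filtration γ N₁ N₂ 3 = targetPiece γ E₁ E₂ E₃ E₄ E₅ 3 ∧
        (∀ x ∈ D', ∀ y ∈ D', γ ^ 2 ∣ euclForm hγ.pow_three x y) ∧
        ∀ x ∈ D' ⊓ filtration γ N₁ N₂ 1, ∀ y ∈ D' ⊓ filtration γ N₁ N₂ 1,
          euclForm hγ.pow_three x y = 0} *
      Nat.card (ResidueField R) ^ (l₀ * (l₀ + 1) / 2 + l₀ * k₁) =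
      Nat.card (ResidueField R) ^ (u * (k₁ + l₀ + k₀)) := by
  have hD1 : ∀ d ∈ D ⊓ filtration γ N₁ N₂ 1, d ∈ block γ 1 0 ⊤ E₄ := fun d hd =>
    hD.inf_le (j := 1) (by norm_num) hd
  have hD2 : ∀ d ∈ D ⊓ filtration γ N₁ N₂ 2, d ∈ block γ 1 1 E₂ ⊤ := fun d hd =>
    hD.inf_le (j := 2) (by norm_num) hd
  have hM3 : D ⊓ filtration γ N₁ N₂ 3 = filtration γ N₁ N₂ 3 := inf_eq_right.2 hD.1
  have hγ2 : ∀ d : Ambient γ N₁ N₂, γ • d ∈ filtration γ N₁ N₂ 2 := fun d =>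
    smul_mem_filtration (j := 0) (by rw [filtration_zero]; trivial)
  have h12 : filtration γ N₁ N₂ 2 ≤ filtration γ N₁ N₂ 1 := filtration_antitone hγ (by norm_num)
  have h23 : filtration γ N₁ N₂ 3 ≤ filtration γ N₁ N₂ 2 := filtration_antitone hγ (by norm_num)
  have card2 := hD.card_inf hγ (j := 2) (by norm_num) (by norm_num)
  rw [hM3, targetDim, hE₂] at card2
  have card1 := hD.card_inf hγ (j := 1) (by norm_num) (by norm_num)
  rw [targetDim, hE₄] at card1
  have card0 := hD.card_inf hγ (j := 0) (by norm_num) (by norm_num)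
  rw [filtration_zero, inf_top_eq, targetDim, hE₁] at card0
  have h := card_lifts hγ h2 (c := euclBilin hγ.pow_three N₁ N₂)
    (P := targetPiece γ E₁ E₂ E₃ E₄ E₅) (i := 3) (D := D)
    (W := D ⊓ filtration γ N₁ N₂ 2) (W₁ := D ⊓ filtration γ N₁ N₂ 1) (m := l₀) (w := k₁) (r := k₀)
    (u := u) (euclForm_comm hγ.pow_three)
    (targetPiece_le 3 (by norm_num)) (filtration_succ_le hγ 3 (by norm_num))
    (fun d hd h => block_mono le_rfl h45 (smul_mem_block (hD1 d
      ⟨hd, mem_filtration_of_smul_mem hγ (by norm_num) h⟩)))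
    (fun d hd => ⟨D.smul_mem _ hd, hγ2 d⟩)
    (le_inf hD.1 h23) (inf_le_inf_left _ h12) inf_le_left
    (fun d hd y hy => by
      rw [euclBilin_apply, euclForm_smul]
      exact hγ.mul_eq_zero_iff.2 (hform _ hd _ hy.1))
    (fun x hx y hy => hγ.eq_zero_iff.2 (pow_dvd_euclForm (a := 2) (b := 1) hγ hx (hD1 y hy)
      (Or.inl le_rfl) (Or.inr ⟨le_rfl, h54⟩)))
    (fun x hx y hy => hγ.eq_zero_iff.2 (pow_dvd_euclForm (a := 2) (b := 1) hγ hx (hD2 y hy)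
      (Or.inl le_rfl) (Or.inl le_rfl)))
    (fun x hx y hy => hγ.eq_zero_iff.2 (pow_dvd_euclForm (a := 1) (b := 1) hγ (hD2 x hx) (hD2 y hy)
      (Or.inr ⟨le_rfl, h22⟩) (Or.inl le_rfl)))
    (fun y hy h => ⟨hy.1, by
      obtain ⟨⟨z, hz⟩, t, -, ht⟩ := hD1 y hy
      -- Pairing with γ times the i-th unit vector of the second component gives γ² t i, and this is
      -- zero only if γ ∣ t i.
      have hdvd : ∀ i, γ ∣ t i := fun i => hγ.dvd_of_pow_dvd (j := 2) (ν := 3) (by norm_num) le_rfl (by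
        have := hγ.eq_zero_iff.1 (h (0, Pi.single i (algebraMap R (ChainQuot γ) (γ ^ 1)))
            ⟨Submodule.zero_mem _, single_mem_gradedPiece i⟩)
        rw [euclBilin_apply, euclForm_single_right hγ.pow_three _ (t i) _ _ (by rw [← ht]; simp)] at this
        rwa [pow_one, ← mul_assoc, ← pow_two] at this)
      choose s hs using hdvd
      refine ⟨⟨z, trivial, hz.2⟩, mem_gradedPiece_top.2 ⟨s, ?_⟩⟩
      rw [← ht]
      funext i
      simp [hs]⟩)
    (fun x hx y hy => hform x hx.1 y hy.1) card1 ?_ ?_ ?_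
  · rw [← h]
    congr 1
    refine Nat.card_congr (Equiv.subtypeEquivRight fun D' => and_congr_right fun h1 =>
      and_congr_right fun _ => ?_)
    have hle : D' ≤ D := h1 ▸ le_sup_left
    rw [← inf_assoc, inf_eq_left.2 hle, and_iff_right fun x hx y hy => hform x (hle hx) y (hle hy)]
    rfl
  · have hfin := finite_chainQuot (γ := γ)
    -- Multiplication by γ identifies (γD + M₃)/M₃ with D/(D ∩ M₁), which has q^k₀ elements.
    have := Submodule.card_map_sup_mul (LinearMap.lsmul R (Ambient γ N₁ N₂) γ) D
      (filtration γ N₁ N₂ 3)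
    have hpos : 0 < Nat.card ↥(D ⊓ filtration γ N₁ N₂ 1) := Nat.card_pos
    rw [comap_filtration hγ (by norm_num), card0] at this
    refine Nat.eq_of_mul_eq_mul_right hpos ?_
    rw [card2, mul_right_comm (Nat.card ↥(D.map _ ⊔ _)), this, pow_add]
    ring
  · exact card0
  · exact card_filtration_eq_mul hγ (by norm_num) (card_filtration_odd hγ (j := 1) (by norm_num))
      (by rw [targetDim, hE₅, hu])

/-- The form already vanishes on D ∩ M₁, and M₄ pairs to zero with M₁, so the symmetric part
concerns D/(D ∩ M₁) and m = k₀. Modulo γD + M₄ the module D ∩ M₁ has l₀ + (k₀ + k₁) + (l₀ + l₁) -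
(k₀ + l₀) = k₁ + l₀ + l₁ generators, which is w; no generator is left free. -/
theorem card_lifts_four [Finite R] (hγ : IsChainRing3 R γ) (h2 : (2 : ResidueField R) ≠ 0)
    {k₀ k₁ k₂ l₀ l₁ u : ℕ} (hE₁ : Module.finrank (ResidueField R) E₁ = k₀)
    (hE₂ : Module.finrank (ResidueField R) E₂ = k₀ + k₁)
    (hE₃ : Module.finrank (ResidueField R) E₃ = k₀ + k₁ + k₂)
    (hE₄ : Module.finrank (ResidueField R) E₄ = l₀)
    (hE₅ : Module.finrank (ResidueField R) E₅ = l₀ + l₁) (hu : N₁ = u + (k₀ + k₁ + k₂))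
    (h23 : E₂ ≤ E₃) (h31 : LeDual E₃ E₁)
    (hD : HasPieces E₁ E₂ E₃ E₄ E₅ 4 D)
    (hform : ∀ x ∈ D, ∀ y ∈ D, γ ^ 2 ∣ euclForm hγ.pow_three x y)
    (hform₁ : ∀ x ∈ D ⊓ filtration γ N₁ N₂ 1, ∀ y ∈ D ⊓ filtration γ N₁ N₂ 1,
      euclForm hγ.pow_three x y = 0) :
    Nat.card {D' : Submodule R (Ambient γ N₁ N₂) // D' ⊔ filtration γ N₁ N₂ 4 = D ∧
        D' ⊓ filtration γ N₁ N₂ 4 = targetPiece γ E₁ E₂ E₃ E₄ E₅ 4 ∧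
        IsSelfOrthogonal hγ.pow_three D'} *
      Nat.card (ResidueField R) ^ (k₀ * (k₀ + 1) / 2 + k₀ * (k₁ + l₀ + l₁)) =
      Nat.card (ResidueField R) ^ (u * (k₁ + l₀ + l₁ + k₀)) := by
  have hD0 : ∀ d ∈ D, d ∈ block γ 0 0 E₁ ⊤ := fun d hd =>
    hD.inf_le (j := 0) (by norm_num) ⟨hd, by rw [filtration_zero]; trivial⟩
  have hD2 : ∀ d ∈ D ⊓ filtration γ N₁ N₂ 2, d ∈ block γ 1 1 E₂ ⊤ := fun d hd =>
    hD.inf_le (j := 2) (by norm_num) hd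
  have hM4 : D ⊓ filtration γ N₁ N₂ 4 = filtration γ N₁ N₂ 4 := inf_eq_right.2 hD.1
  have hγ2 : ∀ d : Ambient γ N₁ N₂, γ • d ∈ filtration γ N₁ N₂ 2 := fun d =>
    smul_mem_filtration (j := 0) (by rw [filtration_zero]; trivial)
  have h12 : filtration γ N₁ N₂ 2 ≤ filtration γ N₁ N₂ 1 := filtration_antitone hγ (by norm_num)
  have h14 : filtration γ N₁ N₂ 4 ≤ filtration γ N₁ N₂ 1 := filtration_antitone hγ (by norm_num)
  have card3 := hD.card_inf hγ (j := 3) (by norm_num) (by norm_num)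
  rw [hM4, targetDim, hE₅] at card3
  have card2 := hD.card_inf hγ (j := 2) (by norm_num) (by norm_num)
  rw [card3, targetDim, hE₂] at card2
  have card1 := hD.card_inf hγ (j := 1) (by norm_num) (by norm_num)
  rw [targetDim, hE₄] at card1
  have card0 := hD.card_inf hγ (j := 0) (by norm_num) (by norm_num)
  rw [filtration_zero, inf_top_eq, targetDim, hE₁] at card0
  have h := card_lifts hγ h2 (c := euclBilin hγ.pow_three N₁ N₂)
    (P := targetPiece γ E₁ E₂ E₃ E₄ E₅) (i := 4) (D := D)
    (W := D ⊓ filtration γ N₁ N₂ 1) (W₁ := D) (m := k₀) (w := k₁ + l₀ + l₁) (r := 0)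
    (u := u) (euclForm_comm hγ.pow_three)
    (targetPiece_le 4 (by norm_num)) (filtration_succ_le hγ 4 (by norm_num))
    (fun d hd h => block_mono h23 le_rfl (smul_mem_block (hD2 d
      ⟨hd, mem_filtration_of_smul_mem hγ (by norm_num) h⟩)))
    (fun d hd => ⟨D.smul_mem _ hd, h12 (hγ2 d)⟩)
    (le_inf hD.1 h14) inf_le_left le_rfl
    (fun d hd y hy => by
      rw [euclBilin_apply, euclForm_smul]
      exact hγ.mul_eq_zero_iff.2 (hform _ hd _ hy))
    (fun x hx y hy => hγ.eq_zero_iff.2 (pow_dvd_euclForm (a := 2) (b := 2) hγ hx (hD0 y hy)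
      (Or.inr ⟨le_rfl, h31⟩) (Or.inl le_rfl)))
    (fun x hx y hy => hγ.eq_zero_iff.2 (pow_dvd_euclForm (a := 2) (b := 2) (a' := 1) (b' := 0) hγ
      hx hy.2 (Or.inl le_rfl) (Or.inl le_rfl)))
    hform₁
    (fun y hy h => ⟨hy, by
      refine ⟨?_, (mem_block_zero (m := y)).2⟩
      choose z hz using fun i => hγ.dvd_of_pow_dvd (j := 2) (ν := 3) (x := y.1 i) (by norm_num)
        le_rfl (by
          have := hγ.eq_zero_iff.1 (h (Pi.single i (γ ^ 2), 0)
            ⟨single_mem_gradedPiece (S := R) i, Submodule.zero_mem _⟩)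
          rwa [euclBilin_apply, euclForm_single_left] at this)
      exact mem_gradedPiece_top.2 ⟨z, funext fun i => by rw [hz, pow_one]; rfl⟩⟩)
    hform card0 ?_ (by simp) ?_
  · rw [add_zero] at h
    rw [← h]
    congr 1
    refine Nat.card_congr (Equiv.subtypeEquivRight fun D' => and_congr_right fun h1 =>
      and_congr_right fun _ => ?_)
    rw [inf_eq_left.2 (h1 ▸ le_sup_left)]
    rfl
  · have hfin := finite_chainQuot (γ := γ)
    -- Here (γD + M₄)/M₄ is identified with D/(D ∩ M₂), which has q^(k₀ + l₀) elements.
    have := Submodule.card_map_sup_mul (LinearMap.lsmul R (Ambient γ N₁ N₂) γ) D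
      (filtration γ N₁ N₂ 4)
    have hpos : 0 < Nat.card (filtration γ N₁ N₂ 4) := Nat.card_pos
    have hq : 0 < Nat.card (ResidueField R) ^ (l₀ + l₁ + (k₀ + k₁)) := by
      have : Finite (ResidueField R) := Finite.of_surjective _ (residue_surjective (R := R))
      exact pow_pos Nat.card_pos _
    rw [comap_filtration hγ (by norm_num), card0, card1, card2] at this
    refine Nat.eq_of_mul_eq_mul_right (mul_pos hpos hq) ?_
    rw [card1, card2]
    calc _ = Nat.card (filtration γ N₁ N₂ 4) * (Nat.card (filtration γ N₁ N₂ 4) *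
          Nat.card (ResidueField R) ^ (l₀ + l₁) * Nat.card (ResidueField R) ^ (k₀ + k₁) *
          Nat.card (ResidueField R) ^ l₀ * Nat.card (ResidueField R) ^ k₀) *
          Nat.card (ResidueField R) ^ (k₁ + l₀ + l₁) := by ring
      _ = _ := by rw [← this]; ring
  · exact card_filtration_eq_mul hγ (by norm_num) (card_filtration_even hγ (j := 2) (by norm_num))
      (by
        change N₁ = u + Module.finrank (ResidueField R) E₃
        rw [hE₃, hu])

end GradedCountSteps

/-! ### Multiplying the four steps -/

section GradedCountTotal

open IsLocalRing

variable {R : Type*} [CommRing R] [IsLocalRing R] {γ : R} {N₁ N₂ : ℕ}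
  {E₁ E₂ E₃ : Submodule (ResidueField R) (Fin N₁ → ResidueField R)}
  {E₄ E₅ : Submodule (ResidueField R) (Fin N₂ → ResidueField R)}

theorem pow_dvd_euclForm_sup {R : Type*} [CommRing R] {γ : R} (hγ : γ ^ 3 = 0) {s : ℕ} {D U X : Submodule R (Ambient γ N₁ N₂)}
    (hX : D ≤ X) (hUX : U ≤ X)
    (hD : ∀ x ∈ D, ∀ y ∈ D, γ ^ s ∣ euclForm hγ x y)
    (hU : ∀ x ∈ U, ∀ y ∈ X, γ ^ s ∣ euclForm hγ x y) :
    ∀ x ∈ D ⊔ U, ∀ y ∈ D ⊔ U, γ ^ s ∣ euclForm hγ x y := by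
  intro x hx y hy
  obtain ⟨d, hd, u, hu, rfl⟩ := Submodule.mem_sup.1 hx
  obtain ⟨d', hd', u', hu', rfl⟩ := Submodule.mem_sup.1 hy
  rw [euclForm_add, euclForm_comm, euclForm_add, euclForm_comm hγ d', euclForm_comm hγ u']
  refine dvd_add (dvd_add (hD d hd d' hd') ?_) (hU u hu _ (X.add_mem (hX hd') (hUX hu')))
  rw [euclForm_comm]
  exact hU u' hu' d (hX hd)

theorem mul_pow_chain {Q n₂ n₃ n₄ n₅ a₁ a₂ a₃ a₄ x₂ x₃ x₄ : ℕ} (h₁ : n₂ = Q ^ a₁)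
    (h₂ : n₃ * Q ^ x₂ = n₂ * Q ^ a₂) (h₃ : n₄ * Q ^ x₃ = n₃ * Q ^ a₃)
    (h₄ : n₅ * Q ^ x₄ = n₄ * Q ^ a₄) :
    n₅ * Q ^ (x₂ + x₃ + x₄) = Q ^ (a₁ + a₂ + a₃ + a₄) := by
  calc n₅ * Q ^ (x₂ + x₃ + x₄) = n₅ * Q ^ x₄ * Q ^ x₃ * Q ^ x₂ := by ring
    _ = n₄ * Q ^ x₃ * Q ^ a₄ * Q ^ x₂ := by rw [h₄]; ring
    _ = n₃ * Q ^ x₂ * Q ^ a₃ * Q ^ a₄ := by rw [h₃]; ring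
    _ = _ := by rw [h₂, h₁]; ring

/-- M₃ pairs with every word into γ²R, so the condition is not lost when D' is replaced by the
coarser D' + M₃. The layerwise count needs this to map admissible modules to admissible ones. -/
theorem pow_two_dvd_euclForm_sup (hγ : IsChainRing3 R γ) {D : Submodule R (Ambient γ N₁ N₂)}
    (h : ∀ x ∈ D, ∀ y ∈ D, γ ^ 2 ∣ euclForm hγ.pow_three x y) :
    ∀ x ∈ D ⊔ filtration γ N₁ N₂ 3, ∀ y ∈ D ⊔ filtration γ N₁ N₂ 3,
      γ ^ 2 ∣ euclForm hγ.pow_three x y :=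
  pow_dvd_euclForm_sup hγ.pow_three le_top le_top h fun _ hx y _ =>
    pow_dvd_euclForm (a := 2) (b := 1) (a' := 0) (b' := 0) (EX := ⊤) (EY := ⊤) hγ hx
      (mem_block_zero (m := y)) (Or.inl le_rfl) (Or.inl le_rfl)

/-- M₄ pairs with all words into γ²R and with M₁ to zero. So the conditions imposed in the third
step are implied by self-orthogonality of the final code and lose no code. -/
theorem euclForm_conditions_sup (hγ : IsChainRing3 R γ) {D : Submodule R (Ambient γ N₁ N₂)}
    (h : IsSelfOrthogonal hγ.pow_three D) :
    (∀ x ∈ D ⊔ filtration γ N₁ N₂ 4, ∀ y ∈ D ⊔ filtration γ N₁ N₂ 4,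
      γ ^ 2 ∣ euclForm hγ.pow_three x y) ∧
    ∀ x ∈ (D ⊔ filtration γ N₁ N₂ 4) ⊓ filtration γ N₁ N₂ 1,
      ∀ y ∈ (D ⊔ filtration γ N₁ N₂ 4) ⊓ filtration γ N₁ N₂ 1, euclForm hγ.pow_three x y = 0 := by
  constructor
  · refine pow_dvd_euclForm_sup hγ.pow_three le_top le_top
      (fun x hx y hy => by rw [h x hx y hy]; exact dvd_zero _) fun x hx y _ => ?_
    exact pow_dvd_euclForm (a := 2) (b := 2) (a' := 0) (b' := 0) (EX := ⊤) (EY := ⊤) hγ hx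
      (mem_block_zero (m := y)) (Or.inl le_rfl) (Or.inl (by norm_num))
  · have hM := filtration_antitone (N₁ := N₁) (N₂ := N₂) hγ
    have h14 : filtration γ N₁ N₂ 4 ≤ filtration γ N₁ N₂ 1 := hM (by norm_num)
    rw [HasGraded.sup_inf_of_le hM (show 1 ≤ 4 by norm_num)]
    intro x hx y hy
    refine hγ.eq_zero_iff.2 (pow_dvd_euclForm_sup hγ.pow_three inf_le_right h14
      (fun x hx y hy => by rw [h x hx.1 y hy.1]; exact dvd_zero _)
      (fun x hx y hy => ?_) x hx y hy)
    exact pow_dvd_euclForm (a := 2) (b := 2) (a' := 1) (b' := 0) (EX := ⊤) (EY := ⊤) (EX' := ⊤)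
      (EY' := ⊤) hγ hx hy (Or.inl le_rfl) (Or.inl le_rfl)

theorem card_hasPieces_one (hγ : IsChainRing3 R γ) :
    Nat.card {D : Submodule R (Ambient γ N₁ N₂) // HasPieces E₁ E₂ E₃ E₄ E₅ 1 D ∧ True} = 1 := by
  have hle : filtration γ N₁ N₂ 1 ≤ targetPiece γ E₁ E₂ E₃ E₄ E₅ 0 :=
    filtration_succ_le hγ 0 (by norm_num)
  have key : ∀ D : Submodule R (Ambient γ N₁ N₂), HasPieces E₁ E₂ E₃ E₄ E₅ 1 D ↔
      D = targetPiece γ E₁ E₂ E₃ E₄ E₅ 0 := by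
    intro D
    constructor
    · rintro ⟨h1, h2⟩
      have := h2 0 (by norm_num)
      rwa [filtration_zero, inf_top_eq, zero_add, sup_eq_left.2 h1] at this
    · rintro rfl
      refine ⟨hle, fun j hj => ?_⟩
      obtain rfl : j = 0 := by omega
      rw [filtration_zero, inf_top_eq, sup_eq_left.2 hle]
  simp only [key, and_true]
  exact Nat.card_unique

/-- There is exactly one module with the first piece prescribed that contains M₁, namely the piece
itself; the four lifting counts then multiply. The exponent on the right counts the unknown
coordinates of the corrections, the one on the left the independent equations. -/
theorem card_selfOrthogonal_hasPieces [Finite R] (hγ : IsChainRing3 R γ)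
    (h2 : (2 : ResidueField R) ≠ 0) {k₀ k₁ k₂ l₀ l₁ u₁ u₂ u₃ u₄ : ℕ}
    (hE₁ : Module.finrank (ResidueField R) E₁ = k₀)
    (hE₂ : Module.finrank (ResidueField R) E₂ = k₀ + k₁)
    (hE₃ : Module.finrank (ResidueField R) E₃ = k₀ + k₁ + k₂)
    (hE₄ : Module.finrank (ResidueField R) E₄ = l₀)
    (hE₅ : Module.finrank (ResidueField R) E₅ = l₀ + l₁)
    (hu₁ : N₂ = u₁ + l₀) (hu₂ : N₁ = u₂ + (k₀ + k₁)) (hu₃ : N₂ = u₃ + (l₀ + l₁))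
    (hu₄ : N₁ = u₄ + (k₀ + k₁ + k₂))
    (h12 : E₁ ≤ E₂) (h23 : E₂ ≤ E₃) (h31 : LeDual E₃ E₁) (h22 : LeDual E₂ E₂)
    (h45 : E₄ ≤ E₅) (h54 : LeDual E₅ E₄) :
    Nat.card {C : Submodule R (Ambient γ N₁ N₂) // HasPieces E₁ E₂ E₃ E₄ E₅ 5 C ∧
        IsSelfOrthogonal hγ.pow_three C} *
      Nat.card (ResidueField R) ^ (k₀ * (k₀ + 1) / 2 + k₀ * l₀ + (l₀ * (l₀ + 1) / 2 + l₀ * k₁) +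
        (k₀ * (k₀ + 1) / 2 + k₀ * (k₁ + l₀ + l₁))) =
      Nat.card (ResidueField R) ^ (u₁ * k₀ + u₂ * (l₀ + k₀) + u₃ * (k₁ + l₀ + k₀) +
        u₄ * (k₁ + l₀ + l₁ + k₀)) := by
  have := finite_chainQuot (γ := γ)
  have hF : Finite (ResidueField R) := Finite.of_surjective _ (residue_surjective (R := R))
  have hq : ∀ n, 0 < Nat.card (ResidueField R) ^ n := fun n => pow_pos Nat.card_pos _
  have hM := filtration_antitone (N₁ := N₁) (N₂ := N₂) hγ
  have s1 := HasGraded.card_succ (i := 1) (P := targetPiece γ E₁ E₂ E₃ E₄ E₅) hM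
    (filtration_succ_le hγ 1 (by norm_num)) (cond := fun _ => True) (cond' := fun _ => True)
    (fun _ _ => trivial) one_pos
    (fun D hD _ => card_lifts_one hγ h2 hE₁ hE₄ hu₁ hD)
  have s2 := HasGraded.card_succ (i := 2) (P := targetPiece γ E₁ E₂ E₃ E₄ E₅) hM
    (filtration_succ_le hγ 2 (by norm_num)) (cond := fun _ => True)
    (cond' := fun D' => ∀ x ∈ D', ∀ y ∈ D', γ ^ 2 ∣ euclForm hγ.pow_three x y)
    (fun _ _ => trivial) (hq _)
    (fun D hD _ => card_lifts_two hγ h2 hE₁ hE₂ hE₄ hu₂ h12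
      (fun x hx y hy => h22 x hx y (h12 hy)) (fun x hx y hy => h54 x (h45 hx) y hy) hD)
  have s3 := HasGraded.card_succ (i := 3) (P := targetPiece γ E₁ E₂ E₃ E₄ E₅) hM
    (filtration_succ_le hγ 3 (by norm_num))
    (cond := fun D' => ∀ x ∈ D', ∀ y ∈ D', γ ^ 2 ∣ euclForm hγ.pow_three x y)
    (cond' := fun D' => (∀ x ∈ D', ∀ y ∈ D', γ ^ 2 ∣ euclForm hγ.pow_three x y) ∧
        ∀ x ∈ D' ⊓ filtration γ N₁ N₂ 1, ∀ y ∈ D' ⊓ filtration γ N₁ N₂ 1,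
          euclForm hγ.pow_three x y = 0)
    (fun D' h => pow_two_dvd_euclForm_sup hγ h.1) (hq _)
    (fun D hD hf => card_lifts_three hγ h2 hE₁ hE₂ hE₄ hE₅ hu₃ h45 h22 h54 hD hf)
  have s4 := HasGraded.card_succ (i := 4) (P := targetPiece γ E₁ E₂ E₃ E₄ E₅) hM
    (filtration_succ_le hγ 4 (by norm_num))
    (cond := fun D' => (∀ x ∈ D', ∀ y ∈ D', γ ^ 2 ∣ euclForm hγ.pow_three x y) ∧
        ∀ x ∈ D' ⊓ filtration γ N₁ N₂ 1, ∀ y ∈ D' ⊓ filtration γ N₁ N₂ 1,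
          euclForm hγ.pow_three x y = 0)
    (cond' := IsSelfOrthogonal hγ.pow_three)
    (fun D' h => euclForm_conditions_sup hγ h) (hq _)
    (fun D hD hf => card_lifts_four hγ h2 hE₁ hE₂ hE₃ hE₄ hE₅ hu₄ h23 h31 hD hf.1 hf.2)
  have h1 := card_hasPieces_one (E₁ := E₁) (E₂ := E₂) (E₃ := E₃) (E₄ := E₄) (E₅ := E₅) hγ
  simp only [HasPieces] at h1
  rw [h1, one_mul, mul_one] at s1
  exact mul_pow_chain s1 s2 s3 s4

end GradedCountTotal

/-! ### The pieces of a code from a triangular generator matrix -/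

section Chain

open IsLocalRing

variable {R A ι : Type*} [CommRing R] [IsLocalRing R] [AddCommGroup A] [Module R A] {γ : R}

/-- If a combination of v plus an element of C lies in M, its coefficients are multiples of γ, and γ
times each v x is already in C. -/
theorem IsRelBasis.span_sup_inf [Fintype ι] (hγ : IsChainRing3 R γ) {M P C : Submodule R A}
    {v : ι → A} (h : IsRelBasis M P v) (hC : C ≤ M) (hv : ∀ x, γ • v x ∈ C) :
    (Submodule.span R (Set.range v) ⊔ C) ⊓ M = C := by
  refine le_antisymm ?_ (le_inf le_sup_right hC)
  rintro x ⟨hx, hxM⟩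
  obtain ⟨y, hy, z, hz, rfl⟩ := Submodule.mem_sup.1 hx
  obtain ⟨a, rfl⟩ := (Submodule.mem_span_range_iff_exists_fun R).1 hy
  have h1 := h.mem_maximalIdeal a ((Submodule.add_mem_iff_left _ (hC hz)).1 hxM)
  refine C.add_mem (Submodule.sum_mem _ fun i _ => ?_) hz
  obtain ⟨b, hb⟩ := hγ.mem_maximalIdeal.1 (h1 i)
  rw [hb, mul_comm, mul_smul]
  exact C.smul_mem _ (hv i)

/-- A chain of submodules `C j` built from representatives of bases of the pieces has these
pieces. -/
theorem hasGraded_of_chain (hγ : IsChainRing3 R γ) {M P C : ℕ → Submodule R A} (hM : Antitone M)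
    {n : ℕ} (hn : M n = ⊥) (hC : ∀ j, C j ≤ M j)
    (h : ∀ j < n, ∃ (ι : Type) (_ : Fintype ι) (v : ι → A), IsRelBasis (M (j + 1)) (P j) v ∧
      C j = Submodule.span R (Set.range v) ⊔ C (j + 1) ∧ ∀ x, γ • v x ∈ C (j + 1)) :
    HasGraded M P n (C 0) := by
  -- The chain is the filtration induced on C 0, by descending one layer at a time.
  have key : ∀ j ≤ n, C 0 ⊓ M j = C j := by
    intro j hj
    induction j with
    | zero => exact inf_eq_left.2 (hC 0)
    | succ j ih =>
      obtain ⟨ι, _, v, hv, h1, h2⟩ := h j hj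
      rw [← inf_eq_right.2 (hM (Nat.le_succ j)), ← inf_assoc, ih (by omega), h1]
      exact hv.span_sup_inf hγ (hC _) h2
  refine ⟨hn ▸ bot_le, fun j hj => ?_⟩
  obtain ⟨ι, _, v, hv, h1, h2⟩ := h j hj
  rw [key j hj.le, h1, sup_assoc, sup_eq_right.2 (hC (j + 1)), sup_comm, hv.sup_span]

end Chain

/-! ### Leading coefficients, torsion codes and triangular families -/

section LeadingTerms

open IsLocalRing

variable {R : Type*} [CommRing R] [IsLocalRing R] {γ : R} {S : Type*} [CommRing S] [Algebra R S]
  {n : ℕ} {ι : Type*} [Fintype ι]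

/-- Modulo the next layer a word γ^m c depends only on the residue of c, so a basis of the space of
residues gives a relative basis. -/
theorem isRelBasis_gradedPiece (hγ : IsChainRing3 R γ) {ν : ℕ} (hν3 : ν ≤ 3)
    (hν : ∀ x, algebraMap R S x = 0 ↔ γ ^ ν ∣ x) {m : ℕ} (hm : m < ν) (c : ι → Fin n → R)
    (hc : LinearIndependent (ResidueField R) fun x i => residue R (c x i)) :
    IsRelBasis (gradedPiece γ S (m + 1) ⊤)
      (gradedPiece γ S m (Submodule.span (ResidueField R)
        (Set.range fun x i => residue R (c x i))))
      (fun x i => algebraMap R S (γ ^ m * c x i)) := by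
  have hsum : ∀ a : ι → R, ∑ x, a x • (fun i => algebraMap R S (γ ^ m * c x i)) =
      fun i => algebraMap R S (γ ^ m * ∑ x, a x * c x i) := fun a => by
    ext i
    rw [Finset.sum_apply, Finset.mul_sum, map_sum]
    refine Finset.sum_congr rfl fun x _ => ?_
    rw [Pi.smul_apply, Algebra.smul_def, ← map_mul]
    congr 1
    ring
  refine ⟨le_antisymm (sup_le (gradedPiece_succ_le hγ) ?_) ?_, fun a ha => ?_⟩
  · rw [Submodule.span_le]
    rintro _ ⟨x, rfl⟩
    exact ⟨c x, Submodule.subset_span ⟨x, rfl⟩, rfl⟩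
  · rintro _ ⟨d, hd, rfl⟩
    obtain ⟨b, hb⟩ := (Submodule.mem_span_range_iff_exists_fun _).1 hd
    choose a ha using fun x => residue_surjective (R := R) (b x)
    have h1 : (fun i => algebraMap R S (γ ^ m * (d i - ∑ x, a x * c x i))) ∈
        gradedPiece γ S (m + 1) (⊤ : Submodule (ResidueField R) (Fin n → ResidueField R)) := by
      rw [mem_gradedPiece_succ (c := fun i => d i - ∑ x, a x * c x i) hγ hν3 hν hm]
      intro i
      rw [← hγ.residue_eq_zero, map_sub, sub_eq_zero, map_sum]
      have := congrFun hb i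
      rw [Finset.sum_apply] at this
      rw [← this]
      refine Finset.sum_congr rfl fun x _ => ?_
      rw [map_mul, ha]; rfl
    have h2 : (fun i => algebraMap R S (γ ^ m * d i)) =
        (fun i => algebraMap R S (γ ^ m * (d i - ∑ x, a x * c x i))) +
          ∑ x, a x • (fun i => algebraMap R S (γ ^ m * c x i)) := by
      rw [hsum]
      ext i
      rw [Pi.add_apply, ← map_add, ← mul_add, sub_add_cancel]
    rw [h2]
    exact Submodule.add_mem_sup h1 (Submodule.sum_mem _ fun x _ =>
      Submodule.smul_mem _ _ (Submodule.subset_span ⟨x, rfl⟩))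
  · rw [hsum, mem_gradedPiece_succ (c := fun i => ∑ x, a x * c x i) hγ hν3 hν hm] at ha
    intro x
    rw [← residue_eq_zero_iff]
    refine Fintype.linearIndependent_iff.1 hc (fun x => residue R (a x)) ?_ x
    ext i
    rw [Finset.sum_apply, Pi.zero_apply, ← hγ.residue_eq_zero.2 (ha i), map_sum]
    refine Finset.sum_congr rfl fun y _ => ?_
    rw [map_mul]; rfl

/-- The factor T belongs to both modules of the quotient, so the second components of v are
irrelevant as long as they lie in T. -/
theorem IsRelBasis.prod_left {A B : Type*} [AddCommGroup A] [Module R A] [AddCommGroup B]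
    [Module R B] {P Q : Submodule R A} {T : Submodule R B} {v : ι → A × B}
    (h : IsRelBasis P Q fun x => (v x).1) (hv : ∀ x, (v x).2 ∈ T) :
    IsRelBasis (P.prod T) (Q.prod T) v := by
  refine ⟨le_antisymm (sup_le (Submodule.prod_mono h.le le_rfl) ?_) ?_, fun a ha => ?_⟩
  · rw [Submodule.span_le]
    rintro _ ⟨x, rfl⟩
    exact ⟨h.mem x, hv x⟩
  · rintro ⟨y, z⟩ ⟨hy, hz⟩
    simp only at hy hz
    rw [← h.sup_span] at hy
    obtain ⟨p, hp, s, hs, rfl⟩ := Submodule.mem_sup.1 hy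
    obtain ⟨a, rfl⟩ := (Submodule.mem_span_range_iff_exists_fun R).1 hs
    have h2 : ((p + ∑ x, a x • (v x).1, z) : A × B) =
        (p, z - ∑ x, a x • (v x).2) + ∑ x, a x • v x := by
      ext <;> simp [Prod.fst_sum, Prod.snd_sum]
    rw [h2]
    exact Submodule.add_mem_sup ⟨hp, T.sub_mem hz (Submodule.sum_mem _ fun x _ =>
      T.smul_mem _ (hv x))⟩ (Submodule.sum_mem _ fun x _ =>
        Submodule.smul_mem _ _ (Submodule.subset_span ⟨x, rfl⟩))
  · refine h.mem_maximalIdeal a ?_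
    have := ha.1
    simpa [Prod.fst_sum] using this

theorem IsRelBasis.prod_right {A B : Type*} [AddCommGroup A] [Module R A] [AddCommGroup B]
    [Module R B] {P Q : Submodule R B} {T : Submodule R A} {v : ι → A × B}
    (h : IsRelBasis P Q fun x => (v x).2) (hv : ∀ x, (v x).1 ∈ T) :
    IsRelBasis (T.prod P) (T.prod Q) v := by
  refine ⟨le_antisymm (sup_le (Submodule.prod_mono le_rfl h.le) ?_) ?_, fun a ha => ?_⟩
  · rw [Submodule.span_le]
    rintro _ ⟨x, rfl⟩
    exact ⟨hv x, h.mem x⟩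
  · rintro ⟨z, y⟩ ⟨hz, hy⟩
    simp only at hy hz
    rw [← h.sup_span] at hy
    obtain ⟨p, hp, s, hs, rfl⟩ := Submodule.mem_sup.1 hy
    obtain ⟨a, rfl⟩ := (Submodule.mem_span_range_iff_exists_fun R).1 hs
    have h2 : ((z, p + ∑ x, a x • (v x).2) : A × B) =
        (z - ∑ x, a x • (v x).1, p) + ∑ x, a x • v x := by
      ext <;> simp [Prod.fst_sum, Prod.snd_sum]
    rw [h2]
    exact Submodule.add_mem_sup ⟨T.sub_mem hz (Submodule.sum_mem _ fun x _ =>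
      T.smul_mem _ (hv x)), hp⟩ (Submodule.sum_mem _ fun x _ =>
        Submodule.smul_mem _ _ (Submodule.subset_span ⟨x, rfl⟩))
  · refine h.mem_maximalIdeal a ?_
    have := ha.2
    simpa [Prod.snd_sum] using this

/-- A word γ^m c with residue in E lies in C only up to a word γ^(m+1) d. Replacing c by c - γ d
corrects this without changing the residue. -/
theorem torsionCode_eq (hγ : IsChainRing3 R γ) {ν : ℕ} (hν3 : ν ≤ 3)
    (hν : ∀ x, algebraMap R S x = 0 ↔ γ ^ ν ∣ x) {m : ℕ} (hm : m < ν)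
    {C : Submodule R (Fin n → S)} {E : Submodule (ResidueField R) (Fin n → ResidueField R)}
    (h : C ⊓ gradedPiece γ S m (⊤ : Submodule (ResidueField R) (Fin n → ResidueField R)) ⊔
      gradedPiece γ S (m + 1) (⊤ : Submodule (ResidueField R) (Fin n → ResidueField R)) =
        gradedPiece γ S m E) : torsionCode γ C m = E := by
  ext v
  constructor
  · rintro ⟨c, hc, hv⟩
    have h1 : (fun i => algebraMap R S (γ ^ m * c i)) ∈ gradedPiece γ S m E := by
      rw [← h]
      exact Submodule.mem_sup_left ⟨hc, mem_gradedPiece_top.2 ⟨c, rfl⟩⟩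
    have h2 := mem_of_mem_gradedPiece hγ hν3 hν hm h1
    rwa [funext hv] at h2
  · intro hv
    choose c hc using fun i => residue_surjective (R := R) (v i)
    have h1 : (fun i => algebraMap R S (γ ^ m * c i)) ∈ gradedPiece γ S m E :=
      ⟨c, by rwa [funext hc], rfl⟩
    rw [← h] at h1
    obtain ⟨y, hy, z, hz, h2⟩ := Submodule.mem_sup.1 h1
    obtain ⟨d, rfl⟩ := mem_gradedPiece_top.1 hz
    refine ⟨fun i => c i - γ * d i, ?_, fun i => ?_⟩
    · have : (fun i => algebraMap R S (γ ^ m * (c i - γ * d i))) = y := by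
        rw [eq_sub_of_add_eq h2]
        ext i
        rw [Pi.sub_apply, ← map_sub, pow_succ, mul_sub, mul_assoc]
      rw [this]
      exact hy.1
    · rw [map_sub, hγ.residue_mul_left, sub_zero, hc]

/-- A triangular family of vectors is linearly independent. -/
theorem linearIndependent_of_triangular {F : Type*} [Field F] {K : ℕ} {k : Fin K → ℕ}
    (e : (Σ i : Fin K, Fin (k i)) → Fin n → F) (p : (Σ i : Fin K, Fin (k i)) → Fin n)
    (h0 : ∀ x y, x.1 < y.1 → e y (p x) = 0)
    (h1 : ∀ i a b, e ⟨i, b⟩ (p ⟨i, a⟩) = if a = b then 1 else 0) : LinearIndependent F e := by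
  rw [Fintype.linearIndependent_iff]
  intro g hg
  -- Read the relation in the pivot columns of one block: rows of later blocks vanish there, rows of
  -- earlier blocks have coefficient zero by induction, and the block itself is an identity matrix.
  have key : ∀ N : ℕ, ∀ x : Σ i : Fin K, Fin (k i), x.1.val = N → g x = 0 := by
    intro N
    induction N using Nat.strong_induction_on with
    | _ N ih =>
      rintro ⟨i, a⟩ hx
      have h2 := congrFun hg (p ⟨i, a⟩)
      rw [Finset.sum_apply, Pi.zero_apply, Finset.sum_eq_single ⟨i, a⟩] at h2
      · simpa [h1] using h2
      · rintro ⟨j, b⟩ _ hne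
        rw [Pi.smul_apply, smul_eq_mul]
        rcases lt_trichotomy i j with hij | rfl | hij
        · rw [h0 _ _ hij, mul_zero]
        · rw [h1, if_neg, mul_zero]
          rintro rfl
          exact hne rfl
        · rw [ih j.val (hx ▸ hij) ⟨j, b⟩ rfl, zero_mul]
      · simp
  exact fun x => key _ x rfl

end LeadingTerms

/-! ### The pieces of a code with a generator matrix in standard form -/

section Rows

open IsLocalRing

variable {R A : Type*} [CommRing R] [IsLocalRing R] [AddCommGroup A] [Module R A] {γ : R}

/-- The pieces of the module generated by the rows `r x` of weight `w x`, where multiplication by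
`γ` raises the weight by `δ`. -/
theorem hasGraded_span_range (hγ : IsChainRing3 R γ) {M P : ℕ → Submodule R A} (hM : Antitone M)
    {n δ : ℕ} (hn : M n = ⊥) (hδ : 0 < δ) (hMγ : ∀ j, ∀ x ∈ M j, γ • x ∈ M (j + δ)) {I : Type}
    {r : I → A} {w : I → ℕ} (hr : ∀ x, r x ∈ M (w x))
    (h : ∀ j < n, ∃ (ι : Type) (_ : Fintype ι) (f : ι → I) (s : ι → ℕ),
      (∀ y, w (f y) + δ * s y = j) ∧ (∀ x t, w x + δ * t = j → ∃ y, f y = x ∧ s y = t) ∧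
      IsRelBasis (M (j + 1)) (P j) fun y => γ ^ s y • r (f y)) :
    HasGraded M P n (Submodule.span R (Set.range r)) := by
  have hrM : ∀ s x, γ ^ s • r x ∈ M (w x + δ * s) := by
    intro s x
    induction s with
    | zero => simpa using hr x
    | succ s ih =>
      rw [pow_succ', mul_smul, mul_add, mul_one, ← add_assoc]
      exact hMγ _ _ ih
  -- The induced filtration is generated by the multiples γ^s r x of total weight at least j; those
  -- of weight exactly j represent a basis of the piece.
  let C : ℕ → Submodule R A := fun j =>
    Submodule.span R {y | ∃ x s, j ≤ w x + δ * s ∧ γ ^ s • r x = y}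
  have h0 : C 0 = Submodule.span R (Set.range r) := by
    refine le_antisymm (Submodule.span_le.2 ?_) (Submodule.span_le.2 ?_)
    · rintro _ ⟨x, s, -, rfl⟩
      exact Submodule.smul_mem _ _ (Submodule.subset_span ⟨x, rfl⟩)
    · rintro _ ⟨x, rfl⟩
      exact Submodule.subset_span ⟨x, 0, Nat.zero_le _, by rw [pow_zero, one_smul]⟩
  rw [← h0]
  refine hasGraded_of_chain hγ hM hn (fun j => Submodule.span_le.2 ?_) fun j hj => ?_
  · rintro _ ⟨x, s, hs, rfl⟩
    exact hM hs (hrM s x)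
  · obtain ⟨ι, hι, f, s, h1, h2, h3⟩ := h j hj
    refine ⟨ι, hι, _, h3, le_antisymm (Submodule.span_le.2 ?_)
      (sup_le (Submodule.span_le.2 ?_) (Submodule.span_le.2 ?_)), fun y => ?_⟩
    · rintro _ ⟨x, t, ht, rfl⟩
      rcases ht.eq_or_lt with ht | ht
      · obtain ⟨y, rfl, rfl⟩ := h2 x t ht.symm
        exact Submodule.mem_sup_left (Submodule.subset_span ⟨y, rfl⟩)
      · exact Submodule.mem_sup_right (Submodule.subset_span ⟨x, t, ht, rfl⟩)
    · rintro _ ⟨y, rfl⟩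
      exact Submodule.subset_span ⟨f y, s y, (h1 y).ge, rfl⟩
    · rintro _ ⟨x, t, ht, rfl⟩
      exact Submodule.subset_span ⟨x, t, by omega, rfl⟩
    · refine Submodule.subset_span ⟨f y, s y + 1, ?_, by rw [pow_succ', mul_smul]⟩
      rw [mul_add, ← add_assoc, h1 y]
      omega

end Rows

/-! ### Pieces of the span of a triangular family of rows -/

section Triangular

open IsLocalRing

variable {R : Type*} [CommRing R] [IsLocalRing R] {γ : R} {S : Type*} [CommRing S] [Algebra R S]
  {n K : ℕ} {k : Fin K → ℕ}

theorem pow_smul_mem_gradedPiece {j s : ℕ} {x : Fin n → S}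
    {E : Submodule (ResidueField R) (Fin n → ResidueField R)} (h : x ∈ gradedPiece γ S j E) :
    γ ^ s • x ∈ gradedPiece γ S (j + s) E := by
  induction s with
  | zero => simpa using h
  | succ s ih =>
    rw [pow_succ', mul_smul]
    exact smul_mem_gradedPiece ih

/-- E m is spanned by the residues of the leading coefficients of the rows in the blocks 0, …, m; a
row of block i reaches layer m after multiplication by γ^(m-i). The identity blocks make these
residues linearly independent. -/
theorem exists_pieces_of_triangular (hγ : IsChainRing3 R γ) {ν : ℕ} (hν3 : ν ≤ 3)
    (hν : ∀ x, algebraMap R S x = 0 ↔ γ ^ ν ∣ x) (hK : K ≤ ν)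
    (row : (Σ i : Fin K, Fin (k i)) → Fin n → S) (p : (Σ i : Fin K, Fin (k i)) → Fin n)
    (hrow : ∀ x j, ∃ d, row x j = algebraMap R S (γ ^ x.1.val * d))
    (h0 : ∀ x y, x.1 < y.1 → row y (p x) = 0)
    (h1 : ∀ i a b, row ⟨i, b⟩ (p ⟨i, a⟩) = if a = b then algebraMap R S (γ ^ i.val) else 0) :
    ∃ E : ℕ → Submodule (ResidueField R) (Fin n → ResidueField R),
      (∀ m, Module.finrank (ResidueField R) (E m) =
        Fintype.card {x : Σ i : Fin K, Fin (k i) // x.1.val ≤ m}) ∧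
      ∀ m < ν, IsRelBasis (gradedPiece γ S (m + 1) ⊤) (gradedPiece γ S m (E m))
        fun x : {x : Σ i : Fin K, Fin (k i) // x.1.val ≤ m} => γ ^ (m - x.1.1.val) • row x.1 := by
  choose c hc using hrow
  have hlin : LinearIndependent (ResidueField R) fun x i => residue R (c x i) := by
    refine linearIndependent_of_triangular _ p (fun x y hxy => ?_) fun i a b => ?_
    · rw [← map_zero (residue R)]
      refine residue_eq_of_algebraMap_eq hγ hν3 hν (y.1.2.trans_le hK) ?_
      rw [← hc, h0 x y hxy, mul_zero, map_zero]
    · have : (if a = b then (1 : ResidueField R) else 0) = residue R (if a = b then 1 else 0) := by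
        split_ifs <;> simp
      rw [this]
      refine residue_eq_of_algebraMap_eq hγ hν3 hν (i.2.trans_le hK) ?_
      rw [← hc ⟨i, b⟩, h1]
      split_ifs <;> simp
  refine ⟨fun m => Submodule.span _ (Set.range
    fun (x : {x : Σ i : Fin K, Fin (k i) // x.1.val ≤ m}) i => residue R (c x.1 i)), ?_, ?_⟩
  · intro m
    exact finrank_span_eq_card (hlin.comp _ Subtype.val_injective)
  · intro m hm
    have h := isRelBasis_gradedPiece (S := S) hγ hν3 hν hm
      (fun (x : {x : Σ i : Fin K, Fin (k i) // x.1.val ≤ m}) => c x.1)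
      (hlin.comp _ Subtype.val_injective)
    convert h using 1
    ext x i
    rw [Pi.smul_apply, hc, Algebra.smul_def, ← map_mul, ← mul_assoc, ← pow_add,
      Nat.sub_add_cancel x.2]

/-- For a single alphabet the layers are the γ-adic ones, so multiplication by γ raises the weight
by one. -/
theorem torsionCode_span_range (hγ : IsChainRing3 R γ) {ν : ℕ} (hν3 : ν ≤ 3)
    (hν : ∀ x, algebraMap R S x = 0 ↔ γ ^ ν ∣ x)
    {row : (Σ i : Fin K, Fin (k i)) → Fin n → S}
    (hrow : ∀ x, row x ∈ gradedPiece γ S x.1.val ⊤)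
    {E : ℕ → Submodule (ResidueField R) (Fin n → ResidueField R)}
    (h : ∀ m < ν, IsRelBasis (gradedPiece γ S (m + 1) ⊤) (gradedPiece γ S m (E m))
        fun x : {x : Σ i : Fin K, Fin (k i) // x.1.val ≤ m} => γ ^ (m - x.1.1.val) • row x.1)
    {m : ℕ} (hm : m < ν) :
    torsionCode γ (Submodule.span R (Set.range row)) m = E m := by
  have hG : HasGraded (fun j => gradedPiece γ S j ⊤) (fun j => gradedPiece γ S j (E j)) ν
      (Submodule.span R (Set.range row)) :=
    hasGraded_span_range (δ := 1) (w := fun x => x.1.val) hγ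
      (fun _ _ h => gradedPiece_antitone_top hγ h) (gradedPiece_eq_bot hν) one_pos
      (fun _ _ h => smul_mem_gradedPiece h) hrow fun j hj =>
      ⟨_, inferInstance, _, fun x : {x : Σ i : Fin K, Fin (k i) // x.1.val ≤ j} => j - x.1.1.val,
        fun y => by have := y.2; simp only; omega, fun x t ht => ⟨⟨x, by omega⟩, rfl, by
          simp only; omega⟩, h j hj⟩
  exact torsionCode_eq hγ hν3 hν hm (hG.2 m hm)

theorem card_sigma_le_three (k : Fin 3 → ℕ) (m : ℕ) :
    Fintype.card {x : Σ i : Fin 3, Fin (k i) // x.1.val ≤ m} =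
      k 0 + (if 1 ≤ m then k 1 else 0) + if 2 ≤ m then k 2 else 0 := by
  rw [Fintype.card_subtype, Finset.card_filter, Fintype.sum_sigma, Fin.sum_univ_three]
  simp

theorem card_sigma_le_two (k : Fin 2 → ℕ) (m : ℕ) :
    Fintype.card {x : Σ i : Fin 2, Fin (k i) // x.1.val ≤ m} =
      k 0 + if 1 ≤ m then k 1 else 0 := by
  rw [Fintype.card_subtype, Finset.card_filter, Fintype.sum_sigma, Fin.sum_univ_two]
  simp

end Triangular

/-! ### Pieces of a code read off from a matrix in standard form -/

section StandardForm

open IsLocalRing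

variable {R : Type*} [CommRing R] {γ : R} {N₁ N₂ : ℕ} {k : Fin 3 → ℕ} {l : Fin 2 → ℕ}

theorem blocksX_castSucc (i : Fin 3) : blocksX N₁ k i.castSucc = k i := by
  fin_cases i <;> rfl

theorem blocksY_castSucc (i : Fin 2) : blocksY N₂ l i.castSucc = l i := by
  fin_cases i <;> rfl

namespace MixedStdGen

theorem B_mem [IsLocalRing R] (G : MixedStdGen γ N₁ N₂ k l) (x : Σ i : Fin 3, Fin (k i)) :
    G.B x ∈ gradedPiece γ (ChainQuot γ) x.1.val
      (⊤ : Submodule (ResidueField R) (Fin N₂ → ResidueField R)) := by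
  have h : ∀ j, ∃ d, algebraMap R (ChainQuot γ) (γ ^ x.1.val * d) = G.B x j := fun j => by
    obtain ⟨⟨i, b⟩, rfl⟩ := G.colY.symm.surjective j
    rcases le_or_gt i.val x.1.val with h | h
    · exact ⟨0, by rw [G.B_lower x.1 x.2 i b h, mul_zero, map_zero]⟩
    · obtain ⟨d, hd⟩ := G.B_upper x.1 x.2 i b h
      obtain ⟨d, rfl⟩ := surjective_algebraMap_chainQuot d
      exact ⟨d, by rw [map_mul, map_pow, hd]⟩
  choose d hd using h
  exact mem_gradedPiece_top.2 ⟨d, funext hd⟩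

theorem C_mem [IsLocalRing R] (G : MixedStdGen γ N₁ N₂ k l) (x : Σ i : Fin 2, Fin (l i)) :
    G.C x ∈ gradedPiece γ R (x.1.val + 1)
      (⊤ : Submodule (ResidueField R) (Fin N₁ → ResidueField R)) := by
  have h : ∀ j, ∃ d, γ ^ (x.1.val + 1) * d = G.C x j := fun j => by
    obtain ⟨⟨i, b⟩, rfl⟩ := G.colX.symm.surjective j
    rcases le_or_gt i.val (x.1.val + 1) with h | h
    · exact ⟨0, by rw [G.C_lower x.1 x.2 i b h, mul_zero]⟩
    · obtain ⟨d, hd⟩ := G.C_upper x.1 x.2 i b h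
      exact ⟨d, hd.symm⟩
  choose d hd using h
  exact mem_gradedPiece_top.2 ⟨d, funext hd⟩

theorem exists_A_eq (G : MixedStdGen γ N₁ N₂ k l) (x : Σ i : Fin 3, Fin (k i)) (j : Fin N₁) :
    ∃ d, G.A x j = algebraMap R R (γ ^ x.1.val * d) := by
  obtain ⟨⟨i, b⟩, rfl⟩ := G.colX.symm.surjective j
  rcases lt_trichotomy i.val x.1.val with h | h | h
  · exact ⟨0, by rw [G.A_lower x.1 x.2 i b h, mul_zero, map_zero]⟩
  · refine ⟨if b.val = x.2.val then 1 else 0, ?_⟩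
    rw [G.A_diag x.1 x.2 i b h]
    split_ifs <;> simp
  · obtain ⟨d, hd⟩ := G.A_upper x.1 x.2 i b h
    exact ⟨d, hd⟩

theorem exists_D_eq (G : MixedStdGen γ N₁ N₂ k l) (x : Σ i : Fin 2, Fin (l i)) (j : Fin N₂) :
    ∃ d, G.D x j = algebraMap R (ChainQuot γ) (γ ^ x.1.val * d) := by
  obtain ⟨⟨i, b⟩, rfl⟩ := G.colY.symm.surjective j
  rcases lt_trichotomy i.val x.1.val with h | h | h
  · exact ⟨0, by rw [G.D_lower x.1 x.2 i b h, mul_zero, map_zero]⟩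
  · refine ⟨if b.val = x.2.val then 1 else 0, ?_⟩
    rw [G.D_diag x.1 x.2 i b h]
    split_ifs <;> simp
  · obtain ⟨d, hd⟩ := G.D_upper x.1 x.2 i b h
    obtain ⟨d, rfl⟩ := surjective_algebraMap_chainQuot d
    exact ⟨d, by rw [map_mul, map_pow, hd]⟩

variable [IsLocalRing R]

theorem exists_pieces_X (hγ : IsChainRing3 R γ) (G : MixedStdGen γ N₁ N₂ k l) :
    ∃ E : ℕ → Submodule (ResidueField R) (Fin N₁ → ResidueField R),
      (∀ m, Module.finrank (ResidueField R) (E m) =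
        Fintype.card {x : Σ i : Fin 3, Fin (k i) // x.1.val ≤ m}) ∧
      ∀ m < 3, IsRelBasis (gradedPiece γ R (m + 1) ⊤) (gradedPiece γ R m (E m))
        fun x : {x : Σ i : Fin 3, Fin (k i) // x.1.val ≤ m} => γ ^ (m - x.1.1.val) • G.A x.1 :=
  exists_pieces_of_triangular hγ le_rfl (algebraMap_self_eq_zero hγ) le_rfl G.A
    (fun x => G.colX.symm ⟨x.1.castSucc, Fin.cast (blocksX_castSucc x.1).symm x.2⟩)
    G.exists_A_eq
    (fun x y hxy => G.A_lower y.1 y.2 _ _ hxy)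
    (fun i a b => by
      rw [G.A_diag i b _ _ (by simp)]
      simp only [Fin.val_cast, Fin.ext_iff]
      rfl)

theorem exists_pieces_Y (hγ : IsChainRing3 R γ) (G : MixedStdGen γ N₁ N₂ k l) :
    ∃ E : ℕ → Submodule (ResidueField R) (Fin N₂ → ResidueField R),
      (∀ m, Module.finrank (ResidueField R) (E m) =
        Fintype.card {x : Σ i : Fin 2, Fin (l i) // x.1.val ≤ m}) ∧
      ∀ m < 2, IsRelBasis (gradedPiece γ (ChainQuot γ) (m + 1) ⊤)
        (gradedPiece γ (ChainQuot γ) m (E m))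
        fun x : {x : Σ i : Fin 2, Fin (l i) // x.1.val ≤ m} => γ ^ (m - x.1.1.val) • G.D x.1 :=
  exists_pieces_of_triangular hγ (by norm_num) IsChainRing3.chainQuot_eq_zero le_rfl G.D
    (fun x => G.colY.symm ⟨x.1.castSucc, Fin.cast (blocksY_castSucc x.1).symm x.2⟩)
    G.exists_D_eq
    (fun x y hxy => G.D_lower y.1 y.2 _ _ hxy)
    (fun i a b => by
      rw [G.D_diag i b _ _ (by simp), map_pow]
      simp only [Fin.val_cast, Fin.ext_iff])

/-- Rows (A | B) of block i have weight 2i, rows (C | D) of block i have weight 2i + 1, and γ raises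
the weight by two. By parity the even layers see only multiples of the former, the odd layers only
multiples of the latter; the components in B and C are absorbed by the factor that is full in that
layer. -/
theorem hasGraded_code (hγ : IsChainRing3 R γ) (G : MixedStdGen γ N₁ N₂ k l)
    {EX : ℕ → Submodule (ResidueField R) (Fin N₁ → ResidueField R)}
    {EY : ℕ → Submodule (ResidueField R) (Fin N₂ → ResidueField R)}
    (hX : ∀ m < 3, IsRelBasis (gradedPiece γ R (m + 1) ⊤) (gradedPiece γ R m (EX m))
        fun x : {x : Σ i : Fin 3, Fin (k i) // x.1.val ≤ m} => γ ^ (m - x.1.1.val) • G.A x.1)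
    (hY : ∀ m < 2, IsRelBasis (gradedPiece γ (ChainQuot γ) (m + 1) ⊤)
        (gradedPiece γ (ChainQuot γ) m (EY m))
        fun x : {x : Σ i : Fin 2, Fin (l i) // x.1.val ≤ m} => γ ^ (m - x.1.1.val) • G.D x.1) :
    HasPieces (EX 0) (EX 1) (EX 2) (EY 0) (EY 1) 5 G.code := by
  have hA : ∀ x, G.A x ∈ gradedPiece γ R x.1.val
      (⊤ : Submodule (ResidueField R) (Fin N₁ → ResidueField R)) := fun x => by
    choose d hd using G.exists_A_eq x
    exact mem_gradedPiece_top.2 ⟨d, funext fun j => (hd j).symm⟩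
  have hD : ∀ x, G.D x ∈ gradedPiece γ (ChainQuot γ) x.1.val
      (⊤ : Submodule (ResidueField R) (Fin N₂ → ResidueField R)) := fun x => by
    choose d hd using G.exists_D_eq x
    exact mem_gradedPiece_top.2 ⟨d, funext fun j => (hd j).symm⟩
  have heven : ∀ m < 3, ∃ (ι : Type) (_ : Fintype ι)
      (f : ι → (Σ i : Fin 3, Fin (k i)) ⊕ (Σ i : Fin 2, Fin (l i))) (s : ι → ℕ),
      (∀ y, Sum.elim (fun x => 2 * x.1.val) (fun x => 2 * x.1.val + 1) (f y) + 2 * s y = 2 * m) ∧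
      (∀ x t, Sum.elim (fun x => 2 * x.1.val) (fun x => 2 * x.1.val + 1) x + 2 * t = 2 * m →
        ∃ y, f y = x ∧ s y = t) ∧
      IsRelBasis (block γ (m + 1) m ⊤ ⊤) (block γ m m (EX m) ⊤) fun y => γ ^ s y •
        Sum.elim (fun x => ((G.A x, G.B x) : Ambient γ N₁ N₂)) (fun x => (G.C x, G.D x)) (f y) := by
    intro m hm
    refine ⟨{x : Σ i : Fin 3, Fin (k i) // x.1.val ≤ m}, inferInstance, fun x => Sum.inl x.1,
      fun x => m - x.1.1.val, fun x => ?_, ?_, IsRelBasis.prod_left (hX m hm) fun x => ?_⟩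
    · have := x.2
      simp only [Sum.elim_inl]
      omega
    · rintro (x | x) t ht
      · simp only [Sum.elim_inl] at ht
        exact ⟨⟨x, by omega⟩, rfl, by simp only; omega⟩
      · simp only [Sum.elim_inr] at ht
        omega
    · have := pow_smul_mem_gradedPiece (s := m - x.1.1.val) (G.B_mem x.1)
      rwa [Nat.add_sub_cancel' x.2] at this
  have hodd : ∀ m < 2, ∃ (ι : Type) (_ : Fintype ι)
      (f : ι → (Σ i : Fin 3, Fin (k i)) ⊕ (Σ i : Fin 2, Fin (l i))) (s : ι → ℕ),
      (∀ y, Sum.elim (fun x => 2 * x.1.val) (fun x => 2 * x.1.val + 1) (f y) + 2 * s y =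
        2 * m + 1) ∧
      (∀ x t, Sum.elim (fun x => 2 * x.1.val) (fun x => 2 * x.1.val + 1) x + 2 * t = 2 * m + 1 →
        ∃ y, f y = x ∧ s y = t) ∧
      IsRelBasis (block γ (m + 1) (m + 1) ⊤ ⊤) (block γ (m + 1) m ⊤ (EY m)) fun y => γ ^ s y •
        Sum.elim (fun x => ((G.A x, G.B x) : Ambient γ N₁ N₂)) (fun x => (G.C x, G.D x)) (f y) := by
    intro m hm
    refine ⟨{x : Σ i : Fin 2, Fin (l i) // x.1.val ≤ m}, inferInstance, fun x => Sum.inr x.1,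
      fun x => m - x.1.1.val, fun x => ?_, ?_, IsRelBasis.prod_right (hY m hm) fun x => ?_⟩
    · have := x.2
      simp only [Sum.elim_inr]
      omega
    · rintro (x | x) t ht
      · simp only [Sum.elim_inl] at ht
        omega
      · simp only [Sum.elim_inr] at ht
        exact ⟨⟨x, by omega⟩, rfl, by simp only; omega⟩
    · have := pow_smul_mem_gradedPiece (s := m - x.1.1.val) (G.C_mem x.1)
      rwa [show x.1.1.val + 1 + (m - x.1.1.val) = m + 1 by have := x.2; omega] at this
  have hcode : G.code = Submodule.span R (Set.range (Sum.elim
      (fun x => ((G.A x, G.B x) : Ambient γ N₁ N₂)) (fun x => (G.C x, G.D x)))) := by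
    rw [Set.Sum.elim_range]
    rfl
  rw [HasPieces, hcode]
  refine hasGraded_span_range (δ := 2)
    (w := Sum.elim (fun x => 2 * x.1.val) (fun x => 2 * x.1.val + 1)) hγ (filtration_antitone hγ)
    (filtration_five hγ) two_pos (fun _ _ h => smul_mem_filtration h) ?_ ?_
  · rintro (x | x)
    · simp only [Sum.elim_inl, filtration]
      rw [show (2 * x.1.val + 1) / 2 = x.1.val by omega, show 2 * x.1.val / 2 = x.1.val by omega]
      exact ⟨hA x, G.B_mem x⟩
    · simp only [Sum.elim_inr, filtration]
      rw [show (2 * x.1.val + 1 + 1) / 2 = x.1.val + 1 by omega,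
        show (2 * x.1.val + 1) / 2 = x.1.val by omega]
      exact ⟨G.C_mem x, hD x⟩
  · intro j hj
    interval_cases j
    · exact heven 0 (by norm_num)
    · exact hodd 0 (by norm_num)
    · exact heven 1 (by norm_num)
    · exact hodd 1 (by norm_num)
    · exact heven 2 (by norm_num)

/-- The pieces of a code with a generator matrix in standard form are the torsion codes. -/
theorem exists_hasPieces (hγ : IsChainRing3 R γ) (G : MixedStdGen γ N₁ N₂ k l) :
    ∃ (E₁ E₂ E₃ : Submodule (ResidueField R) (Fin N₁ → ResidueField R))
      (E₄ E₅ : Submodule (ResidueField R) (Fin N₂ → ResidueField R)),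
      HasPieces E₁ E₂ E₃ E₄ E₅ 5 G.code ∧
      Module.finrank (ResidueField R) E₁ = k 0 ∧ Module.finrank (ResidueField R) E₂ = k 0 + k 1 ∧
      Module.finrank (ResidueField R) E₃ = k 0 + k 1 + k 2 ∧
      Module.finrank (ResidueField R) E₄ = l 0 ∧ Module.finrank (ResidueField R) E₅ = l 0 + l 1 ∧
      torsionCode γ G.codeX 0 = E₁ ∧ torsionCode γ G.codeX 1 = E₂ ∧
      torsionCode γ G.codeX 2 = E₃ ∧ torsionCode γ G.codeY 0 = E₄ ∧ torsionCode γ G.codeY 1 = E₅ := by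
  obtain ⟨EX, hX2, hX3⟩ := G.exists_pieces_X hγ
  obtain ⟨EY, hY2, hY3⟩ := G.exists_pieces_Y hγ
  have hA : ∀ x, G.A x ∈ gradedPiece γ R x.1.val
      (⊤ : Submodule (ResidueField R) (Fin N₁ → ResidueField R)) := fun x => by
    choose d hd using G.exists_A_eq x
    exact mem_gradedPiece_top.2 ⟨d, funext fun j => (hd j).symm⟩
  have hD : ∀ x, G.D x ∈ gradedPiece γ (ChainQuot γ) x.1.val
      (⊤ : Submodule (ResidueField R) (Fin N₂ → ResidueField R)) := fun x => by
    choose d hd using G.exists_D_eq x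
    exact mem_gradedPiece_top.2 ⟨d, funext fun j => (hd j).symm⟩
  have tX : ∀ m < 3, torsionCode γ G.codeX m = EX m := fun m hm =>
    torsionCode_span_range hγ le_rfl (algebraMap_self_eq_zero hγ) hA hX3 hm
  have tY : ∀ m < 2, torsionCode γ G.codeY m = EY m := fun m hm =>
    torsionCode_span_range hγ (by norm_num) IsChainRing3.chainQuot_eq_zero hD hY3 hm
  refine ⟨EX 0, EX 1, EX 2, EY 0, EY 1, G.hasGraded_code hγ hX3 hY3, ?_, ?_, ?_, ?_, ?_,
    tX 0 (by norm_num), tX 1 (by norm_num), tX 2 (by norm_num), tY 0 (by norm_num),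
    tY 1 (by norm_num)⟩
  all_goals simp only [hX2, hY2, card_sigma_le_three, card_sigma_le_two]; simp

end MixedStdGen

end StandardForm

/-! ### Generator matrices in standard form exist -/

section InformationSets

variable {F : Type*} [Field F] {n : ℕ}

/-- An information set of a subspace extends to an information set of a larger subspace. -/
theorem exists_informationSet {E E' : Submodule F (Fin n → F)} (h : E ≤ E') {I : Finset (Fin n)}
    (hI : ∀ a : Fin n → F, ∃ e ∈ E, ∀ i ∈ I, e i = a i) :
    ∃ I' : Finset (Fin n), I ⊆ I' ∧ I'.card = Module.finrank F E' ∧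
      ∀ a : Fin n → F, ∃ e ∈ E', ∀ i ∈ I', e i = a i := by
  classical
  obtain ⟨I', -, ⟨hI', hs⟩, hmax⟩ := Finite.exists_le_maximal
    (p := fun J : Finset (Fin n) => I ⊆ J ∧ ∀ a : Fin n → F, ∃ e ∈ E', ∀ i ∈ J, e i = a i)
    (a := I) ⟨subset_rfl, fun a => (hI a).imp fun e he => ⟨h he.1, he.2⟩⟩
  refine ⟨I', hI', ?_, hs⟩
  let φ : E' →ₗ[F] (I' → F) := LinearMap.pi fun i => LinearMap.proj i.1 ∘ₗ E'.subtype
  -- A nonzero x in E' vanishing on I' would allow I' to be enlarged by a coordinate where x does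
  -- not vanish, against maximality.
  have hinj : Function.Injective φ := by
    rw [injective_iff_map_eq_zero]
    intro x hx
    by_contra hne
    obtain ⟨j, hj⟩ : ∃ j, x.1 j ≠ 0 := by
      by_contra! hall
      exact hne (Subtype.ext (funext hall))
    have hjI : j ∉ I' := fun hjI => hj (congrFun hx ⟨j, hjI⟩)
    refine hjI (hmax ⟨hI'.trans (Finset.subset_insert _ _), fun a => ?_⟩
      (Finset.subset_insert _ _) (Finset.mem_insert_self j I'))
    obtain ⟨e, he, hea⟩ := hs a
    refine ⟨e + ((a j - e j) / x.1 j) • x.1, E'.add_mem he (E'.smul_mem _ x.2), fun i hi => ?_⟩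
    rcases Finset.mem_insert.1 hi with rfl | hi
    · rw [Pi.add_apply, Pi.smul_apply, smul_eq_mul, div_mul_cancel₀ _ hj, add_sub_cancel]
    · have : x.1 i = 0 := congrFun hx ⟨i, hi⟩
      rw [Pi.add_apply, Pi.smul_apply, this, smul_zero, add_zero, hea i hi]
  have hsurj : Function.Surjective φ := fun a => by
    obtain ⟨e, he, hea⟩ := hs fun i => if hi : i ∈ I' then a ⟨i, hi⟩ else 0
    refine ⟨⟨e, he⟩, funext fun i => ?_⟩
    have := hea i.1 i.2
    rwa [dif_pos i.2] at this
  have := (LinearEquiv.ofBijective φ ⟨hinj, hsurj⟩).finrank_eq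
  rw [this, Module.finrank_fintype_fun_eq_card, Fintype.card_coe]

/-- The coordinates can be grouped so that the first `m + 1` groups form an information set of
`E m`. -/
theorem exists_columns {K : ℕ} {E : ℕ → Submodule F (Fin n → F)} (hE : Monotone E)
    (hK : E K = ⊤) {b : Fin (K + 1) → ℕ} (h0 : Module.finrank F (E 0) = b 0)
    (hs : ∀ m : Fin K, Module.finrank F (E (m.val + 1)) = Module.finrank F (E m) + b m.succ) :
    ∃ col : Fin n ≃ Σ j : Fin (K + 1), Fin (b j), ∀ m ≤ K, ∀ a : Fin n → F,
      ∃ e ∈ E m, ∀ i, (col i).1.val ≤ m → e i = a i := by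
  classical
  have hI : ∃ I : ℕ → Finset (Fin n), (∀ m, I m ⊆ I (m + 1)) ∧ ∀ m,
      (I m).card = Module.finrank F (E m) ∧ ∀ a : Fin n → F, ∃ e ∈ E m, ∀ i ∈ I m, e i = a i := by
    obtain ⟨I₀, -, hI₀⟩ := exists_informationSet (le_refl (E 0)) (I := ∅)
      fun a => ⟨0, (E 0).zero_mem, by simp⟩
    have step : ∀ m (J : {J : Finset (Fin n) // J.card = Module.finrank F (E m) ∧
        ∀ a : Fin n → F, ∃ e ∈ E m, ∀ i ∈ J, e i = a i}),
        ∃ J' : {J : Finset (Fin n) // J.card = Module.finrank F (E (m + 1)) ∧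
        ∀ a : Fin n → F, ∃ e ∈ E (m + 1), ∀ i ∈ J, e i = a i}, J.1 ⊆ J'.1 := fun m J => by
      obtain ⟨J', h1, h2⟩ := exists_informationSet (hE (Nat.le_succ m)) J.2.2
      exact ⟨⟨J', h2⟩, h1⟩
    choose g hg using step
    let I : ∀ m, {J : Finset (Fin n) // J.card = Module.finrank F (E m) ∧
        ∀ a : Fin n → F, ∃ e ∈ E m, ∀ i ∈ J, e i = a i} := fun m =>
      Nat.rec ⟨I₀, hI₀⟩ (fun m J => g m J) m
    exact ⟨fun m => (I m).1, fun m => hg m (I m), fun m => (I m).2⟩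
  obtain ⟨I, hmono, hI⟩ := hI
  have hmono' : Monotone I := monotone_nat_of_le_succ hmono
  have hIK : I K = Finset.univ := by
    rw [← Finset.card_eq_iff_eq_univ, (hI K).1, hK, finrank_top, Module.finrank_fin_fun,
      Fintype.card_fin]
  have hex : ∀ i, ∃ m, i ∈ I m := fun i => ⟨K, by rw [hIK]; exact Finset.mem_univ i⟩
  have hle : ∀ i m, Nat.find (hex i) ≤ m ↔ i ∈ I m := fun i m =>
    ⟨fun h => hmono' h (Nat.find_spec (hex i)), fun h => Nat.find_min' _ h⟩
  -- Group a coordinate by the first information set in the chain that contains it.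
  let f : Fin n → Fin (K + 1) := fun i => ⟨Nat.find (hex i),
    Nat.lt_succ_of_le ((hle i K).2 (by rw [hIK]; exact Finset.mem_univ i))⟩
  have hf : ∀ i (j : Fin (K + 1)), f i = j ↔ Nat.find (hex i) = j.val := fun i j => by
    rw [Fin.ext_iff]
  have hcard : ∀ j, Fintype.card {i // f i = j} = b j := by
    refine Fin.cases ?_ fun m => ?_
    · rw [← h0, ← (hI 0).1, Fintype.card_subtype]
      congr 1
      ext i
      rw [Finset.mem_filter_univ, hf, ← hle]
      simp
    · have : Finset.univ.filter (fun i => f i = m.succ) = I (m.val + 1) \ I m.val := by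
        ext i
        rw [Finset.mem_filter_univ, hf, Finset.mem_sdiff, ← hle, ← hle, Fin.val_succ]
        omega
      rw [Fintype.card_subtype, this, Finset.card_sdiff_of_subset (hmono _), (hI _).1, (hI _).1, hs]
      omega
  refine ⟨(Equiv.sigmaFiberEquiv f).symm.trans
    (Equiv.sigmaCongrRight fun j => Fintype.equivFinOfCardEq (hcard j)), fun m _ a => ?_⟩
  obtain ⟨e, he, h⟩ := (hI m).2 a
  exact ⟨e, he, fun i hi => h i ((hle i m).1 hi)⟩

end InformationSets

theorem Submodule.eq_of_le_of_card_eq {R A : Type*} [Ring R] [AddCommGroup A] [Module R A] [Finite A]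
    {C D : Submodule R A} (h : C ≤ D) (hc : Nat.card C = Nat.card D) : C = D :=
  SetLike.coe_injective (Set.eq_of_subset_of_ncard_le h (by
    rw [← Nat.card_coe_set_eq, ← Nat.card_coe_set_eq]
    exact hc.ge) (Set.toFinite _))

/-! ### Gaussian elimination to standard form -/

section StandardFormExists

open IsLocalRing

variable {R : Type*} [CommRing R] [IsLocalRing R] {γ : R} {N₁ N₂ : ℕ}

/-- The columns in p are an information set of E, so the leading coefficient of x can be matched
there by an element of E. What remains is u, supported off p, and an error in the next layer. -/
theorem exists_sub_mem_gradedPiece {S : Type*} [CommRing S] [Algebra R S] {n : ℕ}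
    (hγ : IsChainRing3 R γ) {m : ℕ}
    {E : Submodule (ResidueField R) (Fin n → ResidueField R)} {p : Fin n → Prop} [DecidablePred p]
    (hp : ∀ a : Fin n → ResidueField R, ∃ e ∈ E, ∀ i, p i → e i = a i) {x : Fin n → S}
    (hx : x ∈ gradedPiece γ S m (⊤ : Submodule _ (Fin n → ResidueField R))) :
    ∃ y ∈ gradedPiece γ S m E, ∃ u : Fin n → S, (∀ i, p i → u i = 0) ∧
      x - y - u ∈ gradedPiece γ S (m + 1) (⊤ : Submodule _ (Fin n → ResidueField R)) := by
  obtain ⟨c, rfl⟩ := mem_gradedPiece_top.1 hx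
  obtain ⟨e, he, hec⟩ := hp fun i => residue R (c i)
  choose d hd using fun i => residue_surjective (R := R) (e i)
  have h1 : ∀ i, ∃ z, p i → c i - d i = γ * z := fun i => by
    by_cases hi : p i
    · have : residue R (c i - d i) = 0 := by rw [map_sub, hd, hec i hi, sub_self]
      obtain ⟨z, hz⟩ := hγ.residue_eq_zero.1 this
      exact ⟨z, fun _ => hz⟩
    · exact ⟨0, fun h => absurd h hi⟩
  choose z hz using h1
  refine ⟨_, ⟨d, by rwa [funext hd], rfl⟩,
    fun i => if p i then 0 else algebraMap R S (γ ^ m * (c i - d i)), fun i hi => if_pos hi, ?_⟩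
  refine mem_gradedPiece_top.2 ⟨fun i => if p i then z i else 0, ?_⟩
  ext i
  by_cases hi : p i
  · simp only [if_pos hi, Pi.sub_apply, sub_zero, ← map_sub, ← mul_sub, hz i hi, pow_succ, mul_assoc]
  · simp only [if_neg hi, Pi.sub_apply, ← map_sub, ← mul_sub, mul_zero, sub_self, map_zero]

/-- Elimination with pivots in the information sets: a word of C matches d in the pivot columns of
the current layer, the discrepancy in the other columns is discarded, and the error in the next
layer is removed by induction. The induction descends from the zero layer M₅, where all columns are
matched. -/
theorem HasPieces.exists_reduce (hγ : IsChainRing3 R γ)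
    {EX : ℕ → Submodule (ResidueField R) (Fin N₁ → ResidueField R)}
    {EY : ℕ → Submodule (ResidueField R) (Fin N₂ → ResidueField R)}
    {C : Submodule R (Ambient γ N₁ N₂)} (hC : HasPieces (EX 0) (EX 1) (EX 2) (EY 0) (EY 1) 5 C)
    {bX : Fin N₁ → ℕ} {bY : Fin N₂ → ℕ}
    (hX : ∀ m < 3, ∀ a : Fin N₁ → ResidueField R, ∃ e ∈ EX m, ∀ i, bX i ≤ m → e i = a i)
    (hY : ∀ m < 2, ∀ a : Fin N₂ → ResidueField R, ∃ e ∈ EY m, ∀ i, bY i ≤ m → e i = a i)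
    {j : ℕ} (hj : j ≤ 5) : ∀ d ∈ filtration γ N₁ N₂ j, ∃ c ∈ C ⊓ filtration γ N₁ N₂ j,
      (∀ i, bX i ≤ (j + 1) / 2 → c.1 i = d.1 i) ∧ ∀ i, bY i ≤ j / 2 → c.2 i = d.2 i := by
  have hanti := filtration_antitone (N₁ := N₁) (N₂ := N₂) hγ
  have heven : ∀ m < 3, C ⊓ filtration γ N₁ N₂ (2 * m) ⊔ filtration γ N₁ N₂ (2 * m + 1) =
      block γ m m (EX m) ⊤ := by
    intro m hm
    interval_cases m
    · exact hC.2 0 (by norm_num)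
    · exact hC.2 2 (by norm_num)
    · exact hC.2 4 (by norm_num)
  have hodd : ∀ m < 2, C ⊓ filtration γ N₁ N₂ (2 * m + 1) ⊔ filtration γ N₁ N₂ (2 * m + 2) =
      block γ (m + 1) m ⊤ (EY m) := by
    intro m hm
    interval_cases m
    · exact hC.2 1 (by norm_num)
    · exact hC.2 3 (by norm_num)
  induction hj using Nat.decreasingInduction with
  | self =>
    intro d hd
    rw [filtration_five hγ, Submodule.mem_bot] at hd
    exact ⟨0, Submodule.zero_mem _, by simp [hd], by simp [hd]⟩
  | of_succ j hj ih =>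
    intro d hd
    obtain ⟨m, rfl | rfl⟩ := Nat.even_or_odd' j
    · have e1 : (2 * m + 1) / 2 = m := by omega
      have e2 : 2 * m / 2 = m := by omega
      have e3 : (2 * m + 1 + 1) / 2 = m + 1 := by omega
      simp only [filtration, e1, e2] at hd
      obtain ⟨y, hy, u, hu, hyu⟩ := exists_sub_mem_gradedPiece hγ (p := fun i => bX i ≤ m)
        (hX m (by omega)) hd.1
      have h1 : ((y, 0) : Ambient γ N₁ N₂) ∈ block γ m m (EX m) ⊤ := ⟨hy, Submodule.zero_mem _⟩
      rw [← heven m (by omega)] at h1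
      obtain ⟨c₀, hc₀, z, hz, hcz⟩ := Submodule.mem_sup.1 h1
      -- The vector u is zero on the columns still to be matched at layer j, so subtracting it costs
      -- nothing, and what is left lies one layer deeper.
      have hd' : d - c₀ - (u, 0) ∈ filtration γ N₁ N₂ (2 * m + 1) := by
        have : d - c₀ - (u, 0) = ((d.1 - y - u, d.2) : Ambient γ N₁ N₂) + z := by
          rw [eq_sub_of_add_eq hcz]
          ext <;> simp
          ring
        rw [this]
        refine Submodule.add_mem _ ?_ hz
        simp only [filtration, e1, e3]
        exact ⟨hyu, hd.2⟩
      obtain ⟨c₁, hc₁, h2, h3⟩ := ih _ hd'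
      rw [e3] at h2
      rw [e1] at h3
      refine ⟨c₀ + c₁, ⟨C.add_mem hc₀.1 hc₁.1,
        Submodule.add_mem _ hc₀.2 (hanti (Nat.le_succ _) hc₁.2)⟩, fun i hi => ?_, fun i hi => ?_⟩
      · rw [e1] at hi
        have := h2 i (by omega)
        rw [Prod.fst_add, Pi.add_apply, this]
        simp [hu i hi]
      · rw [e2] at hi
        have := h3 i hi
        rw [Prod.snd_add, Pi.add_apply, this]
        simp
    · have e1 : (2 * m + 1) / 2 = m := by omega
      have e3 : (2 * m + 1 + 1) / 2 = m + 1 := by omega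
      have e4 : (2 * m + 1 + 1 + 1) / 2 = m + 1 := by omega
      simp only [filtration, e1, e3] at hd
      obtain ⟨y, hy, u, hu, hyu⟩ := exists_sub_mem_gradedPiece hγ (p := fun i => bY i ≤ m)
        (hY m (by omega)) hd.2
      have h1 : ((0, y) : Ambient γ N₁ N₂) ∈ block γ (m + 1) m ⊤ (EY m) :=
        ⟨Submodule.zero_mem _, hy⟩
      rw [← hodd m (by omega)] at h1
      obtain ⟨c₀, hc₀, z, hz, hcz⟩ := Submodule.mem_sup.1 h1
      have hd' : d - c₀ - (0, u) ∈ filtration γ N₁ N₂ (2 * m + 1 + 1) := by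
        have : d - c₀ - (0, u) = ((d.1, d.2 - y - u) : Ambient γ N₁ N₂) + z := by
          rw [eq_sub_of_add_eq hcz]
          ext <;> simp
          ring
        rw [this]
        refine Submodule.add_mem _ ?_ hz
        simp only [filtration, e3, e4]
        exact ⟨hd.1, hyu⟩
      obtain ⟨c₁, hc₁, h2, h3⟩ := ih _ hd'
      rw [e4] at h2
      rw [e3] at h3
      refine ⟨c₀ + c₁, ⟨C.add_mem hc₀.1 hc₁.1,
        Submodule.add_mem _ hc₀.2 (hanti (Nat.le_succ _) hc₁.2)⟩, fun i hi => ?_, fun i hi => ?_⟩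
      · rw [e3] at hi
        have := h2 i hi
        rw [Prod.fst_add, Pi.add_apply, this]
        simp
      · rw [e1] at hi
        have := h3 i (by omega)
        rw [Prod.snd_add, Pi.add_apply, this]
        simp [hu i hi]

theorem HasPieces.card_eq [Finite R] (hγ : IsChainRing3 R γ)
    {E₁ E₂ E₃ : Submodule (ResidueField R) (Fin N₁ → ResidueField R)}
    {E₄ E₅ : Submodule (ResidueField R) (Fin N₂ → ResidueField R)}
    {C : Submodule R (Ambient γ N₁ N₂)} (hC : HasPieces E₁ E₂ E₃ E₄ E₅ 5 C) :
    Nat.card C = Nat.card (ResidueField R) ^ ∑ j ∈ Finset.range 5, targetDim E₁ E₂ E₃ E₄ E₅ j := by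
  have h0 : Nat.card ↥(C ⊓ filtration γ N₁ N₂ 0) = Nat.card C := by rw [filtration_zero, inf_top_eq]
  rw [← h0, hC.card_inf hγ (j := 0) (by norm_num) le_rfl, hC.card_inf hγ (j := 1) (by norm_num) le_rfl,
    hC.card_inf hγ (j := 2) (by norm_num) le_rfl, hC.card_inf hγ (j := 3) (by norm_num) le_rfl,
    hC.card_inf hγ (j := 4) (by norm_num) le_rfl, filtration_five hγ, inf_bot_eq,
    show Nat.card (⊥ : Submodule R (Ambient γ N₁ N₂)) = 1 from Nat.card_unique]
  simp only [Finset.sum_range_succ, Finset.sum_range_zero, pow_add, pow_zero]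
  ring

/-- A code with the pieces `E₁, …, E₅` has a generator matrix in standard form. -/
theorem HasPieces.exists_gen [Finite R] (hγ : IsChainRing3 R γ)
    {E₁ E₂ E₃ : Submodule (ResidueField R) (Fin N₁ → ResidueField R)}
    {E₄ E₅ : Submodule (ResidueField R) (Fin N₂ → ResidueField R)} {k : Fin 3 → ℕ} {l : Fin 2 → ℕ}
    (hE₁ : Module.finrank (ResidueField R) E₁ = k 0)
    (hE₂ : Module.finrank (ResidueField R) E₂ = k 0 + k 1)
    (hE₃ : Module.finrank (ResidueField R) E₃ = k 0 + k 1 + k 2)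
    (hE₄ : Module.finrank (ResidueField R) E₄ = l 0)
    (hE₅ : Module.finrank (ResidueField R) E₅ = l 0 + l 1) (h12 : E₁ ≤ E₂) (h23 : E₂ ≤ E₃)
    (h45 : E₄ ≤ E₅) {C : Submodule R (Ambient γ N₁ N₂)} (hC : HasPieces E₁ E₂ E₃ E₄ E₅ 5 C) :
    ∃ G : MixedStdGen γ N₁ N₂ k l, G.code = C := by
  classical
  have := finite_chainQuot (γ := γ)
  let EX : ℕ → Submodule (ResidueField R) (Fin N₁ → ResidueField R)
    | 0 => E₁
    | 1 => E₂
    | 2 => E₃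
    | _ => ⊤
  let EY : ℕ → Submodule (ResidueField R) (Fin N₂ → ResidueField R)
    | 0 => E₄
    | 1 => E₅
    | _ => ⊤
  have leX : k 0 + k 1 + k 2 ≤ N₁ := by
    rw [← hE₃]; simpa using E₃.finrank_le
  have leY : l 0 + l 1 ≤ N₂ := by
    rw [← hE₅]; simpa using E₅.finrank_le
  obtain ⟨colX, hX⟩ := exists_columns (K := 3) (E := EX) (b := blocksX N₁ k)
    (monotone_nat_of_le_succ fun
      | 0 => h12
      | 1 => h23
      | 2 => le_top
      | _ + 3 => le_rfl) rfl hE₁ (fun m => by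
      fin_cases m
      · change Module.finrank _ E₂ = Module.finrank _ E₁ + k 1
        rw [hE₂, hE₁]
      · change Module.finrank _ E₃ = Module.finrank _ E₂ + k 2
        rw [hE₃, hE₂]
      · change Module.finrank _ (⊤ : Submodule (ResidueField R) (Fin N₁ → ResidueField R)) =
          Module.finrank _ E₃ + (N₁ - (k 0 + k 1 + k 2))
        rw [hE₃, finrank_top, Module.finrank_fin_fun]
        omega)
  obtain ⟨colY, hY⟩ := exists_columns (K := 2) (E := EY) (b := blocksY N₂ l)
    (monotone_nat_of_le_succ fun
      | 0 => h45
      | 1 => le_top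
      | _ + 2 => le_rfl) rfl hE₄ (fun m => by
      fin_cases m
      · change Module.finrank _ E₅ = Module.finrank _ E₄ + l 1
        rw [hE₅, hE₄]
      · change Module.finrank _ (⊤ : Submodule (ResidueField R) (Fin N₂ → ResidueField R)) =
          Module.finrank _ E₅ + (N₂ - (l 0 + l 1))
        rw [hE₅, finrank_top, Module.finrank_fin_fun]
        omega)
  have hred := fun (j : ℕ) (hj : j ≤ 5) => HasPieces.exists_reduce hγ (EX := EX) (EY := EY)
    (C := C) hC (bX := fun i => (colX i).1.val) (bY := fun i => (colY i).1.val)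
    (fun m hm => hX m (by omega)) (fun m hm => hY m (by omega)) hj
  have hA : ∀ x : Σ i : Fin 3, Fin (k i), ∃ c ∈ C,
      c ∈ block γ x.1.val x.1.val (⊤ : Submodule (ResidueField R) (Fin N₁ → ResidueField R))
        (⊤ : Submodule (ResidueField R) (Fin N₂ → ResidueField R)) ∧
      (∀ i, (colX i).1.val ≤ x.1.val → c.1 i = (Pi.single (colX.symm ⟨x.1.castSucc,
        Fin.cast (blocksX_castSucc x.1).symm x.2⟩) (γ ^ x.1.val) : Fin N₁ → R) i) ∧
      ∀ i, (colY i).1.val ≤ x.1.val → c.2 i = 0 := by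
    intro x
    have e1 : (2 * x.1.val + 1) / 2 = x.1.val := by omega
    have e2 : 2 * x.1.val / 2 = x.1.val := by omega
    -- The row is the word of C that agrees with γ^i times the unit vector of its pivot on all
    -- columns of the blocks up to i.
    obtain ⟨c, hc, h1, h2⟩ := hred (2 * x.1.val) (by omega) (Pi.single (colX.symm ⟨x.1.castSucc,
        Fin.cast (blocksX_castSucc x.1).symm x.2⟩) (γ ^ x.1.val), 0) (by
      simp only [filtration, e1, e2]
      exact ⟨single_mem_gradedPiece (S := R) _, Submodule.zero_mem _⟩)
    simp only [filtration, e1, e2] at h1 h2 hc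
    exact ⟨c, hc.1, hc.2, h1, h2⟩
  have hD : ∀ x : Σ i : Fin 2, Fin (l i), ∃ c ∈ C,
      c ∈ block γ (x.1.val + 1) x.1.val
        (⊤ : Submodule (ResidueField R) (Fin N₁ → ResidueField R))
        (⊤ : Submodule (ResidueField R) (Fin N₂ → ResidueField R)) ∧
      (∀ i, (colX i).1.val ≤ x.1.val + 1 → c.1 i = 0) ∧
      ∀ i, (colY i).1.val ≤ x.1.val → c.2 i = (Pi.single (colY.symm ⟨x.1.castSucc,
        Fin.cast (blocksY_castSucc x.1).symm x.2⟩) (algebraMap R (ChainQuot γ) (γ ^ x.1.val)) :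
          Fin N₂ → ChainQuot γ) i := by
    intro x
    have e1 : (2 * x.1.val + 1) / 2 = x.1.val := by omega
    have e2 : (2 * x.1.val + 1 + 1) / 2 = x.1.val + 1 := by omega
    obtain ⟨c, hc, h1, h2⟩ := hred (2 * x.1.val + 1) (by omega)
      (0, Pi.single (colY.symm ⟨x.1.castSucc,
        Fin.cast (blocksY_castSucc x.1).symm x.2⟩) (algebraMap R (ChainQuot γ) (γ ^ x.1.val))) (by
      simp only [filtration, e1, e2]
      exact ⟨Submodule.zero_mem _, single_mem_gradedPiece _⟩)
    simp only [filtration, e1, e2] at h1 h2 hc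
    exact ⟨c, hc.1, hc.2, h1, h2⟩
  choose cA hA1 hA2 hA3 hA4 using hA
  choose cD hD1 hD2 hD3 hD4 using hD
  have dvdX : ∀ {m : ℕ} {x : Fin N₁ → R}, x ∈ gradedPiece γ R m
      (⊤ : Submodule (ResidueField R) (Fin N₁ → ResidueField R)) → ∀ i, γ ^ m ∣ x i := by
    intro m x hx i
    obtain ⟨c, rfl⟩ := mem_gradedPiece_top.1 hx
    exact dvd_mul_right _ _
  have dvdY : ∀ {m : ℕ} {x : Fin N₂ → ChainQuot γ}, x ∈ gradedPiece γ (ChainQuot γ) m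
      (⊤ : Submodule (ResidueField R) (Fin N₂ → ResidueField R)) → ∀ i,
      algebraMap R (ChainQuot γ) γ ^ m ∣ x i := by
    intro m x hx i
    obtain ⟨c, rfl⟩ := mem_gradedPiece_top.1 hx
    simp only [map_mul, map_pow]
    exact dvd_mul_right _ _
  let G : MixedStdGen γ N₁ N₂ k l :=
    { colX := colX
      colY := colY
      A := fun x => (cA x).1
      B := fun x => (cA x).2
      C := fun x => (cD x).1
      D := fun x => (cD x).2
      A_lower := fun i a j b h => by
        rw [hA3 ⟨i, a⟩ _ (by simpa using h.le), Pi.single_apply, if_neg]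
        intro h'
        have := congrArg (fun z => z.1.val) (colX.symm.injective h')
        simp only [Fin.val_castSucc] at this
        omega
      A_diag := fun i a j b h => by
        rw [hA3 ⟨i, a⟩ _ (by simpa using h.le), Pi.single_apply]
        refine if_congr ?_ rfl rfl
        obtain rfl : j = i.castSucc := Fin.ext h
        rw [colX.symm.injective.eq_iff]
        simp [Fin.ext_iff]
      A_upper := fun i a j b _ => dvdX (hA2 ⟨i, a⟩).1 _
      B_lower := fun i a j b h => hA4 ⟨i, a⟩ _ (by simpa using h)
      B_upper := fun i a j b _ => dvdY (hA2 ⟨i, a⟩).2 _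
      C_lower := fun i a j b h => hD3 ⟨i, a⟩ _ (by simpa using h)
      C_upper := fun i a j b _ => dvdX (hD2 ⟨i, a⟩).1 _
      D_lower := fun i a j b h => by
        rw [hD4 ⟨i, a⟩ _ (by simpa using h.le), Pi.single_apply, if_neg]
        intro h'
        have := congrArg (fun z => z.1.val) (colY.symm.injective h')
        simp only [Fin.val_castSucc] at this
        omega
      D_diag := fun i a j b h => by
        rw [hD4 ⟨i, a⟩ _ (by simpa using h.le), Pi.single_apply]
        refine if_congr ?_ (map_pow _ _ _) rfl
        obtain rfl : j = i.castSucc := Fin.ext h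
        rw [colY.symm.injective.eq_iff]
        simp [Fin.ext_iff]
      D_upper := fun i a j b _ => dvdY (hD2 ⟨i, a⟩).2 _ }
  -- The rows lie in C, and the size of a code is determined by the dimensions of its pieces, which
  -- agree.
  refine ⟨G, Submodule.eq_of_le_of_card_eq ?_ ?_⟩
  · rw [MixedStdGen.code, Submodule.span_le]
    rintro _ (⟨x, rfl⟩ | ⟨x, rfl⟩)
    · exact hA1 x
    · exact hD1 x
  · obtain ⟨E₁', E₂', E₃', E₄', E₅', hG, h1, h2, h3, h4, h5, -⟩ := G.exists_hasPieces hγ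
    rw [hG.card_eq hγ, hC.card_eq hγ]
    simp only [Finset.sum_range_succ, Finset.sum_range_zero, targetDim]
    rw [h1, h2, h3, h4, h5, hE₁, hE₂, hE₃, hE₄, hE₅]

end StandardFormExists

/-! ### Pieces, torsion codes and types -/

section Pieces

open IsLocalRing

variable {R : Type*} [CommRing R] [IsLocalRing R] {γ : R} {N₁ N₂ : ℕ}

/-- Submodules between two consecutive layers correspond to subspaces over the residue field, as
that quotient is killed by γ. -/
theorem exists_eq_gradedPiece (hγ : IsChainRing3 R γ) {S : Type*} [CommRing S] [Algebra R S]
    {n m : ℕ} {X : Submodule R (Fin n → S)}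
    (h1 : gradedPiece γ S (m + 1) (⊤ : Submodule _ (Fin n → ResidueField R)) ≤ X)
    (h2 : X ≤ gradedPiece γ S m (⊤ : Submodule _ (Fin n → ResidueField R))) :
    ∃ E : Submodule (ResidueField R) (Fin n → ResidueField R), X = gradedPiece γ S m E := by
  refine ⟨{ carrier := {e | ∃ c : Fin n → R, (fun i => algebraMap R S (γ ^ m * c i)) ∈ X ∧
                (fun i => residue R (c i)) = e}
            add_mem' := ?_
            zero_mem' := ⟨0, ?_, ?_⟩
            smul_mem' := ?_ }, le_antisymm ?_ ?_⟩
  · rintro _ _ ⟨c, hc, rfl⟩ ⟨d, hd, rfl⟩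
    refine ⟨c + d, ?_, by ext i; simp⟩
    convert X.add_mem hc hd using 1
    ext i
    simp only [Pi.add_apply, mul_add, map_add]
  · convert X.zero_mem using 1
    ext i
    simp
  · ext i
    simp
  · rintro a _ ⟨c, hc, rfl⟩
    obtain ⟨a, rfl⟩ := residue_surjective a
    refine ⟨a • c, ?_, by ext i; simp⟩
    convert X.smul_mem a hc using 1
    ext i
    simp only [Pi.smul_apply, smul_eq_mul, Algebra.smul_def, ← map_mul]
    congr 1
    ring
  · intro x hx
    obtain ⟨c, rfl⟩ := mem_gradedPiece_top.1 (h2 hx)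
    exact ⟨c, ⟨c, hx, rfl⟩, rfl⟩
  · rintro _ ⟨d, ⟨c, hc, hcd⟩, rfl⟩
    have h3 : (fun i => algebraMap R S (γ ^ m * (d i - c i))) ∈
        gradedPiece γ S (m + 1) (⊤ : Submodule _ (Fin n → ResidueField R)) := by
      have : ∀ i, ∃ z, γ * z = d i - c i := fun i => by
        have : residue R (d i - c i) = 0 := by
          rw [map_sub, sub_eq_zero]
          exact (congrFun hcd i).symm
        obtain ⟨z, hz⟩ := hγ.residue_eq_zero.1 this
        exact ⟨z, hz.symm⟩
      choose z hz using this
      exact mem_gradedPiece_top.2 ⟨z, by ext i; rw [pow_succ, mul_assoc, hz]⟩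
    convert X.add_mem hc (h1 h3) using 1
    ext i
    rw [Pi.add_apply, ← map_add, ← mul_add, add_sub_cancel]

theorem Submodule.exists_eq_prod_left {R A B : Type*} [Ring R] [AddCommGroup A] [AddCommGroup B]
    [Module R A] [Module R B] {P Q : Submodule R A} {T : Submodule R B} {X : Submodule R (A × B)}
    (h1 : P.prod T ≤ X) (h2 : X ≤ Q.prod T) :
    ∃ Y : Submodule R A, P ≤ Y ∧ Y ≤ Q ∧ X = Y.prod T := by
  refine ⟨X.map (LinearMap.fst R A B), fun x hx => ⟨(x, 0), h1 ⟨hx, T.zero_mem⟩, rfl⟩, ?_,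
    le_antisymm (fun x hx => ⟨⟨x, hx, rfl⟩, (h2 hx).2⟩) ?_⟩
  · rintro _ ⟨x, hx, rfl⟩
    exact (h2 hx).1
  · rintro ⟨_, b⟩ ⟨⟨⟨a, b'⟩, hx, rfl⟩, hb⟩
    have h3 : ((0, b - b') : A × B) ∈ X := h1 ⟨P.zero_mem, T.sub_mem hb (h2 hx).2⟩
    simpa using X.add_mem hx h3

theorem Submodule.exists_eq_prod_right {R A B : Type*} [Ring R] [AddCommGroup A] [AddCommGroup B]
    [Module R A] [Module R B] {P Q : Submodule R B} {T : Submodule R A} {X : Submodule R (A × B)}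
    (h1 : T.prod P ≤ X) (h2 : X ≤ T.prod Q) :
    ∃ Y : Submodule R B, P ≤ Y ∧ Y ≤ Q ∧ X = T.prod Y := by
  refine ⟨X.map (LinearMap.snd R A B), fun x hx => ⟨(0, x), h1 ⟨T.zero_mem, hx⟩, rfl⟩, ?_,
    le_antisymm (fun x hx => ⟨(h2 hx).1, ⟨x, hx, rfl⟩⟩) ?_⟩
  · rintro _ ⟨x, hx, rfl⟩
    exact (h2 hx).2
  · rintro ⟨a, _⟩ ⟨ha, ⟨⟨a', b⟩, hx, rfl⟩⟩
    have h3 : ((a - a', 0) : A × B) ∈ X := h1 ⟨T.sub_mem ha (h2 hx).1, P.zero_mem⟩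
    simpa using X.add_mem hx h3

theorem exists_hasPieces (hγ : IsChainRing3 R γ) (C : Submodule R (Ambient γ N₁ N₂)) :
    ∃ E₁ E₂ E₃ E₄ E₅, HasPieces E₁ E₂ E₃ E₄ E₅ 5 C := by
  have hanti := filtration_antitone (N₁ := N₁) (N₂ := N₂) hγ
  have heven : ∀ m, ∃ E, C ⊓ filtration γ N₁ N₂ (2 * m) ⊔ filtration γ N₁ N₂ (2 * m + 1) =
      block γ m m E ⊤ := fun m => by
    have e1 : filtration γ N₁ N₂ (2 * m) = block γ m m ⊤ ⊤ := by
      rw [filtration, show (2 * m + 1) / 2 = m by omega, show 2 * m / 2 = m by omega]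
    have e2 : filtration γ N₁ N₂ (2 * m + 1) = block γ (m + 1) m ⊤ ⊤ := by
      rw [filtration, show (2 * m + 1 + 1) / 2 = m + 1 by omega, show (2 * m + 1) / 2 = m by omega]
    have h1 := hanti (show 2 * m ≤ 2 * m + 1 by omega)
    rw [e1, e2] at h1 ⊢
    obtain ⟨Y, hY1, hY2, hY⟩ := Submodule.exists_eq_prod_left
      (X := C ⊓ block γ m m ⊤ ⊤ ⊔ block γ (m + 1) m ⊤ ⊤) le_sup_right (sup_le inf_le_right h1)
    obtain ⟨E, rfl⟩ := exists_eq_gradedPiece hγ hY1 hY2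
    exact ⟨E, hY⟩
  have hodd : ∀ m, ∃ E, C ⊓ filtration γ N₁ N₂ (2 * m + 1) ⊔ filtration γ N₁ N₂ (2 * m + 2) =
      block γ (m + 1) m ⊤ E := fun m => by
    have e1 : filtration γ N₁ N₂ (2 * m + 1) = block γ (m + 1) m ⊤ ⊤ := by
      rw [filtration, show (2 * m + 1 + 1) / 2 = m + 1 by omega, show (2 * m + 1) / 2 = m by omega]
    have e2 : filtration γ N₁ N₂ (2 * m + 2) = block γ (m + 1) (m + 1) ⊤ ⊤ := by
      rw [filtration, show (2 * m + 2 + 1) / 2 = m + 1 by omega,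
        show (2 * m + 2) / 2 = m + 1 by omega]
    have h1 := hanti (show 2 * m + 1 ≤ 2 * m + 2 by omega)
    rw [e1, e2] at h1 ⊢
    obtain ⟨Y, hY1, hY2, hY⟩ := Submodule.exists_eq_prod_right
      (X := C ⊓ block γ (m + 1) m ⊤ ⊤ ⊔ block γ (m + 1) (m + 1) ⊤ ⊤) le_sup_right
      (sup_le inf_le_right h1)
    obtain ⟨E, rfl⟩ := exists_eq_gradedPiece hγ hY1 hY2
    exact ⟨E, hY⟩
  choose EX hEX using heven
  choose EY hEY using hodd
  refine ⟨EX 0, EX 1, EX 2, EY 0, EY 1, by rw [filtration_five hγ]; exact bot_le, fun j hj => ?_⟩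
  interval_cases j
  · exact hEX 0
  · exact hEY 0
  · exact hEX 1
  · exact hEY 1
  · exact hEX 2

variable {E₁ E₂ E₃ E₁' E₂' E₃' : Submodule (ResidueField R) (Fin N₁ → ResidueField R)}
  {E₄ E₅ E₄' E₅' : Submodule (ResidueField R) (Fin N₂ → ResidueField R)}
  {C : Submodule R (Ambient γ N₁ N₂)}

theorem block_left_inj (hγ : IsChainRing3 R γ) {a b : ℕ} (ha : a < 3)
    {E E' : Submodule (ResidueField R) (Fin N₁ → ResidueField R)}
    {T : Submodule (ResidueField R) (Fin N₂ → ResidueField R)}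
    (h : block γ a b E T = block γ a b E' T) : E = E' := by
  have key : ∀ {E E' : Submodule (ResidueField R) (Fin N₁ → ResidueField R)},
      block γ a b E T ≤ block γ a b E' T → E ≤ E' := fun h =>
    gradedPiece_inj hγ le_rfl (algebraMap_self_eq_zero hγ) ha fun x hx =>
      (h (show (x, 0) ∈ _ from ⟨hx, Submodule.zero_mem _⟩)).1
  exact le_antisymm (key h.le) (key h.ge)

theorem block_right_inj (hγ : IsChainRing3 R γ) {a b : ℕ} (hb : b < 2)
    {E E' : Submodule (ResidueField R) (Fin N₂ → ResidueField R)}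
    {T : Submodule (ResidueField R) (Fin N₁ → ResidueField R)}
    (h : block γ a b T E = block γ a b T E') : E = E' := by
  have key : ∀ {E E' : Submodule (ResidueField R) (Fin N₂ → ResidueField R)},
      block γ a b T E ≤ block γ a b T E' → E ≤ E' := fun h =>
    gradedPiece_inj hγ (by norm_num) IsChainRing3.chainQuot_eq_zero hb fun x hx =>
      (h (show (0, x) ∈ _ from ⟨Submodule.zero_mem _, hx⟩)).2
  exact le_antisymm (key h.le) (key h.ge)

theorem HasPieces.unique (hγ : IsChainRing3 R γ) (h : HasPieces E₁ E₂ E₃ E₄ E₅ 5 C)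
    (h' : HasPieces E₁' E₂' E₃' E₄' E₅' 5 C) :
    E₁ = E₁' ∧ E₂ = E₂' ∧ E₃ = E₃' ∧ E₄ = E₄' ∧ E₅ = E₅' := by
  have key : ∀ j < 5, targetPiece γ E₁ E₂ E₃ E₄ E₅ j = targetPiece γ E₁' E₂' E₃' E₄' E₅' j :=
    fun j hj => (h.2 j hj).symm.trans (h'.2 j hj)
  exact ⟨block_left_inj hγ (by norm_num) (key 0 (by norm_num)),
    block_left_inj hγ (by norm_num) (key 2 (by norm_num)),
    block_left_inj hγ (by norm_num) (key 4 (by norm_num)),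
    block_right_inj hγ (by norm_num) (key 1 (by norm_num)),
    block_right_inj hγ (by norm_num) (key 3 (by norm_num))⟩

/-- The words of `C` in the layer `j` of the filtration represent all elements of the piece. -/
theorem exists_mem_of_sup_eq {a b a' b' j : ℕ} {EX EX' : Submodule (ResidueField R) (Fin N₁ → ResidueField R)}
    {EY EY' : Submodule (ResidueField R) (Fin N₂ → ResidueField R)}
    (h : C ⊓ filtration γ N₁ N₂ j ⊔ block γ a' b' EX' EY' = block γ a b EX EY) {x : Fin N₁ → R}
    {y : Fin N₂ → R} (hx : (fun i => residue R (x i)) ∈ EX)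
    (hy : (fun i => residue R (y i)) ∈ EY) : ∃ c ∈ C ⊓ filtration γ N₁ N₂ j,
      ∃ (x' : Fin N₁ → R) (y' : Fin N₂ → R), c = (fun i => γ ^ a * x i - γ ^ a' * x' i,
        fun i => algebraMap R (ChainQuot γ) (γ ^ b * y i - γ ^ b' * y' i)) := by
  have h1 : ((fun i => γ ^ a * x i, fun i => algebraMap R (ChainQuot γ) (γ ^ b * y i)) :
      Ambient γ N₁ N₂) ∈ block γ a b EX EY := ⟨⟨x, hx, rfl⟩, ⟨y, hy, rfl⟩⟩
  rw [← h] at h1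
  obtain ⟨c, hc, z, hz, hcz⟩ := Submodule.mem_sup.1 h1
  obtain ⟨x', y', -, -, rfl⟩ := exists_of_mem_block hz
  refine ⟨c, hc, x', y', ?_⟩
  rw [eq_sub_of_add_eq hcz]
  ext i
  · rfl
  · simp only [map_sub]
    rfl

theorem HasPieces.exists_left (hγ : IsChainRing3 R γ) {m : ℕ}
    {E : Submodule (ResidueField R) (Fin N₁ → ResidueField R)}
    (h : C ⊓ filtration γ N₁ N₂ (2 * m) ⊔ block γ (m + 1) m ⊤ ⊤ = block γ m m E ⊤)
    {e : Fin N₁ → ResidueField R} (he : e ∈ E) : ∃ c ∈ C, ∃ (x : Fin N₁ → R) (y : Fin N₂ → R),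
      (∀ i, residue R (x i) = e i) ∧
      c = (fun i => γ ^ m * x i, fun i => algebraMap R (ChainQuot γ) (γ ^ m * y i)) := by
  choose x hx using fun i => residue_surjective (R := R) (e i)
  obtain ⟨c, hc, x', y', rfl⟩ := exists_mem_of_sup_eq h (x := x) (y := 0) (by rwa [funext hx])
    Submodule.mem_top
  refine ⟨_, hc.1, fun i => x i - γ * x' i, fun i => - y' i, fun i => ?_, ?_⟩
  · rw [map_sub, hγ.residue_mul_left, sub_zero, hx]
  · ext i
    · simp only
      ring
    · simp

theorem HasPieces.exists_right (hγ : IsChainRing3 R γ) {m : ℕ}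
    {E : Submodule (ResidueField R) (Fin N₂ → ResidueField R)}
    (h : C ⊓ filtration γ N₁ N₂ (2 * m + 1) ⊔ block γ (m + 1) (m + 1) ⊤ ⊤ = block γ (m + 1) m ⊤ E)
    {e : Fin N₂ → ResidueField R} (he : e ∈ E) : ∃ c ∈ C, ∃ (x : Fin N₁ → R) (y : Fin N₂ → R),
      (∀ i, residue R (y i) = e i) ∧
      c = (fun i => γ ^ (m + 1) * x i, fun i => algebraMap R (ChainQuot γ) (γ ^ m * y i)) := by
  choose y hy using fun i => residue_surjective (R := R) (e i)
  obtain ⟨c, hc, x', y', rfl⟩ := exists_mem_of_sup_eq h (x := 0) (y := y) Submodule.mem_top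
    (by rwa [funext hy])
  refine ⟨_, hc.1, fun i => - x' i, fun i => y i - γ * y' i, fun i => ?_, ?_⟩
  · rw [map_sub, hγ.residue_mul_left, sub_zero, hy]
  · ext i
    · simp
    · simp only
      congr 1
      ring

/-- Multiplication by γ takes a word of C two layers down, to the next layer of the same component,
and keeps its leading coefficient. -/
theorem HasPieces.monotone (hγ : IsChainRing3 R γ) (h : HasPieces E₁ E₂ E₃ E₄ E₅ 5 C) :
    E₁ ≤ E₂ ∧ E₂ ≤ E₃ ∧ E₄ ≤ E₅ := by
  have hX : ∀ {m : ℕ} {x : Fin N₁ → R} {y : Fin N₂ → R}, ((fun i => γ ^ m * x i,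
      fun i => algebraMap R (ChainQuot γ) (γ ^ m * y i)) : Ambient γ N₁ N₂) ∈ C →
      ((fun i => γ ^ (m + 1) * x i,
      fun i => algebraMap R (ChainQuot γ) (γ ^ (m + 1) * y i)) : Ambient γ N₁ N₂) ∈
        C ⊓ block γ (m + 1) (m + 1) ⊤ ⊤ := fun {m x y} hc => by
    refine ⟨?_, ⟨x, Submodule.mem_top, rfl⟩, ⟨y, Submodule.mem_top, rfl⟩⟩
    refine Set.mem_of_eq_of_mem ?_ (C.smul_mem γ hc)
    ext i
    · simp only [Prod.smul_mk, Pi.smul_apply, smul_eq_mul, pow_succ']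
      ring
    · simp only [Prod.smul_mk, Pi.smul_apply]
      rw [Algebra.smul_def, ← map_mul]
      congr 1
      ring
  refine ⟨fun e he => ?_, fun e he => ?_, fun e he => ?_⟩
  · obtain ⟨_, hc, x, y, hx, rfl⟩ := HasPieces.exists_left (m := 0) hγ (h.2 0 (by norm_num)) he
    have h1 := h.inf_le (j := 2) (by norm_num) (hX hc)
    have := mem_of_mem_gradedPiece (S := R) hγ le_rfl (algebraMap_self_eq_zero hγ) (by norm_num)
      h1.1
    rwa [funext hx] at this
  · obtain ⟨_, hc, x, y, hx, rfl⟩ := HasPieces.exists_left (m := 1) hγ (h.2 2 (by norm_num)) he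
    have h1 := h.inf_le (j := 4) (by norm_num) (hX hc)
    have := mem_of_mem_gradedPiece (S := R) hγ le_rfl (algebraMap_self_eq_zero hγ) (by norm_num)
      h1.1
    rwa [funext hx] at this
  · obtain ⟨_, hc, x, y, hy, rfl⟩ := HasPieces.exists_right (m := 0) hγ (h.2 1 (by norm_num)) he
    have h2 : ((fun i => γ ^ 2 * x i, fun i => algebraMap R (ChainQuot γ) (γ ^ 1 * y i)) :
        Ambient γ N₁ N₂) ∈ C ⊓ filtration γ N₁ N₂ 3 := by
      refine ⟨?_, ⟨x, Submodule.mem_top, rfl⟩, ⟨y, Submodule.mem_top, rfl⟩⟩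
      refine Set.mem_of_eq_of_mem ?_ (C.smul_mem γ hc)
      ext i
      · simp only [Prod.smul_mk, Pi.smul_apply, smul_eq_mul]
        ring
      · simp only [Prod.smul_mk, Pi.smul_apply]
        rw [Algebra.smul_def, ← map_mul]
        congr 1
        ring
    have h1 := h.inf_le (j := 3) (by norm_num) h2
    have := mem_of_mem_gradedPiece (S := ChainQuot γ) hγ (by norm_num)
      IsChainRing3.chainQuot_eq_zero (by norm_num) h1.2
    rwa [funext hy] at this

/-- In each of the three pairings the relevant component contributes γ² times a lift of the inner
product, and the other component is divisible by γ³ = 0. Vanishing of the form makes the inner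
product vanish modulo γ. -/
theorem HasPieces.leDual (hγ : IsChainRing3 R γ) (h : HasPieces E₁ E₂ E₃ E₄ E₅ 5 C)
    (hC : IsSelfOrthogonal hγ.pow_three C) : LeDual E₃ E₁ ∧ LeDual E₂ E₂ ∧ LeDual E₅ E₄ := by
  have key : ∀ {n : ℕ} {x x' : Fin n → R} {e e' : Fin n → ResidueField R},
      (∀ i, residue R (x i) = e i) → (∀ i, residue R (x' i) = e' i) →
      ∀ z : R, γ ^ 2 * ∑ i, x i * x' i + γ ^ 3 * z = 0 → ∑ i, e i * e' i = 0 := by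
    intro n x x' e e' hx hx' z hz
    rw [hγ.pow_three, zero_mul, add_zero, hγ.eq_zero_iff] at hz
    have := hγ.residue_eq_zero.2 (hγ.dvd_of_pow_dvd (by norm_num) le_rfl hz)
    rw [map_sum] at this
    simpa only [map_mul, hx, hx'] using this
  refine ⟨fun e he e' he' => ?_, fun e he e' he' => ?_, fun e he e' he' => ?_⟩
  · obtain ⟨_, hc, x, y, hx, rfl⟩ := HasPieces.exists_left (m := 2) hγ (h.2 4 (by norm_num)) he
    obtain ⟨_, hc', x', y', hx', rfl⟩ := HasPieces.exists_left (m := 0) hγ (h.2 0 (by norm_num)) he'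
    have h1 := hC _ hc _ hc'
    rw [euclForm_mk] at h1
    refine key hx hx' (∑ i, y i * y' i) (h1 ▸ ?_)
    simp only [Finset.mul_sum]
    congr 1 <;> exact Finset.sum_congr rfl fun i _ => by ring
  · obtain ⟨_, hc, x, y, hx, rfl⟩ := HasPieces.exists_left (m := 1) hγ (h.2 2 (by norm_num)) he
    obtain ⟨_, hc', x', y', hx', rfl⟩ := HasPieces.exists_left (m := 1) hγ (h.2 2 (by norm_num)) he'
    have h1 := hC _ hc _ hc'
    rw [euclForm_mk] at h1
    refine key hx hx' (∑ i, y i * y' i) (h1 ▸ ?_)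
    simp only [Finset.mul_sum]
    congr 1 <;> exact Finset.sum_congr rfl fun i _ => by ring
  · obtain ⟨_, hc, x, y, hx, rfl⟩ := HasPieces.exists_right (m := 1) hγ (h.2 3 (by norm_num)) he
    obtain ⟨_, hc', x', y', hx', rfl⟩ :=
      HasPieces.exists_right (m := 0) hγ (h.2 1 (by norm_num)) he'
    have h1 := hC _ hc _ hc'
    rw [euclForm_mk] at h1
    refine key hx hx' (∑ i, x i * x' i) (h1 ▸ ?_)
    rw [add_comm]
    simp only [Finset.mul_sum]
    congr 1 <;> exact Finset.sum_congr rfl fun i _ => by ring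

/-- The torsion codes of A and D are the pieces of the code, and the pieces are defined without a
generator matrix. So any matrix in standard form gives the same torsion codes. -/
theorem hasTorsionCodes_iff [Finite R] (hγ : IsChainRing3 R γ) :
    HasTorsionCodes C E₁ E₂ E₃ E₄ E₅ ↔ HasPieces E₁ E₂ E₃ E₄ E₅ 5 C := by
  constructor
  · rintro ⟨k, l, G, rfl, h1, h2, h3, h4, h5⟩
    obtain ⟨E₁', E₂', E₃', E₄', E₅', hG, -, -, -, -, -, t1, t2, t3, t4, t5⟩ :=
      G.exists_hasPieces hγ
    rw [SetLike.coe_injective (h1.symm.trans t1), SetLike.coe_injective (h2.symm.trans t2),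
      SetLike.coe_injective (h3.symm.trans t3), SetLike.coe_injective (h4.symm.trans t4),
      SetLike.coe_injective (h5.symm.trans t5)]
    exact hG
  · intro h
    obtain ⟨h12, h23, h45⟩ := h.monotone hγ
    have f12 := Submodule.finrank_mono h12
    have f23 := Submodule.finrank_mono h23
    have f45 := Submodule.finrank_mono h45
    obtain ⟨G, rfl⟩ := HasPieces.exists_gen hγ
      (k := ![Module.finrank (ResidueField R) E₁,
        Module.finrank (ResidueField R) E₂ - Module.finrank (ResidueField R) E₁,
        Module.finrank (ResidueField R) E₃ - Module.finrank (ResidueField R) E₂])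
      (l := ![Module.finrank (ResidueField R) E₄,
        Module.finrank (ResidueField R) E₅ - Module.finrank (ResidueField R) E₄]) (by simp)
      (by simp; omega) (by simp; omega) (by simp) (by simp; omega) h12 h23 h45 h
    refine ⟨_, _, G, rfl, ?_⟩
    obtain ⟨E₁', E₂', E₃', E₄', E₅', hG, -, -, -, -, -, t⟩ := G.exists_hasPieces hγ
    obtain ⟨rfl, rfl, rfl, rfl, rfl⟩ := h.unique hγ hG
    exact t

theorem hasType_iff [Finite R] (hγ : IsChainRing3 R γ) {k₀ k₁ k₂ l₀ l₁ : ℕ} :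
    HasType C k₀ k₁ k₂ l₀ l₁ ↔ ∃ E₁ E₂ E₃ E₄ E₅, HasPieces E₁ E₂ E₃ E₄ E₅ 5 C ∧
      Module.finrank (ResidueField R) E₁ = k₀ ∧ Module.finrank (ResidueField R) E₂ = k₀ + k₁ ∧
      Module.finrank (ResidueField R) E₃ = k₀ + k₁ + k₂ ∧
      Module.finrank (ResidueField R) E₄ = l₀ ∧ Module.finrank (ResidueField R) E₅ = l₀ + l₁ := by
  constructor
  · rintro ⟨G, rfl⟩
    obtain ⟨E₁, E₂, E₃, E₄, E₅, hG, h1, h2, h3, h4, h5, -⟩ := G.exists_hasPieces hγ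
    exact ⟨E₁, E₂, E₃, E₄, E₅, hG, h1, h2, h3, h4, h5⟩
  · rintro ⟨E₁, E₂, E₃, E₄, E₅, h, h1, h2, h3, h4, h5⟩
    obtain ⟨h12, h23, h45⟩ := h.monotone hγ
    exact HasPieces.exists_gen hγ h1 h2 h3 h4 h5 h12 h23 h45 h

end Pieces

/-! ### The exponent Θ₃ -/

section PrescribedTorsion

open IsLocalRing

variable {R : Type*} [CommRing R] [IsLocalRing R] {γ : R} {N₁ N₂ : ℕ}
  {E₁ E₂ E₃ : Submodule (ResidueField R) (Fin N₁ → ResidueField R)}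
  {E₄ E₅ : Submodule (ResidueField R) (Fin N₂ → ResidueField R)}

theorem card_selfOrthogonal_hasPieces_eq_zpow [Finite R] (hγ : IsChainRing3 R γ)
    (h2 : (2 : ResidueField R) ≠ 0) {k₀ k₁ k₂ l₀ l₁ : ℕ}
    (hE₁ : Module.finrank (ResidueField R) E₁ = k₀)
    (hE₂ : Module.finrank (ResidueField R) E₂ = k₀ + k₁)
    (hE₃ : Module.finrank (ResidueField R) E₃ = k₀ + k₁ + k₂)
    (hE₄ : Module.finrank (ResidueField R) E₄ = l₀)
    (hE₅ : Module.finrank (ResidueField R) E₅ = l₀ + l₁)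
    (h12 : E₁ ≤ E₂) (h23 : E₂ ≤ E₃) (h31 : LeDual E₃ E₁) (h22 : LeDual E₂ E₂)
    (h45 : E₄ ≤ E₅) (h54 : LeDual E₅ E₄) :
    (Nat.card {C : Submodule R (Ambient γ N₁ N₂) // HasPieces E₁ E₂ E₃ E₄ E₅ 5 C ∧
        IsSelfOrthogonal hγ.pow_three C} : ℚ) =
      (Nat.card (ResidueField R) : ℚ) ^ theta3 N₁ N₂ k₀ k₁ k₂ l₀ l₁ := by
  have hF : Finite (ResidueField R) := Finite.of_surjective _ (residue_surjective (R := R))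
  have hq : (Nat.card (ResidueField R) : ℚ) ≠ 0 := Nat.cast_ne_zero.2 Nat.card_pos.ne'
  have d2 := E₂.finrank_le
  have d3 := E₃.finrank_le
  have d4 := E₄.finrank_le
  have d5 := E₅.finrank_le
  rw [Module.finrank_fin_fun] at d2 d3 d4 d5
  obtain ⟨u₁, hu₁⟩ : ∃ u, N₂ = u + l₀ := ⟨N₂ - l₀, by omega⟩
  obtain ⟨u₂, hu₂⟩ : ∃ u, N₁ = u + (k₀ + k₁) := ⟨N₁ - (k₀ + k₁), by omega⟩
  obtain ⟨u₃, hu₃⟩ : ∃ u, N₂ = u + (l₀ + l₁) := ⟨N₂ - (l₀ + l₁), by omega⟩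
  obtain ⟨u₄, hu₄⟩ : ∃ u, N₁ = u + (k₀ + k₁ + k₂) := ⟨N₁ - (k₀ + k₁ + k₂), by omega⟩
  have h := card_selfOrthogonal_hasPieces hγ h2 hE₁ hE₂ hE₃ hE₄ hE₅ hu₁ hu₂ hu₃ hu₄ h12 h23 h31
    h22 h45 h54
  have half : ∀ n : ℕ, 2 * ((n * (n + 1) / 2 : ℕ) : ℚ) = n * (n + 1) := fun n => by
    have := Nat.mul_div_cancel' (Nat.even_mul_succ_self n).two_dvd
    exact_mod_cast this
  have hk := half k₀
  have hl := half l₀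
  -- The triangular numbers enter only through 2a = k₀(k₀+1) and 2b = l₀(l₀+1), so the comparison of
  -- exponents becomes a polynomial identity over ℚ.
  generalize k₀ * (k₀ + 1) / 2 = a at h hk
  generalize l₀ * (l₀ + 1) / 2 = b at h hl
  have h' := congrArg (Nat.cast : ℕ → ℚ) h
  push_cast at h'
  rw [← zpow_natCast, ← zpow_natCast, ← eq_div_iff (zpow_ne_zero _ hq), ← zpow_sub₀ hq] at h'
  rw [h']
  congr 1
  have e1 : (u₁ : ℚ) = N₂ - l₀ := by rw [hu₁]; push_cast; ring
  have e2 : (u₂ : ℚ) = N₁ - (k₀ + k₁) := by rw [hu₂]; push_cast; ring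
  have e3 : (u₃ : ℚ) = N₂ - (l₀ + l₁) := by rw [hu₃]; push_cast; ring
  have e4 : (u₄ : ℚ) = N₁ - (k₀ + k₁ + k₂) := by rw [hu₄]; push_cast; ring
  rw [← Int.cast_inj (α := ℚ), theta3_cast]
  push_cast
  rw [e1, e2, e3, e4]
  linear_combination -hk - hl / 2

end PrescribedTorsion

/-! ### Numbers of subspaces over a finite field -/

section Subspaces

theorem Nat.cast_card_eq_mul_of_fiber {α β : Type*} [Finite α] [Finite β] (f : α → β) (r : ℚ)
    (h : ∀ b, (Nat.card {a // f a = b} : ℚ) = r) : (Nat.card α : ℚ) = Nat.card β * r := by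
  classical
  have := Fintype.ofFinite β
  rw [← Nat.card_congr (Equiv.sigmaFiberEquiv f), Nat.card_sigma, Nat.cast_sum,
    Finset.sum_congr rfl fun b _ => h b]
  simp

variable {F V : Type*} [Field F] [Finite F] [AddCommGroup V] [Module F V] [Finite V]

theorem cast_card_linearIndependent {s : ℕ} (hs : Module.finrank F V = s) :
    (Nat.card {v : Fin s → V // LinearIndependent F v} : ℚ) =
      ∏ i ∈ Finset.range s, ((Nat.card F : ℚ) ^ s - (Nat.card F : ℚ) ^ i) := by
  have := Fintype.ofFinite F
  rw [card_linearIndependent hs.ge, hs, Nat.cast_prod, Finset.prod_range]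
  refine Finset.prod_congr rfl fun i _ => ?_
  rw [Nat.cast_sub (Nat.pow_le_pow_right Fintype.card_pos i.2.le), Nat.card_eq_fintype_card]
  push_cast
  rfl

theorem one_lt_cast_card (F : Type*) [Field F] [Finite F] : 1 < (Nat.card F : ℚ) := by
  exact_mod_cast Finite.one_lt_card

theorem pow_sub_pow_ne_zero {q : ℚ} (hq : 1 < q) {i s : ℕ} (h : i < s) : q ^ s - q ^ i ≠ 0 :=
  sub_ne_zero.2 (pow_lt_pow_right₀ hq h).ne'

/-- The number of subspaces with a hereditary property, from the number of one-dimensional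
extensions with this property. -/
theorem card_subspaces_of_extensions {P : Submodule F V → Prop} (hbot : P ⊥)
    (hP : ∀ E E', E ≤ E' → P E' → P E) (c : ℕ → ℚ) (s : ℕ)
    (hc : ∀ i < s, ∀ E : Submodule F V, Module.finrank F E = i → P E →
      (Nat.card {x // x ∉ E ∧ P (E ⊔ Submodule.span F {x})} : ℚ) = c i) :
    (Nat.card {E : Submodule F V // Module.finrank F E = s ∧ P E} : ℚ) =
      ∏ i ∈ Finset.range s, c i / ((Nat.card F : ℚ) ^ s - (Nat.card F : ℚ) ^ i) := by
  -- Ordered bases of subspaces with the property are counted vector by vector; heredity ensures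
  -- that all initial spans have the property.
  have htup : ∀ t ≤ s, (Nat.card {v : Fin t → V // LinearIndependent F v ∧
      P (Submodule.span F (Set.range v))} : ℚ) = ∏ i ∈ Finset.range t, c i := by
    intro t ht
    induction t with
    | zero =>
      have : Unique {v : Fin 0 → V // LinearIndependent F v ∧ P (Submodule.span F (Set.range v))} :=
        ⟨⟨⟨0, linearIndependent_empty_type, by simpa using hbot⟩⟩,
          fun v => Subtype.ext (Subsingleton.elim _ _)⟩
      rw [Nat.card_unique, Finset.range_zero, Finset.prod_empty, Nat.cast_one]
    | succ t ih =>
      have hspan : ∀ (v : Fin t → V) (x : V), Submodule.span F (Set.range (Fin.snoc v x : Fin (t + 1) → V)) =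
          Submodule.span F (Set.range v) ⊔ Submodule.span F {x} := fun v x => by
        rw [Fin.range_snoc, Set.insert_eq, Submodule.span_union, sup_comm]
      have hiff : ∀ (v : Fin t → V) (x : V),
          (LinearIndependent F (Fin.snoc v x : Fin (t + 1) → V) ∧
            P (Submodule.span F (Set.range (Fin.snoc v x : Fin (t + 1) → V)))) ↔
          (LinearIndependent F v ∧ P (Submodule.span F (Set.range v))) ∧
            (x ∉ Submodule.span F (Set.range v) ∧
              P (Submodule.span F (Set.range v) ⊔ Submodule.span F {x})) := fun v x => by
        rw [linearIndependent_finSnoc, hspan]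
        constructor
        · rintro ⟨⟨h1, h2⟩, h3⟩
          exact ⟨⟨h1, hP _ _ le_sup_left h3⟩, h2, h3⟩
        · rintro ⟨⟨h1, -⟩, h2, h3⟩
          exact ⟨⟨h1, h2⟩, h3⟩
      rw [Finset.prod_range_succ, ← ih (by omega)]
      refine Nat.cast_card_eq_mul_of_fiber (fun v => ⟨Fin.init v.1,
        ((hiff (Fin.init v.1) (v.1 (Fin.last t))).1 (by
          rw [Fin.snoc_init_self]; exact v.2)).1⟩) _ fun w => ?_
      rw [← hc t (by omega) _ (by simpa using finrank_span_eq_card w.2.1) w.2.2]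
      congr 1
      refine Nat.card_congr ⟨fun v => ⟨v.1.1 (Fin.last t), ?_⟩, fun x => ⟨⟨Fin.snoc w.1 x.1,
        (hiff w.1 x.1).2 ⟨w.2, x.2⟩⟩, Subtype.ext (Fin.init_snoc (α := fun _ => V) x.1 w.1)⟩, fun v => ?_, fun x => ?_⟩
      · have h1 := congrArg Subtype.val v.2
        simp only at h1
        rw [← h1]
        exact ((hiff _ _).1 (by rw [Fin.snoc_init_self]; exact v.1.2)).2
      · refine Subtype.ext (Subtype.ext ?_)
        have h1 := congrArg Subtype.val v.2
        simp only at h1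
        simp only [← h1, Fin.snoc_init_self]
      · exact Subtype.ext (Fin.snoc_last (α := fun _ => V) x.1 w.1)
  have h1 := htup s le_rfl
  have hq := one_lt_cast_card F
  -- Each subspace of dimension s has ∏ (q^s - q^i) ordered bases.
  rw [Nat.cast_card_eq_mul_of_fiber (β := {E : Submodule F V // Module.finrank F E = s ∧ P E})
    (fun v => ⟨Submodule.span F (Set.range v.1), by simpa using finrank_span_eq_card v.2.1, v.2.2⟩)
    (∏ i ∈ Finset.range s, ((Nat.card F : ℚ) ^ s - (Nat.card F : ℚ) ^ i)) fun E => ?_] at h1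
  · rw [Finset.prod_div_distrib, eq_div_iff]
    · exact h1
    · exact Finset.prod_ne_zero_iff.2 fun i hi => pow_sub_pow_ne_zero hq (Finset.mem_range.1 hi)
  · rw [← cast_card_linearIndependent E.2.1]
    congr 1
    refine Nat.card_congr ⟨fun v => ⟨fun i => ⟨v.1.1 i, ?_⟩, ?_⟩, fun w =>
      ⟨⟨fun i => (w.1 i).1, ?_⟩, ?_⟩, fun v => rfl, fun w => rfl⟩
    · rw [← congrArg Subtype.val v.2]
      exact Submodule.subset_span ⟨i, rfl⟩
    · exact LinearIndependent.of_comp E.1.subtype v.1.2.1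
    · have h2 := w.2.map' E.1.subtype (Submodule.ker_subtype _)
      refine ⟨by exact h2, hP _ _ (Submodule.span_le.2 ?_) E.2.2⟩
      rintro _ ⟨i, rfl⟩
      exact (w.1 i).2
    · have h2 := w.2.map' E.1.subtype (Submodule.ker_subtype _)
      refine Subtype.ext (Submodule.eq_of_le_of_finrank_eq (Submodule.span_le.2 ?_)
        (Eq.trans ?_ E.2.1.symm))
      · rintro _ ⟨i, rfl⟩
        exact (w.1 i).2
      · exact (finrank_span_eq_card h2).trans (Fintype.card_fin s)

theorem card_notMem {F V : Type*} [Field F] [AddCommGroup V] [Module F V] [Finite V]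
    (E : Submodule F V) :
    (Nat.card {x // x ∉ E} : ℚ) = Nat.card V - Nat.card E := by
  classical
  have h := Nat.card_congr (Equiv.sumCompl fun x => x ∈ E)
  rw [Nat.card_sum] at h
  rw [eq_sub_iff_add_eq, add_comm]
  exact_mod_cast h

/-- The number of subspaces of dimension `s`. -/
theorem card_subspaces (s : ℕ) :
    (Nat.card {E : Submodule F V // Module.finrank F E = s} : ℚ) =
      gaussBinom (Nat.card F) (Module.finrank F V) s := by
  have h := card_subspaces_of_extensions (F := F) (V := V) (P := fun _ => True) trivial
    (fun _ _ _ _ => trivial) (fun i => (Nat.card F : ℚ) ^ Module.finrank F V - (Nat.card F : ℚ) ^ i) s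
    (fun i _ E hE _ => by
      simp only [and_true]
      rw [card_notMem, Module.natCard_eq_pow_finrank (K := F) (V := V),
        Module.natCard_eq_pow_finrank (K := F) (V := E), hE]
      push_cast
      rfl)
  simp only [and_true] at h
  exact h

/-- The number of subspaces `E` of dimension `r + s` with `P ≤ E ≤ Q`, where `P` has dimension
`r`. -/
theorem card_subspaces_between {P Q : Submodule F V} (hPQ : P ≤ Q) {r s : ℕ}
    (hP : Module.finrank F P = r) :
    (Nat.card {E : Submodule F V // Module.finrank F E = r + s ∧ P ≤ E ∧ E ≤ Q} : ℚ) =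
      gaussBinom (Nat.card F) (Module.finrank F Q - r) s := by
  -- With W = T ⊓ Q for a complement T of P, the modular law makes E ↦ E ⊓ W and K ↦ P ⊔ K inverse
  -- to each other, and W has dimension dim Q - r.
  obtain ⟨T, hT⟩ := P.exists_isCompl
  have hsup : P ⊔ T ⊓ Q = Q := by rw [← sup_inf_assoc_of_le T hPQ, hT.sup_eq_top, top_inf_eq]
  have hinf : P ⊓ (T ⊓ Q) = ⊥ := by rw [← inf_assoc, hT.inf_eq_bot, bot_inf_eq]
  have hW := Submodule.finrank_sup_add_finrank_inf_eq P (T ⊓ Q)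
  rw [hsup, hinf, finrank_bot, hP, add_zero] at hW
  rw [hW, Nat.add_sub_cancel_left, ← card_subspaces (F := F) (V := ↥(T ⊓ Q)) s]
  generalize T ⊓ Q = W at hsup hinf
  congr 1
  refine Nat.card_congr (Equiv.symm ⟨fun K => ⟨P ⊔ K.1.map W.subtype, ?_, le_sup_left, ?_⟩,
    fun E => ⟨E.1.comap W.subtype, ?_⟩, fun K => Subtype.ext ?_, fun E => Subtype.ext ?_⟩)
  · have hK : P ⊓ K.1.map W.subtype = ⊥ :=
      eq_bot_iff.2 ((inf_le_inf_left P (Submodule.map_subtype_le W K.1)).trans hinf.le)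
    have h1 := Submodule.finrank_sup_add_finrank_inf_eq P (K.1.map W.subtype)
    rwa [hK, finrank_bot, hP, Submodule.finrank_map_subtype_eq, K.2, add_zero] at h1
  · rw [← hsup]
    exact sup_le_sup_left (Submodule.map_subtype_le W K.1) P
  · have h1 := Submodule.finrank_sup_add_finrank_inf_eq P (W ⊓ E.1)
    rw [← sup_inf_assoc_of_le W E.2.2.1, hsup, inf_eq_right.2 E.2.2.2, ← inf_assoc, hinf,
      bot_inf_eq, finrank_bot, hP, E.2.1, add_zero] at h1
    rw [← Submodule.finrank_map_subtype_eq, Submodule.map_comap_subtype]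
    omega
  · refine Submodule.map_injective_of_injective W.injective_subtype ?_
    rw [Submodule.map_comap_subtype]
    simp only
    rw [sup_comm, inf_comm, sup_inf_assoc_of_le P (Submodule.map_subtype_le W K.1), hinf,
      sup_bot_eq]
  · simp only
    rw [Submodule.map_comap_subtype, ← sup_inf_assoc_of_le W E.2.2.1, hsup,
      inf_eq_right.2 E.2.2.2]

end Subspaces

/-! ### The number of zeros of a sum of squares -/

section SumsOfSquares

variable {F : Type*} [Field F] [Finite F]

open Classical in
/-- The sign of `-1`: `1` if it is a square, and `-1` otherwise. -/
noncomputable def negOneSign (F : Type*) [Field F] : ℚ := if IsSquare (-1 : F) then 1 else -1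

theorem card_sq_eq_neg_sq (h2 : (2 : F) ≠ 0) {y : F} (hy : y ≠ 0) :
    (Nat.card {x : F // x ^ 2 + y ^ 2 = 0} : ℚ) = 1 + negOneSign F := by
  classical
  have := Fintype.ofFinite F
  rw [negOneSign]
  split_ifs with h
  · obtain ⟨i, hi⟩ := h
    have h0 : i * y ≠ 0 := by
      refine mul_ne_zero ?_ hy
      rintro rfl
      simp at hi
    have hne : i * y ≠ -(i * y) := fun h => by
      rw [eq_neg_iff_add_eq_zero, ← two_mul] at h
      exact (mul_ne_zero h2 h0) h
    have : {x : F | x ^ 2 + y ^ 2 = 0} = {i * y, -(i * y)} := by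
      ext x
      rw [Set.mem_ofPred_eq, Set.mem_insert_iff, Set.mem_singleton_iff]
      have : x ^ 2 + y ^ 2 = (x - i * y) * (x + i * y) := by
        linear_combination (-y ^ 2) * hi
      rw [this, mul_eq_zero, sub_eq_zero, eq_neg_iff_add_eq_zero]
    rw [← Set.coe_ofPred, Nat.card_coe_set_eq, this, Set.ncard_pair hne]
    norm_num
  · have : IsEmpty {x : F // x ^ 2 + y ^ 2 = 0} := ⟨fun x => h ⟨x.1 / y, by
      have := x.2
      field_simp
      linear_combination -this⟩⟩
    rw [Nat.card_of_isEmpty]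
    norm_num

theorem card_sq_add_sq_eq_zero (h2 : (2 : F) ≠ 0) :
    (Nat.card {p : F × F // p.1 ^ 2 + p.2 ^ 2 = 0} : ℚ) =
      1 + (Nat.card F - 1) * (1 + negOneSign F) := by
  classical
  have := Fintype.ofFinite F
  let e : {p : F × F // p.1 ^ 2 + p.2 ^ 2 = 0} ≃ Σ y : F, {x : F // x ^ 2 + y ^ 2 = 0} :=
    ⟨fun p => ⟨p.1.2, p.1.1, p.2⟩, fun z => ⟨(z.2.1, z.1), z.2.2⟩, fun _ => rfl, fun _ => rfl⟩
  rw [Nat.card_congr e, Nat.card_sigma, Nat.cast_sum,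
    ← Finset.add_sum_erase _ _ (Finset.mem_univ (0 : F)),
    Finset.sum_congr rfl fun y hy => card_sq_eq_neg_sq h2 (Finset.ne_of_mem_erase hy),
    Finset.sum_const, Finset.card_erase_of_mem (Finset.mem_univ _), Finset.card_univ,
    nsmul_eq_mul, Nat.cast_sub Fintype.card_pos, ← Nat.card_eq_fintype_card, Nat.cast_one]
  congr 1
  have : Unique {x : F // x ^ 2 + 0 ^ 2 = 0} :=
    ⟨⟨⟨0, by simp⟩⟩, fun x => Subtype.ext (by have := x.2; simpa using this)⟩
  rw [Nat.card_unique, Nat.cast_one]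

/-- All nonzero d are represented equally often, so the common number follows from the total q² and
the number of zeros. -/
theorem card_sq_add_sq_eq (h2 : (2 : F) ≠ 0) {d : F} (hd : d ≠ 0) :
    (Nat.card {p : F × F // p.1 ^ 2 + p.2 ^ 2 = d} : ℚ) = Nat.card F - negOneSign F := by
  classical
  have := Fintype.ofFinite F
  have hrep : ∀ d : F, ∃ u v : F, u ^ 2 + v ^ 2 = d := fun d => by
    have hchar : ringChar F ≠ 2 := fun h => h2 (by
      have := ringChar.Nat.cast_ringChar (R := F)
      rw [h] at this
      exact_mod_cast this)
    obtain ⟨a, b, hab⟩ := FiniteField.exists_root_sum_quadratic (R := F) (f := X ^ 2)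
      (g := X ^ 2 - C d) (degree_X_pow 2) (degree_X_pow_sub_C (by decide) _)
      (FiniteField.odd_card_of_char_ne_two hchar)
    refine ⟨a, b, ?_⟩
    rw [← sub_eq_zero]
    simpa only [eval_C, eval_X, eval_pow, eval_sub, ← add_sub_assoc] using hab
  -- Once u² + v² = d, the identity (ux - vy)² + (vx + uy)² = (u² + v²)(x² + y²) carries solutions
  -- for 1 bijectively to solutions for d.
  have hone : ∀ d : F, d ≠ 0 → Nat.card {p : F × F // p.1 ^ 2 + p.2 ^ 2 = d} =
      Nat.card {p : F × F // p.1 ^ 2 + p.2 ^ 2 = 1} := fun d hd => by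
    obtain ⟨u, v, huv⟩ := hrep d
    refine Nat.card_congr ⟨fun p => ⟨((u * p.1.1 + v * p.1.2) / d, (u * p.1.2 - v * p.1.1) / d), ?_⟩,
      fun p => ⟨(u * p.1.1 - v * p.1.2, v * p.1.1 + u * p.1.2), ?_⟩, fun p => ?_, fun p => ?_⟩
    · have := p.2
      simp only
      field_simp
      linear_combination (u ^ 2 + v ^ 2) * this + d * huv
    · have := p.2
      simp only
      linear_combination (u ^ 2 + v ^ 2) * this + huv
    · refine Subtype.ext (Prod.ext ?_ ?_)
      · simp only
        field_simp
        linear_combination p.1.1 * huv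
      · simp only
        field_simp
        linear_combination p.1.2 * huv
    · refine Subtype.ext (Prod.ext ?_ ?_)
      · simp only
        field_simp
        linear_combination p.1.1 * huv
      · simp only
        field_simp
        linear_combination p.1.2 * huv
  have htot := Nat.card_congr (Equiv.sigmaFiberEquiv fun p : F × F => p.1 ^ 2 + p.2 ^ 2)
  rw [Nat.card_sigma, ← Finset.add_sum_erase _ _ (Finset.mem_univ (0 : F)),
    Finset.sum_congr rfl fun y hy => hone y (Finset.ne_of_mem_erase hy), Finset.sum_const,
    Finset.card_erase_of_mem (Finset.mem_univ _), Finset.card_univ, smul_eq_mul,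
    Nat.card_prod] at htot
  have htot' := congrArg (Nat.cast : ℕ → ℚ) htot
  push_cast at htot'
  rw [card_sq_add_sq_eq_zero h2, Nat.cast_sub Fintype.card_pos, ← Nat.card_eq_fintype_card] at htot'
  rw [hone d hd]
  have hq := one_lt_cast_card F
  refine mul_left_cancel₀ (sub_ne_zero.2 hq.ne') ?_
  push_cast at htot'
  linear_combination htot'

/-- Split off two variables. Every value of the remaining sum is completed in q - χ ways, and the
value zero in qχ further ways, where χ is the sign of -1. -/
theorem card_sum_sq_eq_zero_add_two (h2 : (2 : F) ≠ 0) (n : ℕ) :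
    (Nat.card {x : Fin (n + 2) → F // ∑ i, x i * x i = 0} : ℚ) =
      Nat.card {x : Fin n → F // ∑ i, x i * x i = 0} * (Nat.card F * negOneSign F) +
        (Nat.card F : ℚ) ^ n * (Nat.card F - negOneSign F) := by
  classical
  have := Fintype.ofFinite F
  let e : {x : Fin (n + 2) → F // ∑ i, x i * x i = 0} ≃
      Σ y : Fin n → F, {p : F × F // p.1 ^ 2 + p.2 ^ 2 = -∑ i, y i * y i} :=
    ⟨fun x => ⟨fun i => x.1 i.succ.succ, ⟨(x.1 0, x.1 1), by
        have := x.2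
        rw [Fin.sum_univ_succ, Fin.sum_univ_succ] at this
        simp only [Fin.succ_zero_eq_one] at this ⊢
        linear_combination this⟩⟩,
      fun z => ⟨Fin.cons z.2.1.1 (Fin.cons z.2.1.2 z.1), by
        have := z.2.2
        rw [Fin.sum_univ_succ, Fin.sum_univ_succ]
        simp only [Fin.cons_zero, Fin.cons_succ]
        linear_combination this⟩,
      fun x => Subtype.ext (by
        ext i
        refine Fin.cases ?_ (fun i => Fin.cases ?_ (fun i => ?_) i) i <;> rfl),
      fun z => rfl⟩
  have hval : ∀ y : Fin n → F,
      (Nat.card {p : F × F // p.1 ^ 2 + p.2 ^ 2 = -∑ i, y i * y i} : ℚ) =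
        (if ∑ i, y i * y i = 0 then (Nat.card F * negOneSign F) else 0) +
          (Nat.card F - negOneSign F) := fun y => by
    split_ifs with h
    · rw [h, neg_zero, card_sq_add_sq_eq_zero h2]
      ring
    · rw [card_sq_add_sq_eq h2 (neg_ne_zero.2 h), zero_add]
  rw [Nat.card_congr e, Nat.card_sigma, Nat.cast_sum, Finset.sum_congr rfl fun y _ => hval y,
    Finset.sum_add_distrib, ← Finset.sum_filter, Finset.sum_const, Finset.sum_const,
    nsmul_eq_mul, nsmul_eq_mul, ← Fintype.card_subtype, ← Nat.card_eq_fintype_card,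
    Finset.card_univ, ← Nat.card_eq_fintype_card (α := Fin n → F), Nat.card_fun]
  simp

/-- The number of zeros of `x₁² + ⋯ + xₙ²`, for `n` odd. -/
theorem card_sum_sq_eq_zero_odd (h2 : (2 : F) ≠ 0) (m : ℕ) :
    (Nat.card {x : Fin (2 * m + 1) → F // ∑ i, x i * x i = 0} : ℚ) =
      (Nat.card F : ℚ) ^ (2 * m) := by
  induction m with
  | zero =>
    have : Unique {x : Fin 1 → F // ∑ i, x i * x i = 0} :=
      ⟨⟨⟨0, by simp⟩⟩, fun x => Subtype.ext (by
        have := x.2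
        ext i
        rw [Fin.sum_univ_one, mul_self_eq_zero] at this
        obtain rfl : i = 0 := Subsingleton.elim i 0
        exact this)⟩
    rw [mul_zero, zero_add, Nat.card_unique, pow_zero, Nat.cast_one]
  | succ m ih =>
    rw [show 2 * (m + 1) + 1 = 2 * m + 1 + 2 by ring, card_sum_sq_eq_zero_add_two h2, ih]
    ring

/-- The number of zeros of `x₁² + ⋯ + xₙ²`, for `n` even. -/
theorem card_sum_sq_eq_zero_even (h2 : (2 : F) ≠ 0) (m : ℕ) :
    Nat.card F * (Nat.card {x : Fin (2 * m) → F // ∑ i, x i * x i = 0} : ℚ) =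
      (Nat.card F : ℚ) ^ (2 * m) + (Nat.card F - 1) * negOneSign F ^ m * (Nat.card F : ℚ) ^ m := by
  induction m with
  | zero =>
    have : Unique {x : Fin 0 → F // ∑ i, x i * x i = 0} :=
      ⟨⟨⟨0, by simp⟩⟩, fun x => Subtype.ext (Subsingleton.elim _ _)⟩
    have h1 : Nat.card {x : Fin 0 → F // ∑ i, x i * x i = 0} = 1 := Nat.card_unique
    rw [mul_zero, h1]
    simp
  | succ m ih =>
    rw [show 2 * (m + 1) = 2 * m + 2 by ring, card_sum_sq_eq_zero_add_two h2]
    linear_combination (Nat.card F * negOneSign F : ℚ) * ih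

theorem negOneSign_pow (F : Type*) [Field F] (m : ℕ) : negOneSign F ^ m = nuSign F (2 * m) := by
  classical
  rw [negOneSign, nuSign, Nat.mul_div_cancel_left _ two_pos]
  rcases Nat.even_or_odd m with hm | hm
  · rw [hm.neg_one_pow, if_pos IsSquare.one]
    split_ifs
    · exact one_pow m
    · exact hm.neg_one_pow
  · rw [hm.neg_one_pow]
    split_ifs
    · exact one_pow m
    · exact hm.neg_one_pow

end SumsOfSquares

/-! ### The number of self-orthogonal subspaces -/

section Isotropic

variable {F : Type*} [Field F] {n : ℕ}

/-- The dual code of `E` with respect to the standard inner product. -/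
def dualCode (E : Submodule F (Fin n → F)) : Submodule F (Fin n → F) where
  carrier := {x | ∀ y ∈ E, ∑ i, x i * y i = 0}
  add_mem' := by
    intro x x' hx hx' y hy
    simp only [Pi.add_apply, add_mul, Finset.sum_add_distrib]
    rw [hx y hy, hx' y hy, add_zero]
  zero_mem' := by
    intro y _
    simp
  smul_mem' := by
    intro a x hx y hy
    simp only [Pi.smul_apply, smul_eq_mul, mul_assoc, ← Finset.mul_sum]
    rw [hx y hy, mul_zero]

theorem mem_dualCode {E : Submodule F (Fin n → F)} {x : Fin n → F} :
    x ∈ dualCode E ↔ ∀ y ∈ E, ∑ i, x i * y i = 0 := Iff.rfl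

theorem leDual_iff {E E' : Submodule F (Fin n → F)} : LeDual E E' ↔ E ≤ dualCode E' := Iff.rfl

/-- Pairing with E maps the whole space onto the dual of E, since every functional on E extends to
the whole space and is given there by a vector; the kernel is the dual code. -/
theorem finrank_dualCode (E : Submodule F (Fin n → F)) :
    Module.finrank F (dualCode E) + Module.finrank F E = n := by
  let φ : (Fin n → F) →ₗ[F] Module.Dual F E :=
    LinearMap.mk₂ F (fun x (y : E) => ∑ i, x i * y.1 i)
      (fun x x' y => by simp only [Pi.add_apply, add_mul, Finset.sum_add_distrib])
      (fun a x y => by simp only [Pi.smul_apply, smul_eq_mul, mul_assoc, ← Finset.mul_sum])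
      (fun x y y' => by
        simp only [Submodule.coe_add, Pi.add_apply, mul_add, Finset.sum_add_distrib])
      (fun a x y => by
        simp only [Submodule.coe_smul, Pi.smul_apply, smul_eq_mul, Finset.mul_sum]
        exact Finset.sum_congr rfl fun i _ => by ring)
  have hker : LinearMap.ker φ = dualCode E := by
    ext x
    rw [LinearMap.mem_ker, mem_dualCode]
    exact ⟨fun h y hy => LinearMap.congr_fun h ⟨y, hy⟩, fun h => LinearMap.ext fun y => h y.1 y.2⟩
  have hsurj : LinearMap.range φ = ⊤ := by
    rw [LinearMap.range_eq_top]
    intro f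
    obtain ⟨g, hg⟩ := LinearMap.exists_extend f
    refine ⟨fun i => g (Pi.single i 1), LinearMap.ext fun y => ?_⟩
    have h1 : f y = g y.1 := by rw [← hg]; rfl
    rw [h1, LinearMap.pi_apply_eq_sum_univ g y.1]
    change ∑ i, g (Pi.single i 1) * y.1 i = _
    refine Finset.sum_congr rfl fun i _ => ?_
    rw [smul_eq_mul, mul_comm]
    congr 2
    ext j
    rw [Pi.single_apply]
    exact if_congr eq_comm rfl rfl
  have h := φ.finrank_range_add_finrank_ker
  rw [hker, hsurj, finrank_top, Subspace.dual_finrank_eq, Module.finrank_fin_fun] at h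
  omega

theorem LeDual.mono {E₁ E₂ E₁' E₂' : Submodule F (Fin n → F)} (h : LeDual E₁ E₂) (h₁ : E₁' ≤ E₁)
    (h₂ : E₂' ≤ E₂) : LeDual E₁' E₂' := fun x hx y hy => h x (h₁ hx) y (h₂ hy)

theorem leDual_sup_span {E : Submodule F (Fin n → F)} (hE : LeDual E E) {x : Fin n → F} :
    LeDual (E ⊔ Submodule.span F {x}) (E ⊔ Submodule.span F {x}) ↔
      x ∈ dualCode E ∧ ∑ i, x i * x i = 0 := by
  constructor
  · intro h
    have hx : x ∈ E ⊔ Submodule.span F {x} :=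
      Submodule.mem_sup_right (Submodule.mem_span_singleton_self x)
    exact ⟨fun y hy => h x hx y (Submodule.mem_sup_left hy), h x hx x hx⟩
  · rintro ⟨h1, h2⟩ u hu v hv
    obtain ⟨y, hy, _, hz, rfl⟩ := Submodule.mem_sup.1 hu
    obtain ⟨a, rfl⟩ := Submodule.mem_span_singleton.1 hz
    obtain ⟨y', hy', _, hz', rfl⟩ := Submodule.mem_sup.1 hv
    obtain ⟨b, rfl⟩ := Submodule.mem_span_singleton.1 hz'
    have e1 := hE y hy y' hy'
    have e2 := h1 y hy
    have e3 := h1 y' hy'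
    have : ∑ i, (y + a • x) i * (y' + b • x) i = ∑ i, y i * y' i + b * ∑ i, x i * y i +
        a * ∑ i, x i * y' i + a * b * ∑ i, x i * x i := by
      simp only [Finset.mul_sum, ← Finset.sum_add_distrib]
      refine Finset.sum_congr rfl fun i _ => ?_
      simp only [Pi.add_apply, Pi.smul_apply, smul_eq_mul]
      ring
    rw [this, e1, e2, e3, h2]
    ring

variable [Finite F]

/-- Outside the dual code exactly one vector in q is isotropic. Count the pairs (x, e) with e in E
and x + e isotropic in two ways. For fixed x the quadratic form at x + e is affine in e, because E
is self-orthogonal, and it is not constant, because x is not orthogonal to E and 2 ≠ 0; so it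
vanishes for |E|/q elements e. -/
theorem card_isotropic_notMem_dualCode (h2 : (2 : F) ≠ 0) {E : Submodule F (Fin n → F)}
    (hE : LeDual E E) :
    (Nat.card {x : Fin n → F // x ∉ dualCode E ∧ ∑ i, x i * x i = 0} : ℚ) * Nat.card F =
      Nat.card {x : Fin n → F // x ∉ dualCode E} := by
  have hE0 : (Nat.card E : ℚ) ≠ 0 := Nat.cast_ne_zero.2 Nat.card_pos.ne'
  have hq : (Nat.card F : ℚ) ≠ 0 := Nat.cast_ne_zero.2 Nat.card_pos.ne'
  have hquad : ∀ x : Fin n → F, ∀ e ∈ E, ∑ i, (x + e) i * (x + e) i =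
      ∑ i, x i * x i + 2 * ∑ i, x i * e i := fun x e he => by
    have : ∑ i, (x + e) i * (x + e) i =
        ∑ i, x i * x i + 2 * ∑ i, x i * e i + ∑ i, e i * e i := by
      simp only [Finset.mul_sum, ← Finset.sum_add_distrib]
      refine Finset.sum_congr rfl fun i _ => ?_
      simp only [Pi.add_apply]
      ring
    rw [this, hE e he e he, add_zero]
  have c1 := Nat.cast_card_eq_mul_of_fiber
    (α := {p : (Fin n → F) × E // p.1 ∉ dualCode E ∧ ∑ i, (p.1 + p.2) i * (p.1 + p.2) i = 0})
    (β := {x : Fin n → F // x ∉ dualCode E ∧ ∑ i, x i * x i = 0})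
    (fun p => ⟨p.1.1 + p.1.2, fun h => p.2.1 (((dualCode E).add_mem_iff_left
      (hE p.1.2.1 p.1.2.2)).1 h), p.2.2⟩) (Nat.card E) fun x => by
        congr 1
        refine Nat.card_congr ⟨fun p => p.1.1.2, fun e => ⟨⟨(x.1 - e.1, e), fun h => x.2.1
          (by simpa using (dualCode E).add_mem h (hE e.1 e.2)), by
            simpa using x.2.2⟩, Subtype.ext (sub_add_cancel _ _)⟩, fun p => ?_, fun e => rfl⟩
        refine Subtype.ext (Subtype.ext (Prod.ext ?_ rfl))
        simp only
        rw [← congrArg Subtype.val p.2, add_sub_cancel_right]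
  have c2 := Nat.cast_card_eq_mul_of_fiber
    (α := {p : (Fin n → F) × E // p.1 ∉ dualCode E ∧ ∑ i, (p.1 + p.2) i * (p.1 + p.2) i = 0})
    (β := {x : Fin n → F // x ∉ dualCode E})
    (fun p => ⟨p.1.1, p.2.1⟩) (Nat.card E / Nat.card F) fun x => by
      let f : E →ₗ[F] F :=
        { toFun := fun e => 2 * ∑ i, x.1 i * e.1 i
          map_add' := fun e e' => by
            simp only [Submodule.coe_add, Pi.add_apply, mul_add, Finset.sum_add_distrib]
          map_smul' := fun a e => by
            simp only [Submodule.coe_smul, Pi.smul_apply, smul_eq_mul, Finset.mul_sum,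
              RingHom.id_apply]
            exact Finset.sum_congr rfl fun i _ => by ring }
      have hf : Function.Surjective f := by
        refine LinearMap.surjective fun h0 => x.2 fun y hy => ?_
        exact (mul_eq_zero.1 (LinearMap.congr_fun h0 ⟨y, hy⟩)).resolve_left h2
      obtain ⟨e₀, he₀⟩ := hf (-∑ i, x.1 i * x.1 i)
      have h3 := f.toAddMonoidHom.card_eq_of_surjective hf
      rw [← f.toAddMonoidHom.card_fiber e₀] at h3
      rw [h3, Nat.cast_mul, mul_div_cancel_left₀ _ hq]
      congr 1
      refine Nat.card_congr ⟨fun p => ⟨p.1.1.2, ?_⟩, fun e => ⟨⟨(x.1, e.1), x.2, ?_⟩, rfl⟩,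
        fun p => ?_, fun e => rfl⟩
      · have h4 := p.1.2.2
        have h5 : p.1.1.1 = x.1 := congrArg Subtype.val p.2
        rw [hquad _ _ p.1.1.2.2, h5] at h4
        change 2 * ∑ i, x.1 i * p.1.1.2.1 i = f e₀
        rw [he₀]
        linear_combination h4
      · have h4 : 2 * ∑ i, x.1 i * e.1.1 i = f e₀ := e.2
        rw [hquad _ _ e.1.2, h4, he₀, add_neg_cancel]
      · refine Subtype.ext (Subtype.ext (Prod.ext ?_ rfl))
        exact (congrArg Subtype.val p.2).symm
  rw [c1, ← mul_div_assoc, eq_div_iff hq] at c2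
  refine mul_right_cancel₀ hE0 ?_
  linear_combination c2

/-- The number of one-dimensional extensions of a self-orthogonal subspace. -/
theorem card_isotropic_extensions (h2 : (2 : F) ≠ 0) {E : Submodule F (Fin n → F)}
    (hE : LeDual E E) {s : ℕ} (hs : Module.finrank F E = s) :
    (Nat.card {x // x ∉ E ∧ LeDual (E ⊔ Submodule.span F {x}) (E ⊔ Submodule.span F {x})} : ℚ) *
        Nat.card F =
      Nat.card F * Nat.card {x : Fin n → F // ∑ i, x i * x i = 0} - (Nat.card F : ℚ) ^ n +
        (Nat.card F : ℚ) ^ (n - s) - (Nat.card F : ℚ) ^ (s + 1) := by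
  have hq : (Nat.card F : ℚ) ≠ 0 := Nat.cast_ne_zero.2 Nat.card_pos.ne'
  have hd := finrank_dualCode E
  have cE : (Nat.card E : ℚ) = (Nat.card F : ℚ) ^ s := by
    rw [Module.natCard_eq_pow_finrank (K := F) (V := E), hs, Nat.cast_pow]
  have cD : (Nat.card (dualCode E) : ℚ) = (Nat.card F : ℚ) ^ (n - s) := by
    rw [Module.natCard_eq_pow_finrank (K := F) (V := dualCode E),
      show Module.finrank F (dualCode E) = n - s by omega, Nat.cast_pow]
  have h1 := card_isotropic_notMem_dualCode h2 hE
  rw [card_notMem, cD, Nat.card_fun, Nat.card_eq_fintype_card (α := Fin n), Fintype.card_fin,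
    Nat.cast_pow] at h1
  classical
  -- The isotropic vectors are split into those outside the dual code, those in E, and those in the
  -- dual code but not in E; the last are the vectors that extend E.
  have h3 := Nat.card_congr (Equiv.sumCompl
    fun x : {x : Fin n → F // ∑ i, x i * x i = 0} => x.1 ∈ dualCode E)
  rw [Nat.card_sum, Nat.card_congr (Equiv.subtypeSubtypeEquivSubtypeInter
    (fun x : Fin n → F => ∑ i, x i * x i = 0) fun x => x ∈ dualCode E),
    Nat.card_congr (Equiv.subtypeSubtypeEquivSubtypeInter
    (fun x : Fin n → F => ∑ i, x i * x i = 0) fun x => x ∉ dualCode E)] at h3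
  have h4 := Nat.card_congr (Equiv.sumCompl
    fun x : {x : Fin n → F // ∑ i, x i * x i = 0 ∧ x ∈ dualCode E} => x.1 ∈ E)
  rw [Nat.card_sum, Nat.card_congr (Equiv.subtypeSubtypeEquivSubtypeInter
    (fun x : Fin n → F => ∑ i, x i * x i = 0 ∧ x ∈ dualCode E) fun x => x ∈ E),
    Nat.card_congr (Equiv.subtypeSubtypeEquivSubtypeInter
    (fun x : Fin n → F => ∑ i, x i * x i = 0 ∧ x ∈ dualCode E) fun x => x ∉ E)] at h4
  have e1 : Nat.card {x : Fin n → F // (∑ i, x i * x i = 0 ∧ x ∈ dualCode E) ∧ x ∈ E} =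
      Nat.card E := Nat.card_congr (Equiv.subtypeEquivRight fun x =>
        ⟨fun h => h.2, fun h => ⟨⟨hE x h x h, hE x h⟩, h⟩⟩)
  have e2 : Nat.card {x : Fin n → F // (∑ i, x i * x i = 0 ∧ x ∈ dualCode E) ∧ x ∉ E} =
      Nat.card {x // x ∉ E ∧ LeDual (E ⊔ Submodule.span F {x}) (E ⊔ Submodule.span F {x})} :=
    Nat.card_congr (Equiv.subtypeEquivRight fun x => by
      rw [leDual_sup_span hE]
      tauto)
  have e3 : Nat.card {x : Fin n → F // ∑ i, x i * x i = 0 ∧ x ∉ dualCode E} =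
      Nat.card {x : Fin n → F // x ∉ dualCode E ∧ ∑ i, x i * x i = 0} :=
    Nat.card_congr (Equiv.subtypeEquivRight fun x => and_comm)
  rw [e1, e2] at h4
  rw [e3, ← h4] at h3
  have h5 := congrArg (Nat.cast : ℕ → ℚ) h3
  push_cast at h5
  rw [cE] at h5
  linear_combination (Nat.card F : ℚ) * h5 - h1

theorem prod_Icc_eq_prod_range (q : ℚ) (s : ℕ) :
    ∏ j ∈ Finset.Icc 1 s, (q ^ j - 1) = ∏ i ∈ Finset.range s, (q ^ (s - i) - 1) := by
  rw [← Finset.prod_range_reflect, ← Finset.Ico_succ_right_eq_Icc, Finset.prod_Ico_eq_prod_range]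
  refine Finset.prod_congr (by simp) fun i hi => ?_
  have := Finset.mem_range.1 hi
  congr 2
  omega

/-- The telescoping product in the even case. -/
theorem prod_mul_prod_telescope (q ν : ℚ) (hν : ν ^ 2 = 1) (m s : ℕ) (hs : s + 1 ≤ m) :
    ∏ i ∈ Finset.range (s + 1), (q ^ (m - i) - ν) * (q ^ (m - 1 - i) + ν) =
      (q ^ (2 * m - (s + 1)) - ν * q ^ (m - (s + 1)) + ν * q ^ m - 1) *
        ∏ i ∈ Finset.Icc 1 s, (q ^ (2 * m - 2 * i) - 1) := by
  induction s with
  | zero =>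
    have h : q ^ (2 * m - (0 + 1)) = q ^ m * q ^ (m - 1) := by
      rw [← pow_add]; congr 1; omega
    simp only [zero_add, Finset.prod_range_one, Nat.sub_zero, Finset.Icc_eq_empty_of_lt one_pos,
      Finset.prod_empty] at h ⊢
    rw [h]
    linear_combination -hν
  | succ s ih =>
    rw [Finset.prod_range_succ, ih (by omega), Finset.prod_Icc_succ_top (by omega)]
    obtain ⟨d, rfl⟩ : ∃ d, m = d + s + 1 + 1 := ⟨m - s - 2, by omega⟩
    have a1 : d + s + 1 + 1 - (s + 1) = d + 1 := by omega
    have a2 : d + s + 1 + 1 - 1 - (s + 1) = d := by omega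
    have a3 : d + s + 1 + 1 - (s + 1 + 1) = d := by omega
    have a4 : 2 * (d + s + 1 + 1) - (s + 1) = 2 * d + s + 1 + 2 := by omega
    have a5 : 2 * (d + s + 1 + 1) - (s + 1 + 1) = 2 * d + s + 2 := by omega
    have a6 : 2 * (d + s + 1 + 1) - 2 * (s + 1) = 2 * (d + 1) := by omega
    rw [a1, a2, a3, a4, a5, a6]
    generalize ∏ i ∈ Finset.Icc 1 s, (q ^ (2 * (d + s + 1 + 1) - 2 * i) - 1) = c
    -- The first factor of the closed form splits because ν² = 1; the old and new factors share q^m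
    -- - ν, and the quotient of the rest telescopes.
    have e1 : q ^ (2 * d + s + 1 + 2) - ν * q ^ (d + 1) + ν * q ^ (d + s + 1 + 1) - 1 =
        (q ^ (d + s + 1 + 1) - ν) * (q ^ (d + 1) + ν) := by
      ring_nf
      linear_combination hν
    have e2 : q ^ (2 * d + s + 2) - ν * q ^ d + ν * q ^ (d + s + 1 + 1) - 1 =
        (q ^ (d + s + 1 + 1) - ν) * (q ^ d + ν) := by
      ring_nf
      linear_combination hν
    have e3 : q ^ (2 * (d + 1)) - 1 = (q ^ (d + 1) - ν) * (q ^ (d + 1) + ν) := by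
      ring_nf
      linear_combination hν
    rw [e1, e2, e3]
    ring

theorem nuSign_sq (F : Type*) [Field F] (n : ℕ) : nuSign F n ^ 2 = 1 := by
  rw [nuSign]
  split_ifs <;> norm_num

/-- The number of self-orthogonal subspaces of dimension `s`. -/
theorem card_isotropic_subspaces (h2 : (2 : F) ≠ 0) (n s : ℕ) :
    (Nat.card {E : Submodule F (Fin n → F) // Module.finrank F E = s ∧ LeDual E E} : ℚ) =
      sigmaNum F n s := by
  have hq1 := one_lt_cast_card F
  have hq : (Nat.card F : ℚ) ≠ 0 := by positivity
  have main := card_subspaces_of_extensions (F := F) (V := Fin n → F) (P := fun E => LeDual E E)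
    (fun x hx y _ => by rw [(Submodule.mem_bot F).1 hx]; simp) (fun E E' h h' => h'.mono h h)
    (fun i => (Nat.card F * Nat.card {x : Fin n → F // ∑ i, x i * x i = 0} - (Nat.card F : ℚ) ^ n +
        (Nat.card F : ℚ) ^ (n - i) - (Nat.card F : ℚ) ^ (i + 1)) / Nat.card F) s
    (fun i _ E hE hP => by rw [eq_div_iff hq, card_isotropic_extensions h2 hP hE])
  rw [main]
  clear main
  simp only [sigmaNum]
  rcases Nat.eq_zero_or_pos s with rfl | hs
  · simp
  rw [if_neg hs.ne']
  obtain ⟨m, rfl | rfl⟩ := Nat.even_or_odd' n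
  · have hZ := card_sum_sq_eq_zero_even h2 m
    rw [negOneSign_pow] at hZ
    have hν := nuSign_sq F (2 * m)
    -- For n = 0 the sign is 1. This rules out m = 0 below, where the factor with index m - 1 is
    -- needed.
    have hν0 : m = 0 → nuSign F (2 * m) = 1 := fun h => by rw [← negOneSign_pow, h, pow_zero]
    generalize nuSign F (2 * m) = ν at hZ hν hν0
    rw [hZ, Nat.mul_div_cancel_left _ two_pos, if_neg (Nat.not_odd_iff_even.2 (even_two_mul m))]
    generalize (Nat.card F : ℚ) = q at hq hq1
    split_ifs with hms
    -- For s > m the product contains a zero factor: the one with i = m if ν = 1, and the one with i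
    -- = m - 1 if ν = -1.
    · have hν' : ν = 1 ∨ ν = -1 := sq_eq_one_iff.1 hν
      rcases hν' with rfl | rfl
      · refine Finset.prod_eq_zero (Finset.mem_range.2 hms) ?_
        rw [show 2 * m - m = m by omega]
        ring
      · obtain ⟨d, rfl⟩ : ∃ d, m = d + 1 := ⟨m - 1, by
          have : m ≠ 0 := fun h => by
            have := hν0 h
            norm_num at this
          omega⟩
        refine Finset.prod_eq_zero (Finset.mem_range.2 (show d < s by omega)) ?_
        rw [show 2 * (d + 1) - d = d + 2 by omega]
        ring
    · have hterm : ∀ i ∈ Finset.range s, (q ^ (2 * m) + (q - 1) * ν * q ^ m - q ^ (2 * m) +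
          q ^ (2 * m - i) - q ^ (i + 1)) / q / (q ^ s - q ^ i) =
          (q ^ (m - i) - ν) * (q ^ (m - 1 - i) + ν) / (q ^ (s - i) - 1) := fun i hi => by
        have hi := Finset.mem_range.1 hi
        obtain ⟨a, rfl⟩ : ∃ a, m = a + 1 + i := ⟨m - 1 - i, by omega⟩
        obtain ⟨b, rfl⟩ : ∃ b, s = b + i := ⟨s - i, by omega⟩
        have hb : q ^ b - 1 ≠ 0 := by
          have := pow_sub_pow_ne_zero hq1 (show 0 < b by omega)
          rwa [pow_zero] at this
        have hqi : q ^ i ≠ 0 := pow_ne_zero _ hq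
        have a1 : 2 * (a + 1 + i) - i = 2 * a + 2 + i := by omega
        have a2 : a + 1 + i - i = a + 1 := by omega
        have a3 : a + 1 + i - 1 - i = a := by omega
        have a4 : b + i - i = b := by omega
        rw [a1, a2, a3, a4, show q ^ (b + i) - q ^ i = q ^ i * (q ^ b - 1) by ring, div_div,
          div_eq_div_iff (mul_ne_zero hq (mul_ne_zero hqi hb)) hb]
        -- The number of extensions factors into two terms, again by ν² = 1.
        have key : q ^ (2 * (a + 1 + i)) + (q - 1) * ν * q ^ (a + 1 + i) - q ^ (2 * (a + 1 + i)) +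
            q ^ (2 * a + 2 + i) - q ^ (i + 1) =
            q * q ^ i * ((q ^ (a + 1) - ν) * (q ^ a + ν)) := by
          ring_nf
          linear_combination q * q ^ i * hν
        rw [key]
        ring
      rw [Finset.prod_congr rfl hterm, Finset.prod_div_distrib, prod_Icc_eq_prod_range]
      obtain ⟨s, rfl⟩ : ∃ t, s = t + 1 := ⟨s - 1, by omega⟩
      rw [prod_mul_prod_telescope q ν hν m s (by omega), Nat.add_sub_cancel]
  · have hZ := card_sum_sq_eq_zero_odd h2 m
    rw [hZ, show (2 * m + 1) / 2 = m by omega, if_pos (odd_two_mul_add_one m)]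
    generalize (Nat.card F : ℚ) = q at hq hq1
    split_ifs with hms
    -- In odd length the factor with i = m is zero.
    · refine Finset.prod_eq_zero (Finset.mem_range.2 hms) ?_
      rw [show 2 * m + 1 - m = m + 1 by omega]
      ring
    · have hterm : ∀ i ∈ Finset.range s, (q * q ^ (2 * m) - q ^ (2 * m + 1) +
          q ^ (2 * m + 1 - i) - q ^ (i + 1)) / q / (q ^ s - q ^ i) =
          (q ^ (2 * m + 1 - 1 - 2 * i) - 1) / (q ^ (s - i) - 1) := fun i hi => by
        have hi := Finset.mem_range.1 hi
        obtain ⟨a, rfl⟩ : ∃ a, m = a + i := ⟨m - i, by omega⟩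
        obtain ⟨b, rfl⟩ : ∃ b, s = b + i := ⟨s - i, by omega⟩
        have hb : q ^ b - 1 ≠ 0 := by
          have := pow_sub_pow_ne_zero hq1 (show 0 < b by omega)
          rwa [pow_zero] at this
        have hqi : q ^ i ≠ 0 := pow_ne_zero _ hq
        have a1 : 2 * (a + i) + 1 - i = 2 * a + 1 + i := by omega
        have a2 : 2 * (a + i) + 1 - 1 - 2 * i = 2 * a := by omega
        have a4 : b + i - i = b := by omega
        rw [a1, a2, a4, show q ^ (b + i) - q ^ i = q ^ i * (q ^ b - 1) by ring, div_div,
          div_eq_div_iff (mul_ne_zero hq (mul_ne_zero hqi hb)) hb]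
        ring
      rw [Finset.prod_congr rfl hterm, Finset.prod_div_distrib, prod_Icc_eq_prod_range]

end Isotropic

/-! ### The enumeration of self-orthogonal codes over the mixed alphabet -/

section Flags

variable {F : Type*} [Field F] [Finite F]

/-- The number of flags `E₁ ≤ E₂ ≤ E₃` with `E₃ ≤ E₁^⊥` and `E₂ ≤ E₂^⊥`. -/
theorem card_flags_X (h2 : (2 : F) ≠ 0) (n k₀ k₁ k₂ : ℕ) :
    (Nat.card {p : Submodule F (Fin n → F) × Submodule F (Fin n → F) × Submodule F (Fin n → F) //
      Module.finrank F p.1 = k₀ ∧ Module.finrank F p.2.1 = k₀ + k₁ ∧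
      Module.finrank F p.2.2 = k₀ + k₁ + k₂ ∧ p.1 ≤ p.2.1 ∧ p.2.1 ≤ p.2.2 ∧
      LeDual p.2.2 p.1 ∧ LeDual p.2.1 p.2.1} : ℚ) =
    sigmaNum F n (k₀ + k₁) * gaussBinom (Nat.card F) (k₀ + k₁) k₀ *
      gaussBinom (Nat.card F) (n - 2 * k₀ - k₁) k₂ := by
  rw [← card_isotropic_subspaces h2]
  -- Choose E₂ among the self-orthogonal subspaces, then E₁ inside it, and finally E₃ between E₂ and
  -- the dual of E₁.
  have c1 := Nat.cast_card_eq_mul_of_fiber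
    (α := {p : Submodule F (Fin n → F) × Submodule F (Fin n → F) //
      Module.finrank F p.1 = k₀ ∧ (Module.finrank F p.2 = k₀ + k₁ ∧ LeDual p.2 p.2) ∧ p.1 ≤ p.2})
    (β := {E : Submodule F (Fin n → F) // Module.finrank F E = k₀ + k₁ ∧ LeDual E E})
    (fun p => ⟨p.1.2, p.2.2.1⟩) (gaussBinom (Nat.card F) (k₀ + k₁) k₀) fun E => by
      have h := card_subspaces_between (P := ⊥) (Q := E.1) (s := k₀) bot_le (finrank_bot F _)
      rw [E.2.1, Nat.sub_zero, zero_add] at h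
      rw [← h]
      congr 1
      exact Nat.card_congr ⟨fun p => ⟨p.1.1.1, p.1.2.1, bot_le,
        p.1.2.2.2.trans (congrArg Subtype.val p.2).le⟩,
        fun K => ⟨⟨(K.1, E.1), K.2.1, E.2, K.2.2.2⟩, rfl⟩, fun p => Subtype.ext (Subtype.ext
          (Prod.ext rfl (congrArg Subtype.val p.2).symm)), fun K => rfl⟩
  rw [← c1]
  refine Nat.cast_card_eq_mul_of_fiber (fun p => ⟨(p.1.1, p.1.2.1), p.2.1, ⟨p.2.2.1,
    p.2.2.2.2.2.2.2⟩, p.2.2.2.2.1⟩) _ fun E => ?_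
  have h := card_subspaces_between (P := E.1.2) (Q := dualCode E.1.1) (s := k₂)
    (E.2.2.1.2.mono le_rfl E.2.2.2) E.2.2.1.1
  have hd := finrank_dualCode E.1.1
  rw [E.2.1] at hd
  rw [show Module.finrank F (dualCode E.1.1) - (k₀ + k₁) = n - 2 * k₀ - k₁ by omega] at h
  rw [← h]
  congr 1
  exact Nat.card_congr ⟨fun p => ⟨p.1.1.2.2, p.1.2.2.2.1,
    (congrArg (fun x => x.1.2) p.2).ge.trans p.1.2.2.2.2.2.1,
    p.1.2.2.2.2.2.2.1.mono le_rfl (congrArg (fun x => x.1.1) p.2).ge⟩,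
    fun K => ⟨⟨(E.1.1, E.1.2, K.1), E.2.1, E.2.2.1.1, K.2.1, E.2.2.2, K.2.2.1, K.2.2.2,
      E.2.2.1.2⟩, rfl⟩, fun p => Subtype.ext (Subtype.ext
        (Prod.ext (congrArg (fun x => x.1.1) p.2).symm
          (Prod.ext (congrArg (fun x => x.1.2) p.2).symm rfl))), fun K => rfl⟩

/-- The number of flags `E₄ ≤ E₅` with `E₅ ≤ E₄^⊥`. -/
theorem card_flags_Y (h2 : (2 : F) ≠ 0) (n l₀ l₁ : ℕ) :
    (Nat.card {p : Submodule F (Fin n → F) × Submodule F (Fin n → F) //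
      Module.finrank F p.1 = l₀ ∧ Module.finrank F p.2 = l₀ + l₁ ∧ p.1 ≤ p.2 ∧
      LeDual p.2 p.1} : ℚ) =
    sigmaNum F n l₀ * gaussBinom (Nat.card F) (n - 2 * l₀) l₁ := by
  rw [← card_isotropic_subspaces h2]
  refine Nat.cast_card_eq_mul_of_fiber (fun p => ⟨p.1.1, p.2.1, p.2.2.2.2.mono p.2.2.2.1 le_rfl⟩)
    _ fun E => ?_
  have h := card_subspaces_between (P := E.1) (Q := dualCode E.1) (s := l₁) E.2.2 E.2.1
  have hd := finrank_dualCode E.1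
  rw [E.2.1] at hd
  rw [show Module.finrank F (dualCode E.1) - l₀ = n - 2 * l₀ by omega] at h
  rw [← h]
  congr 1
  exact Nat.card_congr ⟨fun p => ⟨p.1.1.2, p.1.2.2.1,
    (congrArg Subtype.val p.2).ge.trans p.1.2.2.2.1,
    p.1.2.2.2.2.mono le_rfl (congrArg Subtype.val p.2).ge⟩,
    fun K => ⟨⟨(E.1, K.1), E.2.1, K.2.1, K.2.2.1, K.2.2.2⟩, rfl⟩,
    fun p => Subtype.ext (Subtype.ext (Prod.ext (congrArg Subtype.val p.2).symm rfl)),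
    fun K => rfl⟩

end Flags

/-! ### Summation over flags and types -/

section Enumeration

open IsLocalRing

variable {R : Type*} [CommRing R] [IsLocalRing R] {γ : R} {N₁ N₂ : ℕ}
  {E₁ E₂ E₃ : Submodule (ResidueField R) (Fin N₁ → ResidueField R)}
  {E₄ E₅ : Submodule (ResidueField R) (Fin N₂ → ResidueField R)}
  {C : Submodule R (Ambient γ N₁ N₂)}

theorem HasPieces.bounds (hγ : IsChainRing3 R γ) (h : HasPieces E₁ E₂ E₃ E₄ E₅ 5 C)
    (hC : IsSelfOrthogonal hγ.pow_three C) {k₀ k₁ k₂ l₀ l₁ : ℕ}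
    (hE₁ : Module.finrank (ResidueField R) E₁ = k₀)
    (hE₂ : Module.finrank (ResidueField R) E₂ = k₀ + k₁)
    (hE₃ : Module.finrank (ResidueField R) E₃ = k₀ + k₁ + k₂)
    (hE₄ : Module.finrank (ResidueField R) E₄ = l₀)
    (hE₅ : Module.finrank (ResidueField R) E₅ = l₀ + l₁) :
    2 * k₀ + 2 * k₁ ≤ N₁ ∧ 2 * k₀ + k₁ + k₂ ≤ N₁ ∧ 2 * l₀ + l₁ ≤ N₂ := by
  obtain ⟨h31, h22, h54⟩ := h.leDual hγ hC
  have d1 := finrank_dualCode E₁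
  have d2 := finrank_dualCode E₂
  have d4 := finrank_dualCode E₄
  have e1 := Submodule.finrank_mono (leDual_iff.1 h31)
  have e2 := Submodule.finrank_mono (leDual_iff.1 h22)
  have e4 := Submodule.finrank_mono (leDual_iff.1 h54)
  omega

/-- The number of self-orthogonal codes of a given type. -/
theorem card_selfOrthogonal_hasType [Finite R] (hγ : IsChainRing3 R γ)
    (h2 : (2 : ResidueField R) ≠ 0) (k₀ k₁ k₂ l₀ l₁ : ℕ) :
    (Nat.card {C : Submodule R (Ambient γ N₁ N₂) // IsSelfOrthogonal hγ.pow_three C ∧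
        HasType C k₀ k₁ k₂ l₀ l₁} : ℚ) = typeTerm (ResidueField R) N₁ N₂ k₀ k₁ k₂ l₀ l₁ := by
  have := finite_chainQuot (γ := γ)
  have hF : Finite (ResidueField R) := Finite.of_surjective _ (residue_surjective (R := R))
  have hX := card_flags_X h2 N₁ k₀ k₁ k₂
  have hY := card_flags_Y h2 N₂ l₀ l₁
  have hE : ∀ C : {C : Submodule R (Ambient γ N₁ N₂) // IsSelfOrthogonal hγ.pow_three C ∧
        HasType C k₀ k₁ k₂ l₀ l₁}, ∃ E₁ E₂ E₃ E₄ E₅, HasPieces E₁ E₂ E₃ E₄ E₅ 5 C.1 ∧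
      Module.finrank (ResidueField R) E₁ = k₀ ∧ Module.finrank (ResidueField R) E₂ = k₀ + k₁ ∧
      Module.finrank (ResidueField R) E₃ = k₀ + k₁ + k₂ ∧
      Module.finrank (ResidueField R) E₄ = l₀ ∧ Module.finrank (ResidueField R) E₅ = l₀ + l₁ :=
    fun C => (hasType_iff hγ).1 C.2.2
  choose E₁ E₂ E₃ E₄ E₅ hp d1 d2 d3 d4 d5 using hE
  -- A code is sent to its pair of flags of pieces. Every admissible pair has q^Θ₃ self-orthogonal
  -- codes above it, and the two flags are chosen independently.
  rw [Nat.cast_card_eq_mul_of_fiber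
    (fun C => ((⟨(E₁ C, E₂ C, E₃ C), d1 C, d2 C, d3 C, ((hp C).monotone hγ).1,
        ((hp C).monotone hγ).2.1, ((hp C).leDual hγ C.2.1).1, ((hp C).leDual hγ C.2.1).2.1⟩,
      ⟨(E₄ C, E₅ C), d4 C, d5 C, ((hp C).monotone hγ).2.2, ((hp C).leDual hγ C.2.1).2.2⟩) :
      {p : Submodule (ResidueField R) (Fin N₁ → ResidueField R) ×
          Submodule (ResidueField R) (Fin N₁ → ResidueField R) ×
          Submodule (ResidueField R) (Fin N₁ → ResidueField R) //
        Module.finrank (ResidueField R) p.1 = k₀ ∧ Module.finrank (ResidueField R) p.2.1 = k₀ + k₁ ∧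
        Module.finrank (ResidueField R) p.2.2 = k₀ + k₁ + k₂ ∧ p.1 ≤ p.2.1 ∧ p.2.1 ≤ p.2.2 ∧
        LeDual p.2.2 p.1 ∧ LeDual p.2.1 p.2.1} ×
      {p : Submodule (ResidueField R) (Fin N₂ → ResidueField R) ×
          Submodule (ResidueField R) (Fin N₂ → ResidueField R) //
        Module.finrank (ResidueField R) p.1 = l₀ ∧ Module.finrank (ResidueField R) p.2 = l₀ + l₁ ∧
        p.1 ≤ p.2 ∧ LeDual p.2 p.1}))
    ((Nat.card (ResidueField R) : ℚ) ^ theta3 N₁ N₂ k₀ k₁ k₂ l₀ l₁) fun E => ?_, Nat.card_prod,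
    Nat.cast_mul, hX, hY, typeTerm]
  · ring
  · obtain ⟨⟨⟨F₁, F₂, F₃⟩, f1, f2, f3, f12, f23, f31, f22⟩, ⟨⟨F₄, F₅⟩, f4, f5, f45, f54⟩⟩ := E
    rw [← card_selfOrthogonal_hasPieces_eq_zpow hγ h2 f1 f2 f3 f4 f5 f12 f23 f31 f22 f45 f54]
    congr 1
    have key : ∀ C, HasPieces F₁ F₂ F₃ F₄ F₅ 5 C.1 →
        E₁ C = F₁ ∧ E₂ C = F₂ ∧ E₃ C = F₃ ∧ E₄ C = F₄ ∧ E₅ C = F₅ :=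
      fun C h => (hp C).unique hγ h
    have htype : ∀ C : Submodule R (Ambient γ N₁ N₂), HasPieces F₁ F₂ F₃ F₄ F₅ 5 C →
        HasType C k₀ k₁ k₂ l₀ l₁ := fun C h =>
      (hasType_iff hγ).2 ⟨F₁, F₂, F₃, F₄, F₅, h, f1, f2, f3, f4, f5⟩
    refine Nat.card_congr ⟨fun C => ⟨C.1.1, ?_, C.1.2.1⟩,
      fun C => ⟨⟨C.1, C.2.2, htype C.1 C.2.1⟩, ?_⟩, fun C => rfl, fun C => rfl⟩
    · have h := hp C.1
      have hC := C.2
      simp only [Prod.mk.injEq, Subtype.mk.injEq] at hC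
      obtain ⟨⟨e1, e2, e3⟩, e4, e5⟩ := hC
      rw [e1, e2, e3, e4, e5] at h
      exact h
    · obtain ⟨e1, e2, e3, e4, e5⟩ := key ⟨C.1, C.2.2, htype C.1 C.2.1⟩ C.2.1
      exact Prod.ext (Subtype.ext (Prod.ext e1 (Prod.ext e2 e3))) (Subtype.ext (Prod.ext e4 e5))

theorem Nat.cast_card_eq_sum_of_mem {α : Type*} [Finite α] (p : α → Prop) (g : α → ℕ)
    (s : Finset ℕ) (h : ∀ a, p a → g a ∈ s) :
    (Nat.card {a // p a} : ℚ) = ∑ k ∈ s, (Nat.card {a // p a ∧ g a = k} : ℚ) := by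
  classical
  have := Fintype.ofFinite α
  simp only [Nat.card_eq_fintype_card, Fintype.card_subtype]
  rw [Finset.card_eq_sum_card_fiberwise (f := g) (t := s) fun a ha => h a (by simpa using ha),
    Nat.cast_sum]
  simp only [Finset.filter_filter]

/-- The number of all self-orthogonal codes. -/
theorem card_selfOrthogonal [Finite R] (hγ : IsChainRing3 R γ) (h2 : (2 : ResidueField R) ≠ 0) :
    (Nat.card {C : Submodule R (Ambient γ N₁ N₂) // IsSelfOrthogonal hγ.pow_three C} : ℚ) =
      enumSum (ResidueField R) N₁ N₂ := by
  have := finite_chainQuot (γ := γ)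
  have hF : Finite (ResidueField R) := Finite.of_surjective _ (residue_surjective (R := R))
  have hE : ∀ C : Submodule R (Ambient γ N₁ N₂), ∃ k₀ k₁ k₂ l₀ l₁, HasType C k₀ k₁ k₂ l₀ l₁ :=
    fun C => by
    obtain ⟨E₁, E₂, E₃, E₄, E₅, h⟩ := _root_.exists_hasPieces hγ C
    obtain ⟨h12, h23, h45⟩ := h.monotone hγ
    have f12 := Submodule.finrank_mono h12
    have f23 := Submodule.finrank_mono h23
    have f45 := Submodule.finrank_mono h45
    exact ⟨_, Module.finrank (ResidueField R) E₂ - Module.finrank (ResidueField R) E₁,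
      Module.finrank (ResidueField R) E₃ - Module.finrank (ResidueField R) E₂, _,
      Module.finrank (ResidueField R) E₅ - Module.finrank (ResidueField R) E₄,
      (hasType_iff hγ).2 ⟨E₁, E₂, E₃, E₄, E₅, h, rfl, by omega, by omega, rfl, by omega⟩⟩
  choose k₀ k₁ k₂ l₀ l₁ hT using hE
  have hiff : ∀ C a₀ a₁ a₂ b₀ b₁, HasType C a₀ a₁ a₂ b₀ b₁ ↔
      (((k₀ C = a₀ ∧ k₁ C = a₁) ∧ k₂ C = a₂) ∧ l₀ C = b₀) ∧ l₁ C = b₁ := by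
    intro C a₀ a₁ a₂ b₀ b₁
    constructor
    · intro h
      obtain ⟨E₁, E₂, E₃, E₄, E₅, hE, e1, e2, e3, e4, e5⟩ := (hasType_iff hγ).1 h
      obtain ⟨E₁', E₂', E₃', E₄', E₅', hE', e1', e2', e3', e4', e5'⟩ := (hasType_iff hγ).1 (hT C)
      obtain ⟨rfl, rfl, rfl, rfl, rfl⟩ := hE.unique hγ hE'
      omega
    · rintro ⟨⟨⟨⟨rfl, rfl⟩, rfl⟩, rfl⟩, rfl⟩
      exact hT C
  have hb : ∀ C, IsSelfOrthogonal hγ.pow_three C → 2 * k₀ C + 2 * k₁ C ≤ N₁ ∧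
      2 * k₀ C + k₁ C + k₂ C ≤ N₁ ∧ 2 * l₀ C + l₁ C ≤ N₂ := fun C hC => by
    obtain ⟨E₁, E₂, E₃, E₄, E₅, hE, e1, e2, e3, e4, e5⟩ := (hasType_iff hγ).1 (hT C)
    exact hE.bounds hγ hC e1 e2 e3 e4 e5
  -- Each code has exactly one type, and self-orthogonality confines it to the ranges of summation;
  -- the sums are split off one parameter at a time.
  rw [enumSum, Nat.cast_card_eq_sum_of_mem _ k₀ (Finset.Icc 0 (N₁ / 2)) fun C hC => by
    have := hb C hC
    rw [Finset.mem_Icc]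
    omega]
  refine Finset.sum_congr rfl fun a₀ _ => ?_
  rw [Nat.cast_card_eq_sum_of_mem _ k₁ (Finset.Icc 0 (N₁ / 2 - a₀)) fun C hC => by
    have := hb C hC.1
    rw [Finset.mem_Icc]
    omega]
  refine Finset.sum_congr rfl fun a₁ _ => ?_
  rw [Nat.cast_card_eq_sum_of_mem _ k₂ (Finset.Icc 0 (N₁ - 2 * a₀ - a₁)) fun C hC => by
    have := hb C hC.1.1
    rw [Finset.mem_Icc]
    omega]
  refine Finset.sum_congr rfl fun a₂ _ => ?_
  rw [Nat.cast_card_eq_sum_of_mem _ l₀ (Finset.Icc 0 (N₂ / 2)) fun C hC => by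
    have := hb C hC.1.1.1
    rw [Finset.mem_Icc]
    omega]
  refine Finset.sum_congr rfl fun b₀ _ => ?_
  rw [Nat.cast_card_eq_sum_of_mem _ l₁ (Finset.Icc 0 (N₂ - 2 * b₀)) fun C hC => by
    have := hb C hC.1.1.1.1
    rw [Finset.mem_Icc]
    omega]
  refine Finset.sum_congr rfl fun b₁ _ => ?_
  rw [← card_selfOrthogonal_hasType hγ h2]
  congr 1
  refine Nat.card_congr (Equiv.subtypeEquivRight fun C => ?_)
  rw [hiff]
  tauto

end Enumeration

/-! ### The chain ring `ℤ/p³` -/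

section ZModChain

open IsLocalRing

/-- The characteristic 2m + 1 of R is zero in the residue field, so 2 = 0 there would give 1 = 0. -/
theorem IsLocalRing.residueField_two_ne_zero {R : Type*} [CommRing R] [IsLocalRing R]
    (hR : Odd (ringChar R)) : (2 : ResidueField R) ≠ 0 := by
  intro h2
  obtain ⟨m, hm⟩ := hR
  have h : ((ringChar R : R)) = 0 := ringChar.Nat.cast_ringChar
  have h3 := congrArg (residue R) h
  rw [hm] at h3
  push_cast at h3
  rw [map_add, map_mul, map_ofNat, h2, zero_mul, zero_add, map_one, map_zero] at h3
  exact one_ne_zero h3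

theorem ZMod.castHom_eq_zero_iff {m n : ℕ} [NeZero n] (h : m ∣ n) (x : ZMod n) :
    ZMod.castHom h (ZMod m) x = 0 ↔ (m : ZMod n) ∣ x := by
  constructor
  · intro hx
    rw [← ZMod.natCast_zmod_val x, map_natCast, ZMod.natCast_eq_zero_iff] at hx
    rw [← ZMod.natCast_zmod_val x]
    exact Nat.cast_dvd_cast hx
  · rintro ⟨y, rfl⟩
    rw [map_mul, map_natCast, ZMod.natCast_self, zero_mul]

variable (p : ℕ) [Fact p.Prime]

theorem ZMod.isUnit_iff_castHom_ne_zero {e : ℕ} (he : e ≠ 0) (x : ZMod (p ^ e)) :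
    IsUnit x ↔ ZMod.castHom (dvd_pow_self p he) (ZMod p) x ≠ 0 := by
  have hp : p.Prime := Fact.out
  have : NeZero (p ^ e) := ⟨pow_ne_zero _ hp.ne_zero⟩
  rw [← ZMod.natCast_zmod_val x, map_natCast, ZMod.isUnit_iff_coprime, Ne,
    ZMod.natCast_eq_zero_iff, Nat.coprime_pow_right_iff (Nat.pos_of_ne_zero he), Nat.coprime_comm,
    hp.coprime_iff_not_dvd]

theorem ZMod.isLocalRing_prime_pow {e : ℕ} (he : e ≠ 0) : IsLocalRing (ZMod (p ^ e)) := by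
  have hp : p.Prime := Fact.out
  have : Fact (1 < p ^ e) := ⟨Nat.one_lt_pow he hp.one_lt⟩
  refine IsLocalRing.of_nonunits_add fun a b ha hb => ?_
  rw [mem_nonunits_iff, ZMod.isUnit_iff_castHom_ne_zero p he, not_not] at ha hb ⊢
  rw [map_add, ha, hb, add_zero]

theorem ZMod.isChainRing3_prime_pow [IsLocalRing (ZMod (p ^ 3))] :
    IsChainRing3 (ZMod (p ^ 3)) (p : ZMod (p ^ 3)) := by
  have hp : p.Prime := Fact.out
  have : NeZero (p ^ 3) := ⟨pow_ne_zero _ hp.ne_zero⟩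
  refine ⟨?_, ?_, ?_⟩
  · ext x
    rw [mem_maximalIdeal, mem_nonunits_iff, ZMod.isUnit_iff_castHom_ne_zero p three_ne_zero,
      not_not, ZMod.castHom_eq_zero_iff, Ideal.mem_span_singleton]
  · exact_mod_cast ZMod.natCast_self (p ^ 3)
  · intro h
    rw [← Nat.cast_pow, ZMod.natCast_eq_zero_iff] at h
    have := (Nat.pow_dvd_pow_iff_le_right hp.one_lt).1 h
    omega

theorem ZMod.nonempty_residueField_equiv [IsLocalRing (ZMod (p ^ 3))] :
    Nonempty (ResidueField (ZMod (p ^ 3)) ≃+* ZMod p) := by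
  have h : maximalIdeal (ZMod (p ^ 3)) =
      RingHom.ker (ZMod.castHom (dvd_pow_self p three_ne_zero) (ZMod p)) := by
    ext x
    rw [mem_maximalIdeal, mem_nonunits_iff, ZMod.isUnit_iff_castHom_ne_zero p three_ne_zero,
      not_not, RingHom.mem_ker]
  exact ⟨(Ideal.quotEquivOfEq h).trans (RingHom.quotientKerEquivOfSurjective
    (ZMod.castHom_surjective _))⟩

theorem ZMod.nonempty_chainQuot_equiv :
    Nonempty (ZMod (p ^ 2) ≃+* ChainQuot (p : ZMod (p ^ 3))) := by
  have hp : p.Prime := Fact.out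
  have : NeZero (p ^ 3) := ⟨pow_ne_zero _ hp.ne_zero⟩
  have h : Ideal.span {(p : ZMod (p ^ 3)) ^ 2} =
      RingHom.ker (ZMod.castHom (pow_dvd_pow p (by norm_num : 2 ≤ 3)) (ZMod (p ^ 2))) := by
    ext x
    rw [RingHom.mem_ker, ZMod.castHom_eq_zero_iff, Ideal.mem_span_singleton, Nat.cast_pow]
  exact ⟨((Ideal.quotEquivOfEq h).trans (RingHom.quotientKerEquivOfSurjective
    (ZMod.castHom_surjective _))).symm⟩

/-- Besides the cardinality, the formula depends on the field only through whether (-1)^(n/2) is a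
square. This allows replacing the residue field of ℤ/p³ by ℤ/p. -/
theorem enumSum_congr {F F' : Type*} [Field F] [Field F'] (e : F ≃+* F') (N₁ N₂ : ℕ) :
    enumSum F N₁ N₂ = enumSum F' N₁ N₂ := by
  have hcard : Nat.card F = Nat.card F' := Nat.card_congr e.toEquiv
  have hν : ∀ n, nuSign F n = nuSign F' n := fun n => by
    have : IsSquare ((-1 : F) ^ (n / 2)) ↔ IsSquare ((-1 : F') ^ (n / 2)) := by
      rw [show (-1 : F') ^ (n / 2) = e ((-1 : F) ^ (n / 2)) by simp]
      refine ⟨fun h => h.map e, fun h => ?_⟩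
      have := h.map e.symm
      rwa [RingEquiv.symm_apply_apply] at this
    by_cases hs : IsSquare ((-1 : F) ^ (n / 2))
    · rw [nuSign, nuSign, if_pos hs, if_pos (this.1 hs)]
    · rw [nuSign, nuSign, if_neg hs, if_neg (mt this.2 hs)]
  simp only [enumSum, typeTerm, sigmaNum, hcard, hν]

end ZModChain

/-! ### Coordinates on an Eisenstein extension -/

namespace IsEisensteinData

variable {p r k t : ℕ} {h : (ZMod (p ^ 3))[X]} {g : (AdjoinRoot h)[X]}

theorem eq_zero_of_grCoeff (H : IsEisensteinData p r k t h g) {a : AdjoinRoot h}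
    (ha : ∀ s < r, H.grCoeff s a = 0) : a = 0 := by
  refine (AdjoinRoot.isAdjoinRootMonic h H.h_monic).basis.ext_elem fun i => ?_
  rw [IsAdjoinRootMonic.basis_repr, map_zero]
  exact ha i (i.2.trans_eq H.h_natDegree)

theorem exists_grCoeff (H : IsEisensteinData p r k t h g) (c : ℕ → ZMod (p ^ 3)) :
    ∃ a, ∀ s < r, H.grCoeff s a = c s := by
  let b := (AdjoinRoot.isAdjoinRootMonic h H.h_monic).basis
  refine ⟨b.equivFun.symm fun i => c i, fun s hs => ?_⟩
  have h1 := b.equivFun_apply (b.equivFun.symm fun i => c i)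
  rw [LinearEquiv.apply_symm_apply] at h1
  have h2 := congrFun h1 ⟨s, hs.trans_eq H.h_natDegree.symm⟩
  rw [IsAdjoinRootMonic.basis_repr] at h2
  exact h2.symm

theorem coeff_modByMonic_eq_zero (H : IsEisensteinData p r k t h g) (f : (AdjoinRoot h)[X])
    {i : ℕ} (hi : k ≤ i) : (f %ₘ g).coeff i = 0 := by
  rcases subsingleton_or_nontrivial (AdjoinRoot h) with hs | hs
  · exact Subsingleton.elim _ _
  · refine coeff_eq_zero_of_degree_lt ((degree_modByMonic_lt f H.g_monic).trans_le ?_)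
    refine degree_le_of_natDegree_le ?_
    rw [H.g_natDegree]
    exact hi

theorem modByMonic_eq_self (H : IsEisensteinData p r k t h g) {f : (AdjoinRoot h)[X]}
    (hf : ∀ i, k ≤ i → f.coeff i = 0) : f %ₘ g = f := by
  rcases subsingleton_or_nontrivial (AdjoinRoot h) with hs | hs
  · exact Subsingleton.elim _ _
  · rw [modByMonic_eq_self_iff H.g_monic, degree_eq_natDegree H.g_monic.ne_zero,
      degree_lt_iff_coeff_zero, H.g_natDegree]
    exact hf

/-- If all coordinates vanish, the remainder of f modulo g has zero coefficients below y^t and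
coefficients divisible by p² from y^t on. It is thus a multiple of p² y^t and lies in the ideal. -/
theorem psi_injective [Fact p.Prime] (H : IsEisensteinData p r k t h g) :
    Function.Injective H.psi := by
  have hp : p.Prime := Fact.out
  have : NeZero (p ^ 3) := ⟨pow_ne_zero _ hp.ne_zero⟩
  rw [injective_iff_map_eq_zero]
  intro x hx
  obtain ⟨f, rfl⟩ := Ideal.Quotient.mk_surjective x
  replace hx : H.prePsi f = 0 := hx
  have h1 : ∀ i < t, (f %ₘ g).coeff i = 0 := fun i hi =>
    H.eq_zero_of_grCoeff fun s hs => congrFun (congrArg Prod.fst hx) (⟨i, hi⟩, ⟨s, hs⟩)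
  have h2 : ∀ i, ∃ b, (f %ₘ g).coeff (t + i) = (p : AdjoinRoot h) ^ 2 * b := fun i => by
    rcases le_or_gt k (t + i) with hi | hi
    · exact ⟨0, by rw [H.coeff_modByMonic_eq_zero f hi, mul_zero]⟩
    · have h3 : ∀ s, ∃ y, s < r → H.grCoeff s ((f %ₘ g).coeff (t + i)) = (p ^ 2 : ℕ) * y :=
        fun s => by
        by_cases hs : s < r
        · have h4 := congrFun (congrArg Prod.snd hx) (⟨i, by omega⟩, ⟨s, hs⟩)
          obtain ⟨y, hy⟩ := (ZMod.castHom_eq_zero_iff _ _).1 h4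
          exact ⟨y, fun _ => hy⟩
        · exact ⟨0, fun h => absurd h hs⟩
      choose y hy using h3
      obtain ⟨b, hb⟩ := H.exists_grCoeff y
      refine ⟨b, ?_⟩
      rw [← sub_eq_zero]
      refine H.eq_zero_of_grCoeff fun s hs => ?_
      have h5 : (p : AdjoinRoot h) ^ 2 * b = (p ^ 2 : ℕ) • b := by
        rw [nsmul_eq_mul, Nat.cast_pow]
      rw [map_sub, hy s hs, h5, map_nsmul, hb s hs, nsmul_eq_mul, sub_self]
  choose b hb using h2
  have h3 : f %ₘ g = (∑ i ∈ Finset.range (k - t), C (b i) * X ^ i) *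
      (C ((p : AdjoinRoot h) ^ 2) * X ^ t) := by
    ext i
    rw [mul_comm (C _) (X ^ t), ← mul_assoc, coeff_mul_C, coeff_mul_X_pow']
    split_ifs with hi
    · obtain ⟨j, rfl⟩ := Nat.exists_eq_add_of_le hi
      rw [Nat.add_sub_cancel_left, finsetSum_coeff]
      simp only [coeff_C_mul_X_pow]
      rw [Finset.sum_ite_eq]
      split_ifs with hj
      · rw [hb, mul_comm]
      · rw [Finset.mem_range, not_lt] at hj
        rw [zero_mul, H.coeff_modByMonic_eq_zero f (by omega)]
    · rw [zero_mul, h1 i (by omega)]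
  refine Ideal.Quotient.eq_zero_iff_mem.2 ?_
  rw [← modByMonic_add_div f g, h3]
  exact Ideal.mem_span_pair.2 ⟨f /ₘ g, ∑ i ∈ Finset.range (k - t), C (b i) * X ^ i, by ring⟩

/-- Any coordinates are those of a polynomial of degree less than k, which is its own remainder
modulo g; residues modulo p² are first lifted to ℤ/p³. -/
theorem psi_surjective (H : IsEisensteinData p r k t h g) : Function.Surjective H.psi := by
  intro c
  have hex : ∀ i, ∃ a : AdjoinRoot h, (∀ (hi : i < t) (s : Fin r), H.grCoeff s a = c.1 (⟨i, hi⟩, s)) ∧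
      ∀ (hi : i - t < k - t) (s : Fin r), t ≤ i →
        ZMod.castHom (pow_dvd_pow p (by norm_num : 2 ≤ 3)) (ZMod (p ^ 2)) (H.grCoeff s a) =
          c.2 (⟨i - t, hi⟩, s) := fun i => by
    rcases lt_or_ge i t with hi | hi
    · obtain ⟨a, ha⟩ := H.exists_grCoeff fun s => if hs : s < r then c.1 (⟨i, hi⟩, ⟨s, hs⟩) else 0
      exact ⟨a, fun _ s => by rw [ha s s.2, dif_pos s.2], fun _ _ h => absurd h (by omega)⟩
    · by_cases hik : i - t < k - t
      · choose z hz using fun s : Fin r => ZMod.castHom_surjective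
          (pow_dvd_pow p (by norm_num : 2 ≤ 3)) (c.2 (⟨i - t, hik⟩, s))
        obtain ⟨a, ha⟩ := H.exists_grCoeff fun s => if hs : s < r then z ⟨s, hs⟩ else 0
        exact ⟨a, fun h => absurd h (by omega), fun _ s _ => by rw [ha s s.2, dif_pos s.2, hz]⟩
      · exact ⟨0, fun h => absurd h (by omega), fun h => absurd h hik⟩
  choose a ha1 ha2 using hex
  let f : (AdjoinRoot h)[X] := ∑ i ∈ Finset.range k, C (a i) * X ^ i
  have hcoeff : ∀ i, f.coeff i = if i < k then a i else 0 := fun i => by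
    rw [finsetSum_coeff]
    simp only [coeff_C_mul_X_pow]
    rw [Finset.sum_ite_eq]
    simp only [Finset.mem_range]
  have hf : f %ₘ g = f := H.modByMonic_eq_self fun i hi => by rw [hcoeff, if_neg (by omega)]
  have ht := H.t_le
  refine ⟨Ideal.Quotient.mk _ f, ?_⟩
  change H.prePsi f = c
  refine Prod.ext (funext fun x => ?_) (funext fun x => ?_)
  · change H.grCoeff x.2 ((f %ₘ g).coeff x.1) = _
    rw [hf, hcoeff, if_pos (by omega), ha1 _ x.1.2]
  · have hx := x.1.2
    change ZMod.castHom _ _ (H.grCoeff x.2 ((f %ₘ g).coeff (t + x.1))) = _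
    rw [hf, hcoeff, if_pos (by omega), ha2 _ (by omega) x.2 (by omega)]
    exact congrArg c.2 (Prod.ext (Fin.ext (Nat.add_sub_cancel_left t x.1)) rfl)

end IsEisensteinData

/-! ### Additive codes as codes over `ℤ/p³` and `ℤ/p²` -/

namespace IsEisensteinData

open IsLocalRing

variable {p r k t : ℕ} {h : (ZMod (p ^ 3))[X]} {g : (AdjoinRoot h)[X]} {N : ℕ}

/-- The coordinates of the entries of a word over an Eisenstein extension, arranged as a word over
the mixed alphabet `(ℤ/p³, ℤ/p²)`. -/
noncomputable def wordHom (H : IsEisensteinData p r k t h g) (ι : ZMod (p ^ 2) ≃+* ChainQuot (p : ZMod (p ^ 3)))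
    (e₁ : Fin (N * r * t) ≃ Fin N × Fin t × Fin r)
    (e₂ : Fin (N * r * (k - t)) ≃ Fin N × Fin (k - t) × Fin r) :
    (Fin N → EisRing t g) →+ Ambient (p : ZMod (p ^ 3)) (N * r * t) (N * r * (k - t)) where
  toFun c := (fun i => (H.psi (c (e₁ i).1)).1 (e₁ i).2,
    fun j => ι ((H.psi (c (e₂ j).1)).2 (e₂ j).2))
  map_zero' := by
    refine Prod.ext (funext fun i => ?_) (funext fun j => ?_) <;> simp
  map_add' c d := by
    refine Prod.ext (funext fun i => ?_) (funext fun j => ?_) <;> simp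

variable (H : IsEisensteinData p r k t h g) (ι : ZMod (p ^ 2) ≃+* ChainQuot (p : ZMod (p ^ 3)))
  (e₁ : Fin (N * r * t) ≃ Fin N × Fin t × Fin r)
  (e₂ : Fin (N * r * (k - t)) ≃ Fin N × Fin (k - t) × Fin r)

theorem wordHom_bijective [Fact p.Prime] : Function.Bijective (H.wordHom ι e₁ e₂) := by
  constructor
  · intro c d hcd
    refine funext fun n => H.psi_injective (Prod.ext (funext fun x => ?_) (funext fun x => ?_))
    · have := congrFun (congrArg Prod.fst hcd) (e₁.symm (n, x))
      simpa [wordHom] using this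
    · have := congrFun (congrArg Prod.snd hcd) (e₂.symm (n, x))
      simpa [wordHom] using this
  · intro m
    choose c hc using fun n : Fin N => H.psi_surjective
      (fun x => m.1 (e₁.symm (n, x)), fun x => ι.symm (m.2 (e₂.symm (n, x))))
    refine ⟨c, Prod.ext (funext fun i => ?_) (funext fun j => ?_)⟩
    · change (H.psi (c (e₁ i).1)).1 (e₁ i).2 = m.1 i
      rw [hc]
      simp
    · change ι ((H.psi (c (e₂ j).1)).2 (e₂ j).2) = m.2 j
      rw [hc]
      simp

/-- Any ring isomorphism sends the class of a natural number to its class, so the value does not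
depend on the choice of ι. -/
theorem gammaMul_ringEquiv [Fact p.Prime] (hγ : (p : ZMod (p ^ 3)) ^ 3 = 0) (a : ZMod (p ^ 2)) :
    gammaMul hγ (ι a) = ((p * a.val : ℕ) : ZMod (p ^ 3)) := by
  have : NeZero (p ^ 2) := ⟨pow_ne_zero _ (Fact.out : p.Prime).ne_zero⟩
  conv_lhs => rw [← ZMod.natCast_zmod_val a, map_natCast,
    ← map_natCast (algebraMap (ZMod (p ^ 3)) (ChainQuot (p : ZMod (p ^ 3)))), gammaMul_algebraMap]
  rw [Nat.cast_mul]

theorem euclForm_wordHom [Fact p.Prime] (hγ : (p : ZMod (p ^ 3)) ^ 3 = 0)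
    (d c : Fin N → EisRing t g) :
    euclForm hγ (H.wordHom ι e₁ e₂ d) (H.wordHom ι e₁ e₂ c) =
      ((∑ n, (∑ x, ((H.psi (d n)).1 x * (H.psi (c n)).1 x).val +
        ∑ x, p * ((H.psi (d n)).2 x * (H.psi (c n)).2 x).val) : ℕ) : ZMod (p ^ 3)) := by
  have : NeZero (p ^ 3) := ⟨pow_ne_zero _ (Fact.out : p.Prime).ne_zero⟩
  rw [Finset.sum_add_distrib, Nat.cast_add, euclForm, map_sum]
  congr 1
  · rw [← Fintype.sum_prod_type', Nat.cast_sum, ← Equiv.sum_comp e₁]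
    refine Finset.sum_congr rfl fun i _ => ?_
    rw [ZMod.natCast_zmod_val]
    rfl
  · rw [← Fintype.sum_prod_type', Nat.cast_sum, ← Equiv.sum_comp e₂]
    refine Finset.sum_congr rfl fun i _ => ?_
    rw [← gammaMul_ringEquiv ι hγ, map_mul ι]
    rfl

/-- The exponents of ξ add up to a natural number whose class modulo p³ is the Euclidean form of the
coordinate words, and ξ has order exactly p³. -/
theorem prod_chi_eq_one_iff [Fact p.Prime] (hγ : (p : ZMod (p ^ 3)) ^ 3 = 0) {ξ : ℂ}
    (hξ : IsPrimitiveRoot ξ (p ^ 3)) (d c : Fin N → EisRing t g) :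
    ∏ i, H.chi ξ (d i) (c i) = 1 ↔
      euclForm hγ (H.wordHom ι e₁ e₂ d) (H.wordHom ι e₁ e₂ c) = 0 := by
  simp only [chi, Finset.prod_pow_eq_pow_sum, ← pow_add]
  rw [hξ.pow_eq_one_iff_dvd, euclForm_wordHom, ZMod.natCast_eq_zero_iff]

/-- Additive codes over an Eisenstein extension correspond to linear codes over the mixed alphabet
`(ℤ/p³, ℤ/p²)`. -/
noncomputable def codeEquiv [Fact p.Prime] : AddSubgroup (Fin N → EisRing t g) ≃
    Submodule (ZMod (p ^ 3)) (Ambient (p : ZMod (p ^ 3)) (N * r * t) (N * r * (k - t))) :=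
  (AddEquiv.ofBijective _ (H.wordHom_bijective ι e₁ e₂)).mapAddSubgroup.toEquiv.trans
    (AddSubgroup.toZModSubmodule (p ^ 3)).toEquiv

theorem isChiSelfOrthogonal_iff [Fact p.Prime] (hγ : (p : ZMod (p ^ 3)) ^ 3 = 0) {ξ : ℂ}
    (hξ : IsPrimitiveRoot ξ (p ^ 3)) (C : AddSubgroup (Fin N → EisRing t g)) :
    H.IsChiSelfOrthogonal ξ C ↔ IsSelfOrthogonal hγ (H.codeEquiv ι e₁ e₂ C) := by
  constructor
  · rintro hC _ ⟨d, hd, rfl⟩ _ ⟨c, hc, rfl⟩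
    exact (H.prod_chi_eq_one_iff ι e₁ e₂ hγ hξ d c).1 (hC d hd c hc)
  · intro hC d hd c hc
    exact (H.prod_chi_eq_one_iff ι e₁ e₂ hγ hξ d c).2
      (hC _ ⟨d, hd, rfl⟩ _ ⟨c, hc, rfl⟩)

theorem card_chiSelfOrthogonal [Fact p.Prime] (hp2 : Odd p) {ξ : ℂ}
    (hξ : IsPrimitiveRoot ξ (p ^ 3)) :
    (Nat.card {C : AddSubgroup (Fin N → EisRing t g) // H.IsChiSelfOrthogonal ξ C} : ℚ) =
      enumSum (ZMod p) (N * r * t) (N * r * (k - t)) := by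
  have : NeZero (p ^ 3) := ⟨pow_ne_zero _ (Fact.out : p.Prime).ne_zero⟩
  have := ZMod.isLocalRing_prime_pow p three_ne_zero
  have hγ := ZMod.isChainRing3_prime_pow p
  obtain ⟨ι⟩ := ZMod.nonempty_chainQuot_equiv p
  obtain ⟨e⟩ := ZMod.nonempty_residueField_equiv p
  let e₁ : Fin (N * r * t) ≃ Fin N × Fin t × Fin r :=
    (Fintype.equivFinOfCardEq (by simp only [Fintype.card_prod, Fintype.card_fin]; ring)).symm
  let e₂ : Fin (N * r * (k - t)) ≃ Fin N × Fin (k - t) × Fin r :=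
    (Fintype.equivFinOfCardEq (by simp only [Fintype.card_prod, Fintype.card_fin]; ring)).symm
  have h2 : (2 : ResidueField (ZMod (p ^ 3))) ≠ 0 :=
    residueField_two_ne_zero (by rw [ZMod.ringChar_zmod_n]; exact hp2.pow)
  rw [← enumSum_congr e, ← card_selfOrthogonal hγ h2]
  exact congrArg _ (Nat.card_congr ((H.codeEquiv ι e₁ e₂).subtypeEquiv
    (H.isChiSelfOrthogonal_iff ι e₁ e₂ hγ.pow_three hξ)))

end IsEisensteinData

/-! ### The theorem -/

theorem theorem4p7 :
    -- Codes over a finite commutative chain ring of odd characteristic and nilpotency index 3: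
    (∀ (R : Type*) [CommRing R] [IsLocalRing R] [Finite R] (γ : R) (hγ : IsChainRing3 R γ)
        (_ : Odd (ringChar R)) (N₁ N₂ : ℕ),
      -- prescribed torsion codes,
      (∀ (k₀ k₁ k₂ l₀ l₁ : ℕ)
          (E₁ E₂ E₃ : Submodule (IsLocalRing.ResidueField R)
            (Fin N₁ → IsLocalRing.ResidueField R))
          (E₄ E₅ : Submodule (IsLocalRing.ResidueField R)
            (Fin N₂ → IsLocalRing.ResidueField R)),
          Module.finrank (IsLocalRing.ResidueField R) E₁ = k₀ →
          Module.finrank (IsLocalRing.ResidueField R) E₂ = k₀ + k₁ →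
          Module.finrank (IsLocalRing.ResidueField R) E₃ = k₀ + k₁ + k₂ →
          Module.finrank (IsLocalRing.ResidueField R) E₄ = l₀ →
          Module.finrank (IsLocalRing.ResidueField R) E₅ = l₀ + l₁ →
          E₁ ≤ E₂ → E₂ ≤ E₃ → LeDual E₃ E₁ → LeDual E₂ E₂ → E₄ ≤ E₅ → LeDual E₅ E₄ →
          (Set.ncard {C : Submodule R (Ambient γ N₁ N₂) |
              IsSelfOrthogonal hγ.pow_three C ∧ HasTorsionCodes C E₁ E₂ E₃ E₄ E₅} : ℚ) =
            (Nat.card (IsLocalRing.ResidueField R) : ℚ) ^ theta3 N₁ N₂ k₀ k₁ k₂ l₀ l₁) ∧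
      -- prescribed type,
      (∀ k₀ k₁ k₂ l₀ l₁ : ℕ,
          (Set.ncard {C : Submodule R (Ambient γ N₁ N₂) |
              IsSelfOrthogonal hγ.pow_three C ∧ HasType C k₀ k₁ k₂ l₀ l₁} : ℚ) =
            if 2 * k₀ + 2 * k₁ ≤ N₁ ∧ 2 * k₀ + k₁ + k₂ ≤ N₁ ∧ 2 * l₀ + l₁ ≤ N₂ then
              typeTerm (IsLocalRing.ResidueField R) N₁ N₂ k₀ k₁ k₂ l₀ l₁
            else 0) ∧
      -- and all codes.
      (Set.ncard {C : Submodule R (Ambient γ N₁ N₂) | IsSelfOrthogonal hγ.pow_three C} : ℚ) =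
        enumSum (IsLocalRing.ResidueField R) N₁ N₂) ∧
    -- Additive codes over an Eisenstein extension of a Galois ring of characteristic `p³`:
    (∀ (p r k t N : ℕ) [Fact p.Prime] (_ : Odd p) (h : (ZMod (p ^ 3))[X])
        (g : (AdjoinRoot h)[X]) (H : IsEisensteinData p r k t h g) (ξ : ℂ)
        (_ : IsPrimitiveRoot ξ (p ^ 3)),
      (Set.ncard {C : AddSubgroup (Fin N → EisRing t g) | H.IsChiSelfOrthogonal ξ C} : ℚ) =
        enumSum (ZMod p) (N * r * t) (N * r * (k - t))) := by
  refine ⟨fun R _ _ _ γ hγ hR N₁ N₂ => ?_, fun p r k t N _ hp h g H ξ hξ => ?_⟩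
  · have h2 := IsLocalRing.residueField_two_ne_zero hR
    refine ⟨fun k₀ k₁ k₂ l₀ l₁ E₁ E₂ E₃ E₄ E₅ hE₁ hE₂ hE₃ hE₄ hE₅ h12 h23 h31 h22 h45 h54 => ?_,
      fun k₀ k₁ k₂ l₀ l₁ => ?_, ?_⟩
    · rw [← Nat.card_coe_set_eq, ← card_selfOrthogonal_hasPieces_eq_zpow hγ h2 hE₁ hE₂ hE₃ hE₄ hE₅
        h12 h23 h31 h22 h45 h54]
      exact congrArg _ (Nat.card_congr (Equiv.subtypeEquivRight fun C =>
        (and_congr_right' (hasTorsionCodes_iff hγ)).trans and_comm))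
    · split_ifs with hk
      · rw [← Nat.card_coe_set_eq]
        exact card_selfOrthogonal_hasType hγ h2 k₀ k₁ k₂ l₀ l₁
      · rw [Nat.cast_eq_zero]
        -- Outside the stated range no self-orthogonal code has this type, since the orthogonality
        -- relations between its pieces bound their dimensions.
        refine (congrArg _ (Set.eq_empty_of_forall_notMem fun C hC => hk ?_)).trans (Set.ncard_empty _)
        obtain ⟨E₁, E₂, E₃, E₄, E₅, hP, hE₁, hE₂, hE₃, hE₄, hE₅⟩ := (hasType_iff hγ).1 hC.2
        exact hP.bounds hγ hC.1 hE₁ hE₂ hE₃ hE₄ hE₅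
    · rw [← Nat.card_coe_set_eq]
      exact card_selfOrthogonal hγ h2
  · rw [← Nat.card_coe_set_eq]
    exact H.card_chiSelfOrthogonal hp hξ
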